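/- **Setting.** An input is a sequence $P=(p_1,\dots,p_n)$ of points of $\mathbb R^2$, drawn from a product distribution $\mathcal D=\prod_i\mathcal D_i$ with continuous $\mathcal D_i$ (every line has $\mathcal D_i$-probability $0$). A point $p_i$ is *extremal* if it lies on the upper hull of $P$; $\mathrm{lss}(q,r)$ is the open region bounded by the segment $\overline{qr}$ and the downward vertical rays from $q$ and $r$; $(q,r)$ is a *witness pair* for $p$ if $p\in\mathrm{lss}(q,r)$. *Trees.* A linear comparison tree is a finite rooted binary tree whose inner nodes $v$ ask "$p_i\in\ell_v^+$?" (open left halfplane of a directed line $\ell_v$), where $\ell_v$ is fixed, or has a fixed slope and passes through an input point $p_j$, or passes through $p_j$ and a fixed point, or passes through two distinct input points $p_j,p_k$ (with $j,k\ne i$). The region $\mathcal R_v\subseteq\mathbb R^{2n}$ is the set of the inputs on which all comparisons on the path to $v$ have the respective strict outcome. $\mathcal T$ *computes* certificates of some kind if each leaf $v$ is labeled with a certificate that is valid for all $P\in\mathcal R_v$. $d_{\mathcal T}$ is the expected depth, under $\mathcal D$, of the leaf reached. $\mathcal T$ is *entropy-sensitive* if every inner node $v$ of depth at most $n^2$ asks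 about a point $p_j$ and a fixed line $\ell_v$ (so that $\mathcal R_v=\prod_i R_i$) with $\Pr[p_j\in\ell_v^+\cap R_j]=\Pr[p_j\in\ell_v^-\cap R_j]$. *Hull certificates.* A convex hull certificate consists of the indices of the extremal points, sorted from left to right, and a witness pair for each non-extremal point; $\mathcal T$ *computes the upper hull* if it computes such certificates. The certificate is *extremal* if all witness pairs consist of extremal points. *Canonical hull.* Let $v_1,\dots,v_k$ be unit vectors pointing upwards, in clockwise order, and $\ell_i$ a line normal to $v_i$, with $\ell_i^+$ the open halfplane above it and $\ell_i^-$ the one below. The canonical hull is $\mathcal C=\bigcap_i\ell_i^-$. With constants $c,K$, the learning phase is *successful* if $k\le Kn/\log^2 n$ and $\Pr_{P\sim\mathcal D}\bigl[|\ell_i^+\cap P|\in[1,c\log n]\bigr]\ge1-n^{-3}$ for all $i$. A point of $P$ is *$\mathbf V$-extremal* if it is, for some $i$, the lexicographically smallest maximizer $e_{v_i}$ of $\langle\cdot,v_i\rangle$ on $P$. The vertical lines through the vertices of $\mathcal C$ cut the plane into open *leaf slabs*; a *$\mathcal C$-slab* is an open slab formed by a contiguous nonempty sequence of them (possibly unbounded).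 For a bounded $\mathcal C$-slab $S$, $\mathrm{seg}(\mathcal C,S)$ is the segment between the two vertices of $\mathcal C$ on its boundary. For $p$ outside the closure of $\mathcal C$ let $a_1,a_2$ be the vertices where the left and right tangents from $p$ touch $\mathcal C$. The *pencil slab* of $p$ is bounded by the vertical lines through $a_1,a_2$, and the *pencil* of $p$ is the part of it below $\overline{a_1p}\cup\overline{pa_2}$. If $p$ lies above the line of the leftmost (rightmost) unbounded edge, the left (right) tangent touches at infinity: the slab is unbounded on this side, and the segment is replaced by the ray from $p$ in this direction parallel to that edge. *$\mathbf V$-extremal certificates* consist of the $\mathbf V$-extremal points, sorted from left to right, and for every other $p\in P$ either a witness pair of $\mathbf V$-extremal points, or two adjacent $\mathbf V$-extremal points $e_1,e_2$ with $x(e_1)\le x(p)\le x(e_2)$ (where $e_1$ or $e_2$ may be missing if there is no $\mathbf V$-extremal point on that side). *$\mathcal C$-certificates* consist of the $\mathbf V$-extremal points, sorted from left to right, and for every other $p\in P$ a $\mathcal C$-slab $S_p$ containing $p$ such that $S_p$ is a leaf slab, or $p$ lies below $\mathrm{seg}(\mathcal C,S_p)$, or $S_p$ is the pencil slab of a $\mathbf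 V$-extremal point whose pencil contains $p$. **Lemma.** For all constants $c,K$ there is a constant $A$ such that the following holds for all $n\ge2$, all continuous $\mathcal D_1,\dots,\mathcal D_n$, every canonical hull $\mathcal C$ from a successful learning phase with constants $c,K$, and every linear comparison tree $\mathcal T$ that computes the upper hull. 1. There is an entropy-sensitive linear comparison tree with expected depth at most $A\,(n+d_{\mathcal T})$ that computes $\mathcal C$-certificates. 2. There are linear comparison trees $\mathcal T_1,\mathcal T_2,\mathcal T_3$ computing extremal, $\mathbf V$-extremal and $\mathcal C$-certificates, respectively, such that $d_{\mathcal T_1}\le d_{\mathcal T}+An$, $d_{\mathcal T_2}\le d_{\mathcal T_1}+An$ and $d_{\mathcal T_3}\le d_{\mathcal T_2}+An$. -/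

import Mathlib

open MeasureTheory Set
open scoped NNReal ENNReal

/-- The Euclidean plane; `p.1` is the x-coordinate and `p.2` the y-coordinate. -/
abbrev Plane : Type := ℝ × ℝ

/-- An input: a sequence of `n` points of the plane. -/
abbrev Input (n : ℕ) : Type := Fin n → Plane

/-- The determinant of `u` and `w`; it is positive iff `w` points to the left of `u`. -/
def cross (u w : Plane) : ℝ := u.1 * w.2 - u.2 * w.1

/-- The scalar product. -/
def dot (u w : Plane) : ℝ := u.1 * w.1 + u.2 * w.2

/-- The point `p` lies strictly below some point of the set `A`. -/
def Below (p : Plane) (A : Set Plane) : Prop := ∃ y : ℝ, p.2 < y ∧ (p.1, y) ∈ A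

/-! ### Distributions -/

/-- A continuous planar distribution: no line carries positive probability. -/
def IsContinuousDist (μ : Measure Plane) : Prop :=
  ∀ a b c : ℝ, (a, b) ≠ ((0, 0) : Plane) → μ {p : Plane | a * p.1 + b * p.2 = c} = 0

/-! ### Linear comparison trees -/

/-- A directed line, by a point on it and its direction. -/
structure DirLine where
  base : Plane
  dir : Plane

/-- The open halfplane to the left of a directed line. -/
def DirLine.left (l : DirLine) : Set Plane := {p | 0 < cross l.dir (p - l.base)}

/-- The open halfplane to the right of a directed line. -/
def DirLine.right (l : DirLine) : Set Plane := {p | cross l.dir (p - l.base) < 0}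

/-- The four ways in which a query line may depend on the input: a fixed line, a line of fixed
slope through an input point, a line through a fixed point and an input point, and a line
through two distinct input points. -/
inductive LineSpec (n : ℕ) : Type
  | fixed (a d : Plane) (hd : d ≠ 0)
  | slope (j : Fin n) (d : Plane) (hd : d ≠ 0)
  | pivot (q : Plane) (j : Fin n)
  | pair (j k : Fin n) (hjk : j ≠ k)

namespace LineSpec

/-- The directed line on input `P`. The opposite direction of a line only exchanges the
two outcomes of a query. -/
def line {n : ℕ} (P : Input n) : LineSpec n → DirLine
  | fixed a d _ => ⟨a, d⟩
  | slope j d _ => ⟨P j, d⟩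
  | pivot q j => ⟨q, P j - q⟩
  | pair j k _ => ⟨P j, P k - P j⟩

/-- The input points through which the line is drawn. -/
def Uses {n : ℕ} : LineSpec n → Fin n → Prop
  | fixed _ _ _, _ => False
  | slope j _ _, i => i = j
  | pivot _ j, i => i = j
  | pair j k _, i => i = j ∨ i = k

end LineSpec

/-- A query "is the input point `pt` to the left of the line?". The line is not drawn through
the queried point itself. -/
structure Query (n : ℕ) where
  pt : Fin n
  spec : LineSpec n
  not_uses : ¬ spec.Uses pt

/-- The queried point lies strictly to the left of the query line. -/
def Query.IsLeft {n : ℕ} (q : Query n) (P : Input n) : Prop := P q.pt ∈ (q.spec.line P).left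

/-- The queried point lies strictly to the right of the query line. -/
def Query.IsRight {n : ℕ} (q : Query n) (P : Input n) : Prop := P q.pt ∈ (q.spec.line P).right

/-- Linear comparison trees on `n` points, with leaves labeled by elements of `α`. -/
inductive LinTree (n : ℕ) (α : Type) : Type
  | leaf (label : α) : LinTree n α
  | node (q : Query n) (l r : LinTree n α) : LinTree n α

namespace LinTree

variable {n : ℕ} {α : Type}

/-- `P` lies in the (open) region of some leaf with label `γ`: all comparisons on the path
to this leaf have the respective strict outcome on `P`. -/
def LeadsTo (P : Input n) : LinTree n α → α → Prop
  | leaf label, γ => label = γ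
  | node q l r, γ => (q.IsLeft P ∧ l.LeadsTo P γ) ∨ (q.IsRight P ∧ r.LeadsTo P γ)

/-- Every leaf is labeled with a certificate that is valid for every input in the region
of the leaf. -/
def Computes (valid : α → Input n → Prop) (T : LinTree n α) : Prop :=
  ∀ (P : Input n) (γ : α), T.LeadsTo P γ → valid γ P

open Classical in
/-- The depth of the leaf that the evaluation on `P` reaches. (A point on its query line,
an event of probability zero, goes to the right.) -/
noncomputable def leafDepth (P : Input n) : LinTree n α → ℕ
  | leaf _ => 0
  | node q l r => if q.IsLeft P then l.leafDepth P + 1 else r.leafDepth P + 1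

/-- The expected depth over the product distribution of the `D i`. -/
noncomputable def expectedDepth (D : Fin n → Measure Plane) (T : LinTree n α) : ℝ≥0∞ :=
  ∫⁻ P, (T.leafDepth P : ℝ≥0∞) ∂(Measure.pi D)

/-- The condition of entropy-sensitivity below a node of depth `d` whose region is the
product of the sets `R i`: if `d ≤ n ^ 2` and the node is a query node, the query compares some
`p_j` with a fixed line that is a halving line for `R j` with respect to `D j`, and the
condition holds at both children. -/
def EntropySensitiveFrom (D : Fin n → Measure Plane) :
    LinTree n α → (d : ℕ) → (R : Fin n → Set Plane) → Prop
  | leaf _, _, _ => True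
  | node q l r, d, R => d ≤ n ^ 2 →
      ∃ (a v : Plane) (hv : v ≠ 0), q.spec = LineSpec.fixed a v hv ∧
        D q.pt ((DirLine.mk a v).left ∩ R q.pt) = D q.pt ((DirLine.mk a v).right ∩ R q.pt) ∧
        l.EntropySensitiveFrom D (d + 1)
          (Function.update R q.pt (R q.pt ∩ (DirLine.mk a v).left)) ∧
        r.EntropySensitiveFrom D (d + 1)
          (Function.update R q.pt (R q.pt ∩ (DirLine.mk a v).right))

/-- Entropy-sensitive trees: all query nodes of depth at most `n ^ 2` use fixed lines, and these
are halving lines for the region of the queried point at this node. -/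
def EntropySensitive (D : Fin n → Measure Plane) (T : LinTree n α) : Prop :=
  T.EntropySensitiveFrom D 0 (fun _ => univ)

end LinTree

/-! ### Upper hull certificates -/

/-- `P i` appears on the upper hull of `P`: no point of the convex hull is vertically
above it. -/
def IsExtremal {n : ℕ} (P : Input n) (i : Fin n) : Prop :=
  ∀ q ∈ convexHull ℝ (range P), q.1 = (P i).1 → q.2 ≤ (P i).2

/-- The lower semislab of `q` and `r`: the open region below the segment from `q` to `r`. -/
def lss (q r : Plane) : Set Plane :=
  {p | min q.1 r.1 < p.1 ∧ p.1 < max q.1 r.1 ∧ Below p (segment ℝ q r)}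

/-- `l` lists exactly the indices with property `S`, sorted from left to right. -/
def IsSortedListOf {n : ℕ} (P : Input n) (S : Fin n → Prop) (l : List (Fin n)) : Prop :=
  (∀ i, i ∈ l ↔ S i) ∧ l.Pairwise (fun i j => (P i).1 < (P j).1)

/-- A convex hull certificate: a list of points, and a pair of points for every point (only
relevant at the non-extremal points). -/
structure HullCert (n : ℕ) where
  hull : List (Fin n)
  witness : Fin n → Fin n × Fin n

/-- The list contains the extremal points, and each non-extremal point has a witness pair. -/
def HullCert.Valid {n : ℕ} (γ : HullCert n) (P : Input n) : Prop :=
  IsSortedListOf P (IsExtremal P) γ.hull ∧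
    ∀ i, ¬ IsExtremal P i → P i ∈ lss (P (γ.witness i).1) (P (γ.witness i).2)

/-- A valid certificate all of whose witness pairs consist of extremal points. -/
def HullCert.ValidExtremal {n : ℕ} (γ : HullCert n) (P : Input n) : Prop :=
  γ.Valid P ∧
    ∀ i, ¬ IsExtremal P i → IsExtremal P (γ.witness i).1 ∧ IsExtremal P (γ.witness i).2

/-! ### Canonical directions, canonical lines and the canonical hull -/

/-- Canonical directions `dir i` (upward unit vectors in clockwise order), and for each of them
the line `{p | dot (dir i) p = height i}` normal to it. -/
structure CanonicalLines (k : ℕ) where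
  dir : Fin k → Plane
  height : Fin k → ℝ
  unit : ∀ i, dot (dir i) (dir i) = 1
  upward : ∀ i, 0 < (dir i).2
  clockwise : ∀ i j, i ≤ j → cross (dir i) (dir j) ≤ 0

/-- `P i` has maximum scalar product with `v` among the input points. -/
def IsExtremalFor {n : ℕ} (v : Plane) (P : Input n) (i : Fin n) : Prop :=
  ∀ j, dot v (P j) ≤ dot v (P i)

/-- `P i` is the point `e_v`: the lexicographically smallest input point extremal for `v`. -/
def IsCanonicalExtremalFor {n : ℕ} (v : Plane) (P : Input n) (i : Fin n) : Prop :=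
  IsExtremalFor v P i ∧ ∀ j, IsExtremalFor v P j → toLex (P i) ≤ toLex (P j)

/-- A vertical slab `{p | lo < x(p) < hi}`, possibly unbounded. -/
structure Slab where
  lo : EReal
  hi : EReal

/-- The open slab contains the point `p`. -/
def Slab.Contains (S : Slab) (p : Plane) : Prop := S.lo < (p.1 : EReal) ∧ (p.1 : EReal) < S.hi

namespace CanonicalLines

variable {k : ℕ} (L : CanonicalLines k)

/-- The open halfplane above the `i`-th canonical line. -/
def above (i : Fin k) : Set Plane := {p | L.height i < dot (L.dir i) p}

/-- The open halfplane below the `i`-th canonical line. -/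
def below (i : Fin k) : Set Plane := {p | dot (L.dir i) p < L.height i}

/-- The canonical hull. -/
def hull : Set Plane := ⋂ i, L.below i

/-- The vertices of the polygonal region `hull`. -/
def vertices : Set Plane := extremePoints ℝ (closure L.hull)

/-- `V`-extremal points. -/
def VExtremal {n : ℕ} (P : Input n) (i : Fin n) : Prop :=
  ∃ j : Fin k, IsCanonicalExtremalFor (L.dir j) P i

/-- Slabs bounded by vertical lines through vertices of the canonical hull; a slab may also be
unbounded to the left or to the right. -/
def IsSlab (S : Slab) : Prop :=
  S.lo < S.hi ∧ (S.lo = ⊥ ∨ ∃ a ∈ L.vertices, S.lo = (a.1 : EReal)) ∧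
    (S.hi = ⊤ ∨ ∃ a ∈ L.vertices, S.hi = (a.1 : EReal))

/-- A slab without a vertex of the canonical hull in its interior. -/
def IsLeafSlab (S : Slab) : Prop := L.IsSlab S ∧ ∀ a ∈ L.vertices, ¬ S.Contains a

/-- `p` lies below the segment between the two vertices of the canonical hull on the two
boundary lines of `S`; such a segment exists only if `S` is bounded. -/
def BelowSeg (S : Slab) (p : Plane) : Prop :=
  ∃ a ∈ L.vertices, ∃ b ∈ L.vertices,
    S.lo = (a.1 : EReal) ∧ S.hi = (b.1 : EReal) ∧ Below p (segment ℝ a b)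

/-- The tangent from `p` to the canonical hull that goes to the left touches it at `a`. -/
def IsLeftTangent (p a : Plane) : Prop :=
  a ∈ L.vertices ∧ a.1 < p.1 ∧ ∀ q ∈ L.hull, cross (p - a) (q - a) ≤ 0

/-- The tangent from `p` to the canonical hull that goes to the right touches it at `a`. -/
def IsRightTangent (p a : Plane) : Prop :=
  a ∈ L.vertices ∧ p.1 < a.1 ∧ ∀ q ∈ L.hull, cross (a - p) (q - p) ≤ 0

/-- The tangent segment from `p` to the left. If `p` lies above the line of the leftmost
(unbounded) edge, there is no left tangent vertex: the tangent touches at infinity, and the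
segment is the ray from `p` to the left parallel to this edge. -/
def leftArm (p : Plane) : Set Plane :=
  {z | ∃ a, L.IsLeftTangent p a ∧ z ∈ segment ℝ a p} ∪
  {z | (¬ ∃ a, L.IsLeftTangent p a) ∧ ∃ i : Fin k, (∀ j, i ≤ j) ∧
    ∃ t : ℝ, 0 ≤ t ∧ z = p + t • (-(L.dir i).2, (L.dir i).1)}

/-- The tangent segment, or ray, from `p` to the right. -/
def rightArm (p : Plane) : Set Plane :=
  {z | ∃ a, L.IsRightTangent p a ∧ z ∈ segment ℝ p a} ∪
  {z | (¬ ∃ a, L.IsRightTangent p a) ∧ ∃ i : Fin k, (∀ j, j ≤ i) ∧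
    ∃ t : ℝ, 0 ≤ t ∧ z = p + t • ((L.dir i).2, -(L.dir i).1)}

/-- `S` is the pencil slab of the point `p` outside the canonical hull: it is bounded by the
vertical lines through the points where the two tangents through `p` touch (and is unbounded on
a side where the tangent touches at infinity). -/
def IsPencilSlab (p : Plane) (S : Slab) : Prop :=
  p ∉ closure L.hull ∧
  ((∃ a, L.IsLeftTangent p a ∧ S.lo = (a.1 : EReal)) ∨
    ((¬ ∃ a, L.IsLeftTangent p a) ∧ S.lo = ⊥)) ∧
  ((∃ a, L.IsRightTangent p a ∧ S.hi = (a.1 : EReal)) ∨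
    ((¬ ∃ a, L.IsRightTangent p a) ∧ S.hi = ⊤))

/-- The pencil of `p`: the points inside the pencil slab below the two tangent segments. -/
def pencil (p : Plane) : Set Plane :=
  {q | (∃ S, L.IsPencilSlab p S ∧ S.Contains q) ∧ Below q (L.leftArm p ∪ L.rightArm p)}

end CanonicalLines

/-- The learning phase is successful (with constants `c` and `K`): there are at most
`K n / log² n` canonical directions, and for every `i`, with probability at least `1 - n⁻³`, the
number of input points above the `i`-th canonical line is in `[1, c log n]`. -/
def SuccessfulLearning {n k : ℕ} (D : Fin n → Measure Plane) (L : CanonicalLines k)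
    (c K : ℝ) : Prop :=
  (k : ℝ) ≤ K * (n / (Real.log n) ^ 2) ∧
  ∀ i : Fin k, 1 - 1 / (n : ℝ) ^ 3 ≤ (Measure.pi D).real
    {P : Input n | 1 ≤ {j : Fin n | P j ∈ L.above i}.ncard ∧
      ({j : Fin n | P j ∈ L.above i}.ncard : ℝ) ≤ c * Real.log n}

/-! ### `V`-extremal certificates and certificates for the canonical hull -/

/-- The information that a `V`-extremal certificate stores for a point. -/
inductive VInfo (n : ℕ) : Type
  | witness (q r : Fin n)
  | between (e₁ e₂ : Option (Fin n))

/-- Validity of the information for the point `P i`: either `q`, `r` is a witness pair of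
`V`-extremal points, or `e₁`, `e₂` are adjacent `V`-extremal points with
`x(e₁) ≤ x(P i) ≤ x(e₂)`. Here `none` stands for a missing neighbor, if no `V`-extremal point
is on the respective side. -/
def VInfo.Valid {n k : ℕ} (L : CanonicalLines k) (P : Input n) (i : Fin n) : VInfo n → Prop
  | witness q r => L.VExtremal P q ∧ L.VExtremal P r ∧ P i ∈ lss (P q) (P r)
  | between e₁ e₂ =>
      (∀ e ∈ e₁, L.VExtremal P e ∧ (P e).1 ≤ (P i).1) ∧
      (∀ e ∈ e₂, L.VExtremal P e ∧ (P i).1 ≤ (P e).1) ∧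
      (∀ e ∈ e₁, e ∉ e₂) ∧
      (∀ j, L.VExtremal P j →
        (∃ e ∈ e₁, (P j).1 ≤ (P e).1) ∨ (∃ e ∈ e₂, (P e).1 ≤ (P j).1))

/-- A `V`-extremal certificate. -/
structure VCert (n : ℕ) where
  list : List (Fin n)
  info : Fin n → VInfo n

/-- Validity of a `V`-extremal certificate. -/
def VCert.Valid {n k : ℕ} (L : CanonicalLines k) (γ : VCert n) (P : Input n) : Prop :=
  IsSortedListOf P (L.VExtremal P) γ.list ∧
    ∀ i, ¬ L.VExtremal P i → (γ.info i).Valid L P i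

/-- A certificate with respect to the canonical hull: a list of points, and a slab for every
point (only relevant at the points that are not `V`-extremal). -/
structure CanonicalCert (n : ℕ) where
  list : List (Fin n)
  slab : Fin n → Slab

/-- The list contains the `V`-extremal points, sorted from left to right, and for every other
point `p` there is a slab of the canonical hull that contains `p` and that is a leaf slab, or
is such that `p` lies below its segment, or is the pencil slab of a `V`-extremal point whose
pencil contains `p`. -/
def CanonicalCert.Valid {n k : ℕ} (L : CanonicalLines k) (γ : CanonicalCert n)
    (P : Input n) : Prop :=
  IsSortedListOf P (L.VExtremal P) γ.list ∧
    ∀ i, ¬ L.VExtremal P i →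
      L.IsSlab (γ.slab i) ∧ (γ.slab i).Contains (P i) ∧
        (L.IsLeafSlab (γ.slab i) ∨ L.BelowSeg (γ.slab i) (P i) ∨
          ∃ j, L.VExtremal P j ∧ L.IsPencilSlab (P j) (γ.slab i) ∧ P i ∈ L.pencil (P j))

/-! ### Combinators for linear comparison trees -/

namespace LinTree

variable {n : ℕ} {α β : Type}

/-- Run `T`, then continue with the tree that `f` assigns to the label found. -/
def bind : LinTree n α → (α → LinTree n β) → LinTree n β
  | leaf a, f => f a
  | node q l r, f => node q (l.bind f) (r.bind f)

/-- Relabel the leaves. -/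
def map (g : α → β) (T : LinTree n α) : LinTree n β := T.bind fun a => leaf (g a)

theorem leadsTo_bind {P : Input n} {T : LinTree n α} {f : α → LinTree n β} {b : β} :
    (T.bind f).LeadsTo P b ↔ ∃ a, T.LeadsTo P a ∧ (f a).LeadsTo P b := by
  induction T with
  | leaf a => simp [bind, LeadsTo]
  | node q l r hl hr =>
    simp only [bind, LeadsTo, hl, hr]
    constructor
    · rintro (⟨h, a, h1, h2⟩ | ⟨h, a, h1, h2⟩)
      exacts [⟨a, Or.inl ⟨h, h1⟩, h2⟩, ⟨a, Or.inr ⟨h, h1⟩, h2⟩]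
    · rintro ⟨a, ⟨h, h1⟩ | ⟨h, h1⟩, h2⟩
      exacts [Or.inl ⟨h, a, h1, h2⟩, Or.inr ⟨h, a, h1, h2⟩]

theorem leadsTo_map {P : Input n} {T : LinTree n α} {g : α → β} {b : β} :
    (T.map g).LeadsTo P b ↔ ∃ a, T.LeadsTo P a ∧ g a = b := by
  simp [map, leadsTo_bind, LeadsTo]

open Classical in
/-- The label of the leaf that the evaluation on `P` reaches. -/
noncomputable def eval (P : Input n) : LinTree n α → α
  | leaf a => a
  | node q l r => if q.IsLeft P then l.eval P else r.eval P

theorem leafDepth_bind (P : Input n) (T : LinTree n α) (f : α → LinTree n β) :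
    (T.bind f).leafDepth P = T.leafDepth P + (f (T.eval P)).leafDepth P := by
  induction T with
  | leaf a => simp [bind, leafDepth, eval]
  | node q l r hl hr =>
    simp only [bind, leafDepth, eval, hl, hr]
    split_ifs <;> ring

theorem eval_bind (P : Input n) (T : LinTree n α) (f : α → LinTree n β) :
    (T.bind f).eval P = (f (T.eval P)).eval P := by
  induction T with
  | leaf a => simp [bind, eval]
  | node q l r hl hr =>
    simp only [bind, eval, hl, hr]
    split_ifs <;> rfl

theorem leafDepth_map (P : Input n) (T : LinTree n α) (g : α → β) :
    (T.map g).leafDepth P = T.leafDepth P := by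
  simp [map, leafDepth_bind, leafDepth]

/-- The maximum depth of a leaf. -/
def height : LinTree n α → ℕ
  | leaf _ => 0
  | node _ l r => max l.height r.height + 1

theorem leafDepth_le_height (P : Input n) (T : LinTree n α) : T.leafDepth P ≤ T.height := by
  induction T with
  | leaf a => simp [leafDepth, height]
  | node q l r hl hr =>
    simp only [leafDepth, height]
    split_ifs <;> omega

theorem height_bind_le {T : LinTree n α} {f : α → LinTree n β} {B : ℕ}
    (h : ∀ a, (f a).height ≤ B) : (T.bind f).height ≤ T.height + B := by
  induction T with
  | leaf a => simpa [bind, height] using h a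
  | node q l r hl hr => simp only [bind, height]; omega

theorem height_map (T : LinTree n α) (g : α → β) : (T.map g).height = T.height := by
  induction T with
  | leaf a => rfl
  | node q l r hl hr => simp only [map] at hl hr; simp only [map, bind, height, hl, hr]

/-- Run all trees of a finite sequence. -/
def pi : {m : ℕ} → (Fin m → LinTree n β) → LinTree n (Fin m → β)
  | 0, _ => leaf Fin.elim0
  | _ + 1, t => (t 0).bind fun b => (pi (Fin.tail t)).map (Fin.cons b)

theorem LeadsTo.of_pi {P : Input n} {m : ℕ} {t : Fin m → LinTree n β} {g : Fin m → β}
    (h : (pi t).LeadsTo P g) (i : Fin m) : (t i).LeadsTo P (g i) := by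
  induction m with
  | zero => exact i.elim0
  | succ m ih =>
    simp only [pi, leadsTo_bind, leadsTo_map] at h
    obtain ⟨b, h1, g', h2, rfl⟩ := h
    refine Fin.cases ?_ (fun j => ?_) i
    · simpa using h1
    · simpa [Fin.tail] using ih h2 j

theorem leafDepth_pi (P : Input n) {m : ℕ} (t : Fin m → LinTree n β) :
    (pi t).leafDepth P = ∑ i, (t i).leafDepth P := by
  induction m with
  | zero => simp [pi, leafDepth]
  | succ m ih =>
    simp only [pi, leafDepth_bind, leafDepth_map, ih, Fin.sum_univ_succ]
    rfl

theorem height_pi_le {m : ℕ} (t : Fin m → LinTree n β) :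
    (pi t).height ≤ ∑ i, (t i).height := by
  induction m with
  | zero => simp [pi, height]
  | succ m ih =>
    rw [Fin.sum_univ_succ]
    exact height_bind_le fun b => by rw [height_map]; exact ih _

theorem expectedDepth_bind_le {D : Fin n → Measure Plane} [∀ i, IsProbabilityMeasure (D i)]
    {T : LinTree n α} {f : α → LinTree n β} {B : ℕ} (h : ∀ a, (f a).height ≤ B) :
    (T.bind f).expectedDepth D ≤ T.expectedDepth D + B := by
  have : ∀ P, ((T.bind f).leafDepth P : ℝ≥0∞) ≤ T.leafDepth P + B := fun P => by
    rw [leafDepth_bind]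
    exact_mod_cast Nat.add_le_add_left ((leafDepth_le_height P _).trans (h _)) _
  calc (T.bind f).expectedDepth D ≤ ∫⁻ P, (T.leafDepth P + B : ℝ≥0∞) ∂(Measure.pi D) :=
        lintegral_mono this
    _ = _ := by rw [lintegral_add_right _ measurable_const]; simp [expectedDepth]

theorem expectedDepth_map (D : Fin n → Measure Plane) (T : LinTree n α) (g : α → β) :
    (T.map g).expectedDepth D = T.expectedDepth D := by
  simp [expectedDepth, leafDepth_map]

open Classical in
/-- The tree with the single query whether the `i`-th point lies to the left of the given line. -/
noncomputable def ask (i : Fin n) (s : LineSpec n) : LinTree n Bool :=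
  if h : s.Uses i then leaf false else node ⟨i, s, h⟩ (leaf true) (leaf false)

theorem height_ask (i : Fin n) (s : LineSpec n) : (ask i s).height ≤ 1 := by
  unfold ask; split_ifs <;> simp [height]

theorem ask_true {P : Input n} {i : Fin n} {s : LineSpec n} (h : (ask i s).LeadsTo P true) :
    P i ∈ (s.line P).left := by
  unfold ask at h; split_ifs at h <;> simp_all [LeadsTo, Query.IsLeft]

theorem ask_false {P : Input n} {i : Fin n} {s : LineSpec n} (h : (ask i s).LeadsTo P false)
    (hs : ¬ s.Uses i) : P i ∈ (s.line P).right := by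
  unfold ask at h; split_ifs at h; simp_all [LeadsTo, Query.IsRight]

/-- Binary search for a change of answers from `true` to `false` between the positions `lo` and
`hi`; the number `f` bounds the number of steps. -/
def search (t : ℕ → LinTree n Bool) : (f lo hi : ℕ) → LinTree n ℕ
  | 0, lo, _ => leaf lo
  | f + 1, lo, hi => if hi ≤ lo + 1 then leaf lo else
      (t ((lo + hi) / 2)).bind fun b =>
        if b then search t f ((lo + hi) / 2) hi else search t f lo ((lo + hi) / 2)

theorem height_search_le {t : ℕ → LinTree n Bool} (ht : ∀ i, (t i).height ≤ 1) (f lo hi : ℕ) :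
    (search t f lo hi).height ≤ f := by
  induction f generalizing lo hi with
  | zero => simp [search, height]
  | succ f ih =>
    unfold search
    split_ifs
    · simp [height]
    · refine (height_bind_le (B := f) ?_).trans (by have := ht ((lo + hi) / 2); omega)
      intro b; cases b <;> simp [ih]

theorem LeadsTo.of_search {t : ℕ → LinTree n Bool} {P : Input n} {f lo hi j : ℕ}
    (h : (search t f lo hi).LeadsTo P j) (hlo : lo < hi) (hf : hi - lo ≤ 2 ^ f) :
    lo ≤ j ∧ j < hi ∧ (j = lo ∨ (t j).LeadsTo P true) ∧
      (j + 1 = hi ∨ (t (j + 1)).LeadsTo P false) := by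
  induction f generalizing lo hi with
  | zero =>
    simp only [search, LeadsTo] at h
    simp at hf
    subst h
    exact ⟨le_rfl, hlo, Or.inl rfl, Or.inl (by omega)⟩
  | succ f ih =>
    unfold search at h
    split_ifs at h with h0
    · simp only [LeadsTo] at h
      subst h
      exact ⟨le_rfl, hlo, Or.inl rfl, Or.inl (by omega)⟩
    · rw [leadsTo_bind] at h
      rw [pow_succ] at hf
      obtain ⟨b, hb, h⟩ := h
      cases b
      · simp only [Bool.false_eq_true, if_false] at h
        obtain ⟨h1, h2, h3, h4⟩ := ih h (by omega) (by omega)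
        refine ⟨h1, by omega, h3, ?_⟩
        rcases h4 with h4 | h4
        · rw [h4]; exact Or.inr hb
        · exact Or.inr h4
      · simp only [if_true] at h
        obtain ⟨h1, h2, h3, h4⟩ := ih h (by omega) (by omega)
        refine ⟨by omega, h2, ?_, h4⟩
        rcases h3 with h3 | h3
        · rw [h3]; exact Or.inr hb
        · exact Or.inr h3

end LinTree

/-! ### Comparisons are strict with probability one -/

theorem IsContinuousDist.measure_singleton {μ : Measure Plane} (h : IsContinuousDist μ)
    (p : Plane) : μ {p} = 0 := by
  refine measure_mono_null ?_ (h 1 0 p.1 (by simp))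
  rintro q rfl
  simp

theorem IsContinuousDist.measure_line {μ : Measure Plane} (h : IsContinuousDist μ)
    (a : Plane) {v : Plane} (hv : v ≠ 0) : μ {p : Plane | cross v (p - a) = 0} = 0 := by
  refine measure_mono_null ?_ (h (-v.2) v.1 (-v.2 * a.1 + v.1 * a.2) ?_)
  · intro p hp
    simp only [cross, mem_ofPred_eq, Prod.fst_sub, Prod.snd_sub] at hp ⊢
    linarith
  · intro h0
    simp only [Prod.mk.injEq, neg_eq_zero] at h0
    exact hv (Prod.ext h0.2 h0.1)

theorem measure_pi_eq_zero_of_update {n : ℕ} {D : Fin n → Measure Plane}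
    [∀ i, IsProbabilityMeasure (D i)] {B : Set (Input n)} (hB : MeasurableSet B) (i : Fin n)
    (h : ∀ P : Input n, D i {z | Function.update P i z ∈ B} = 0) : Measure.pi D B = 0 := by
  classical
  have hm : Measurable (B.indicator (1 : Input n → ℝ≥0∞)) := measurable_one.indicator hB
  rw [← lintegral_indicator_one hB,
    lintegral_eq_lmarginal_univ (μ := D) (fun _ => ((0, 0) : Plane)),
    lmarginal_erase' _ hm (Finset.mem_univ i)]
  have : (fun P : Input n => ∫⁻ z, B.indicator (1 : Input n → ℝ≥0∞) (Function.update P i z) ∂D i)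
      = 0 := by
    funext P
    have h1 : MeasurableSet {z | Function.update P i z ∈ B} := (measurable_update P) hB
    calc _ = ∫⁻ z, {z | Function.update P i z ∈ B}.indicator (1 : Plane → ℝ≥0∞) z ∂D i := rfl
      _ = 0 := by rw [lintegral_indicator_one h1, h P]
  rw [this]
  simp [lmarginal]

namespace LineSpec

variable {n : ℕ}

theorem line_update_of_not_uses {s : LineSpec n} {i : Fin n} (h : ¬ s.Uses i) (P : Input n)
    (z : Plane) : s.line (Function.update P i z) = s.line P := by
  cases s with
  | fixed a d hd => rfl
  | slope j d hd =>
    have : j ≠ i := fun e => h e.symm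
    simp [line, Function.update_of_ne this]
  | pivot q j =>
    have : j ≠ i := fun e => h e.symm
    simp [line, Function.update_of_ne this]
  | pair j k hjk =>
    have h1 : j ≠ i := fun e => h (Or.inl e.symm)
    have h2 : k ≠ i := fun e => h (Or.inr e.symm)
    simp [line, Function.update_of_ne h1, Function.update_of_ne h2]

theorem measurable_line_base (s : LineSpec n) : Measurable fun P : Input n => (s.line P).base := by
  cases s <;> simp only [line] <;> fun_prop

theorem measurable_line_dir (s : LineSpec n) : Measurable fun P : Input n => (s.line P).dir := by
  cases s <;> simp only [line] <;> fun_prop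

end LineSpec

theorem measurable_cross {δ : Type*} [MeasurableSpace δ] {f g : δ → Plane} (hf : Measurable f)
    (hg : Measurable g) : Measurable fun x => cross (f x) (g x) := by
  unfold cross; fun_prop

theorem DirLine.measurableSet_left (l : DirLine) : MeasurableSet l.left :=
  measurableSet_lt measurable_const (measurable_cross measurable_const (by fun_prop))

theorem DirLine.measurableSet_right (l : DirLine) : MeasurableSet l.right :=
  measurableSet_lt (measurable_cross measurable_const (by fun_prop)) measurable_const

namespace Query

variable {n : ℕ}

theorem measurable_cross (q : Query n) :
    Measurable fun P : Input n => cross (q.spec.line P).dir (P q.pt - (q.spec.line P).base) :=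
  _root_.measurable_cross q.spec.measurable_line_dir
    ((measurable_pi_apply _).sub q.spec.measurable_line_base)

theorem measurableSet_isLeft (q : Query n) : MeasurableSet {P | q.IsLeft P} :=
  measurableSet_lt measurable_const q.measurable_cross

variable {D : Fin n → Measure Plane} [∀ i, IsProbabilityMeasure (D i)]

theorem ae_apply_ne (hD : ∀ i, IsContinuousDist (D i)) (j : Fin n) (q : Plane) :
    ∀ᵐ P ∂(Measure.pi D), P j ≠ q := by
  rw [ae_iff]
  refine measure_pi_eq_zero_of_update (i := j) ?_ fun P => ?_
  · simp only [not_not]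
    exact measurableSet_eq_fun (measurable_pi_apply j) measurable_const
  · simpa using (hD j).measure_singleton q

theorem ae_dir_ne (hD : ∀ i, IsContinuousDist (D i)) (s : LineSpec n) :
    ∀ᵐ P ∂(Measure.pi D), (s.line P).dir ≠ 0 := by
  cases s with
  | fixed a d hd => simp [LineSpec.line, hd]
  | slope j d hd => simp [LineSpec.line, hd]
  | pivot q j =>
    filter_upwards [ae_apply_ne hD j q] with P hP
    simpa [LineSpec.line, sub_eq_zero] using hP
  | pair j k hjk =>
    rw [ae_iff]
    refine measure_pi_eq_zero_of_update (i := j) ?_ fun P => ?_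
    · simp only [LineSpec.line, not_not, sub_eq_zero]
      exact measurableSet_eq_fun (measurable_pi_apply k) (measurable_pi_apply j)
    · have : {z | ¬ (((LineSpec.pair j k hjk).line (Function.update P j z)).dir ≠ 0)} = {P k} := by
        ext z
        simp [LineSpec.line, Function.update_of_ne hjk.symm, sub_eq_zero, eq_comm]
      exact (congrArg _ this).trans ((hD j).measure_singleton _)

theorem ae_isLeft_or_isRight (hD : ∀ i, IsContinuousDist (D i)) (q : Query n) :
    ∀ᵐ P ∂(Measure.pi D), q.IsLeft P ∨ q.IsRight P := by
  have : ∀ᵐ P ∂(Measure.pi D), ¬ (cross (q.spec.line P).dir (P q.pt - (q.spec.line P).base) = 0 ∧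
      (q.spec.line P).dir ≠ 0) := by
    rw [ae_iff]
    simp only [not_not]
    refine measure_pi_eq_zero_of_update (i := q.pt) ?_ fun P => ?_
    · refine MeasurableSet.inter ?_ ?_
      · exact measurableSet_eq_fun q.measurable_cross measurable_const
      · exact (measurableSet_eq_fun q.spec.measurable_line_dir measurable_const).compl
    · simp only [mem_ofPred_eq, LineSpec.line_update_of_not_uses q.not_uses, Function.update_self]
      by_cases h0 : (q.spec.line P).dir = 0
      · simp [h0]
      · exact measure_mono_null (fun z hz => hz.1) ((hD q.pt).measure_line (q.spec.line P).base h0)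
  filter_upwards [this, ae_dir_ne hD q.spec] with P h1 h2
  have h3 := fun h => h1 ⟨h, h2⟩
  rcases lt_or_gt_of_ne h3 with h | h
  exacts [Or.inr h, Or.inl h]

end Query

theorem LinTree.ae_leadsTo_eval {n : ℕ} {α : Type} {D : Fin n → Measure Plane}
    [∀ i, IsProbabilityMeasure (D i)] (hD : ∀ i, IsContinuousDist (D i)) (T : LinTree n α) :
    ∀ᵐ P ∂(Measure.pi D), T.LeadsTo P (T.eval P) := by
  induction T with
  | leaf a => simp [LeadsTo, eval]
  | node q l r hl hr =>
    filter_upwards [hl, hr, q.ae_isLeft_or_isRight hD] with P h1 h2 h3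
    simp only [LeadsTo, eval]
    split_ifs with h
    · exact Or.inl ⟨h, h1⟩
    · exact Or.inr ⟨h3.resolve_left h, h2⟩

open Classical in
theorem LinTree.measurable_leafDepth {n : ℕ} {α : Type} (T : LinTree n α) :
    Measurable fun P => (T.leafDepth P : ℝ≥0∞) := by
  induction T with
  | leaf a => simp [leafDepth]
  | node q l r hl hr =>
    have : (fun P => ((node q l r).leafDepth P : ℝ≥0∞)) = fun P => if q.IsLeft P then
        (l.leafDepth P : ℝ≥0∞) + 1 else (r.leafDepth P : ℝ≥0∞) + 1 := by
      funext P
      simp only [leafDepth]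
      split_ifs <;> simp
    rw [this]
    exact Measurable.ite q.measurableSet_isLeft (hl.add_const 1) (hr.add_const 1)

/-! ### Halving lines -/

section Halving

open Filter Topology

/-- The level sets of `f` in `S` lie on lines, with the larger values on the left. -/
def LevelLines (f : Plane → ℝ) (S : Set Plane) : Prop :=
  ∀ t, ∃ a v : Plane, v ≠ 0 ∧ ∀ p ∈ S,
    (p ∈ (DirLine.mk a v).left ↔ t < f p) ∧ (p ∈ (DirLine.mk a v).right ↔ f p < t)

theorem mem_left_iff {a v p : Plane} :
    p ∈ (DirLine.mk a v).left ↔ 0 < v.1 * (p.2 - a.2) - v.2 * (p.1 - a.1) := Iff.rfl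

theorem mem_right_iff {a v p : Plane} :
    p ∈ (DirLine.mk a v).right ↔ v.1 * (p.2 - a.2) - v.2 * (p.1 - a.1) < 0 := Iff.rfl

theorem levelLines_cross {v : Plane} (hv : v ≠ 0) (S : Set Plane) :
    LevelLines (fun p => cross v p) S := fun t => by
  have h0 : 0 < v.1 ^ 2 + v.2 ^ 2 := by
    rcases (ne_eq _ _).symm ▸ hv with h
    by_contra hle
    exact h (Prod.ext (by simp; nlinarith [sq_nonneg v.1, sq_nonneg v.2])
      (by simp; nlinarith [sq_nonneg v.1, sq_nonneg v.2]))
  have key : ∀ p : Plane, v.1 * (p.2 - v.1 * t / (v.1 ^ 2 + v.2 ^ 2)) -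
      v.2 * (p.1 - -v.2 * t / (v.1 ^ 2 + v.2 ^ 2)) = cross v p - t := fun p => by
    unfold cross; field_simp; ring
  refine ⟨(-v.2 * t / (v.1 ^ 2 + v.2 ^ 2), v.1 * t / (v.1 ^ 2 + v.2 ^ 2)), v, hv, fun p _ => ?_⟩
  rw [mem_left_iff, mem_right_iff, key]
  exact ⟨sub_pos, sub_neg⟩

theorem DirLine.not_mem_right {l : DirLine} {p : Plane} (h : p ∈ l.left) : p ∉ l.right :=
  fun h' => lt_asymm (α := ℝ) h h'

variable {μ : Measure Plane}

theorem measure_inter_add_of_line [IsProbabilityMeasure μ] (hμ : IsContinuousDist μ)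
    (S : Set Plane) {a v : Plane} (hv : v ≠ 0) :
    μ ((DirLine.mk a v).left ∩ S) + μ ((DirLine.mk a v).right ∩ S) = μ S := by
  have hl := (DirLine.mk a v).measurableSet_left
  rw [← measure_inter_add_sdiff S hl, inter_comm S]
  congr 1
  refine measure_congr ?_
  have h0 := hμ.measure_line a hv
  have : ∀ᵐ p ∂μ, cross v (p - a) ≠ 0 := by rw [ae_iff]; simpa using h0
  filter_upwards [this] with p hp
  refine propext ⟨fun h => ⟨h.2, fun h' => ?_⟩, fun h => ⟨?_, h.1⟩⟩
  · exact DirLine.not_mem_right h' h.1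
  · exact lt_of_le_of_ne (not_lt.1 h.2) hp

theorem exists_halving [IsProbabilityMeasure μ] (hμ : IsContinuousDist μ) {f : Plane → ℝ}
    {S : Set Plane} (hS : MeasurableSet S) (hf : LevelLines f S) :
    ∃ t : ℝ, μ {p ∈ S | t < f p} = μ S / 2 := by
  have hm : ∀ t, MeasurableSet {p ∈ S | t < f p} := fun t => by
    obtain ⟨a, v, -, H⟩ := hf t
    convert hS.inter (DirLine.mk a v).measurableSet_left using 1
    ext p
    exact ⟨fun h => ⟨h.1, (H p h.1).1.2 h.2⟩, fun h => ⟨h.1, (H p h.1).1.1 h.2⟩⟩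
  rcases eq_or_ne (μ S) 0 with h0 | h0
  · exact ⟨0, by rw [h0]; simpa using measure_mono_null (sep_subset S _) h0⟩
  have hcont : Continuous fun t => μ {p ∈ S | t < f p} := by
    refine continuous_iff_continuousAt.2 fun t => ?_
    refine tendsto_measure_of_ae_tendsto_indicator_of_isFiniteMeasure (𝓝 t) (hm t) hm ?_
    obtain ⟨a, v, hv, H⟩ := hf t
    have : ∀ᵐ p ∂μ, cross v (p - a) ≠ 0 := by rw [ae_iff]; simpa using hμ.measure_line a hv
    filter_upwards [this] with p hp
    by_cases hpS : p ∈ S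
    · rcases lt_or_gt_of_ne hp with h | h
      · filter_upwards [lt_mem_nhds ((H p hpS).2.1 h)] with t' ht'
        exact ⟨fun h' => absurd h'.2 ht'.not_gt, fun h' => absurd h'.2 ((H p hpS).2.1 h).not_gt⟩
      · filter_upwards [gt_mem_nhds ((H p hpS).1.1 h)] with t' ht'
        exact ⟨fun _ => ⟨hpS, (H p hpS).1.1 h⟩, fun _ => ⟨hpS, ht'⟩⟩
    · exact Eventually.of_forall fun t' => ⟨fun h => absurd h.1 hpS, fun h => absurd h.1 hpS⟩
  have htop : Tendsto (fun t => μ {p ∈ S | t < f p}) atTop (𝓝 0) := by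
    rw [← measure_empty (μ := μ)]
    refine tendsto_measure_of_ae_tendsto_indicator_of_isFiniteMeasure _ .empty hm ?_
    refine ae_of_all _ fun p => ?_
    filter_upwards [eventually_ge_atTop (f p)] with t ht
    simp [ht.not_gt]
  have hbot : Tendsto (fun t => μ {p ∈ S | t < f p}) atBot (𝓝 (μ S)) := by
    refine tendsto_measure_of_ae_tendsto_indicator_of_isFiniteMeasure _ hS hm ?_
    refine ae_of_all _ fun p => ?_
    filter_upwards [eventually_lt_atBot (f p)] with t ht
    simp [ht]
  have h2 : 0 < μ S / 2 := ENNReal.half_pos h0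
  obtain ⟨t₁, h₁⟩ := (htop.eventually (gt_mem_nhds h2)).exists
  obtain ⟨t₂, h₂⟩ := (hbot.eventually
    (lt_mem_nhds (ENNReal.half_lt_self h0 (measure_ne_top _ _)))).exists
  exact mem_range_of_exists_le_of_exists_ge hcont ⟨t₁, h₁.le⟩ ⟨t₂, h₂.le⟩

theorem exists_halving_line [IsProbabilityMeasure μ] (hμ : IsContinuousDist μ) {f : Plane → ℝ}
    {S : Set Plane} (hS : MeasurableSet S) (hf : LevelLines f S) :
    ∃ (t : ℝ) (a v : Plane), v ≠ 0 ∧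
      μ ((DirLine.mk a v).left ∩ S) = μ ((DirLine.mk a v).right ∩ S) ∧
      ∀ p ∈ S, (p ∈ (DirLine.mk a v).left ↔ t < f p) ∧ (p ∈ (DirLine.mk a v).right ↔ f p < t) := by
  obtain ⟨t, ht⟩ := exists_halving hμ hS hf
  obtain ⟨a, v, hv, H⟩ := hf t
  refine ⟨t, a, v, hv, ?_, H⟩
  have h1 : μ ((DirLine.mk a v).left ∩ S) = μ S / 2 := by
    rw [← ht]; congr 1; ext p
    exact ⟨fun h => ⟨h.2, (H p h.2).1.1 h.1⟩, fun h => ⟨(H p h.1).1.2 h.2, h.1⟩⟩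
  have h2 := measure_inter_add_of_line hμ S (a := a) hv
  rw [h1] at h2 ⊢
  nth_rewrite 2 [← ENNReal.add_halves (μ S)] at h2
  exact ((ENNReal.add_right_inj
    (ENNReal.div_ne_top (measure_ne_top _ _) two_ne_zero)).1 h2).symm

end Halving

/-! ### Partial simulations of comparison trees -/

section Simulation

variable {n : ℕ} {α : Type} {D : Fin n → Measure Plane}

/-- The inputs whose `i`-th point lies in `R i`. -/
def box (R : Fin n → Set Plane) : Set (Input n) := univ.pi R

theorem box_mono {R R' : Fin n → Set Plane} (h : R' ≤ R) : box R' ⊆ box R :=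
  pi_mono fun i _ => h i

theorem measurableSet_box {R : Fin n → Set Plane} (h : ∀ i, MeasurableSet (R i)) :
    MeasurableSet (box R) := .univ_pi h

theorem update_inter_le (R : Fin n → Set Plane) (i : Fin n) (S : Set Plane) :
    Function.update R i (R i ∩ S) ≤ R :=
  update_le_self_iff.2 inter_subset_left

theorem measurableSet_update_inter {R : Fin n → Set Plane} (h : ∀ i, MeasurableSet (R i))
    (i : Fin n) {S : Set Plane} (hS : MeasurableSet S) (j : Fin n) :
    MeasurableSet (Function.update R i (R i ∩ S) j) := by
  rcases eq_or_ne j i with rfl | hj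
  · simpa using (h j).inter hS
  · simpa [hj] using h j

theorem mem_box_update_inter {R : Fin n → Set Plane} {i : Fin n} {S : Set Plane} {P : Input n} :
    P ∈ box (Function.update R i (R i ∩ S)) ↔ P ∈ box R ∧ P i ∈ S := by
  simp only [box, mem_univ_pi]
  constructor
  · intro h
    refine ⟨fun j => ?_, ?_⟩
    · exact update_inter_le R i S j (h j)
    · have := h i; simp only [Function.update_self] at this; exact this.2
  · rintro ⟨h, hi⟩ j
    rcases eq_or_ne j i with rfl | hj
    · simpa using ⟨h j, hi⟩
    · simpa [hj] using h j

/-- There is a tree that is entropy-sensitive from depth `d` and region `box R` on, finds labels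
that satisfy `φ` on this region, and has expected depth at most `c` there. -/
def Solvable (D : Fin n → Measure Plane) (φ : α → Input n → Prop) (d : ℕ)
    (R : Fin n → Set Plane) (c : ℝ≥0∞) : Prop :=
  ∃ T : LinTree n α, T.EntropySensitiveFrom D d R ∧
    (∀ P ∈ box R, ∀ γ, T.LeadsTo P γ → φ γ P) ∧
    ∫⁻ P in box R, T.leafDepth P ∂(Measure.pi D) ≤ c

theorem Solvable.mono {φ ψ : α → Input n → Prop} {d : ℕ} {R : Fin n → Set Plane} {c c' : ℝ≥0∞}
    (h : Solvable D φ d R c) (hφ : ∀ P ∈ box R, ∀ γ, φ γ P → ψ γ P) (hc : c ≤ c') :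
    Solvable D ψ d R c' := by
  obtain ⟨T, h1, h2, h3⟩ := h
  exact ⟨T, h1, fun P hP γ hγ => hφ P hP γ (h2 P hP γ hγ), h3.trans hc⟩

/-- All regions `box R` with `C R` are solvable from depth `d` on, at the cost given by `κ`. -/
def Solves (D : Fin n → Measure Plane) (φ : α → Input n → Prop) (κ : Measure (Input n)) (d : ℕ)
    (C : (Fin n → Set Plane) → Prop) : Prop :=
  ∀ d' ≥ d, ∀ R : Fin n → Set Plane, (∀ i, MeasurableSet (R i)) → C R →
    Solvable D φ d' R (κ (box R))

theorem Solves.mono {φ : α → Input n → Prop} {κ κ' : Measure (Input n)} {d d' : ℕ}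
    {C C' : (Fin n → Set Plane) → Prop} (h : Solves D φ κ d C) (hκ : κ ≤ κ') (hd : d ≤ d')
    (hC : ∀ R, C' R → C R) : Solves D φ κ' d' C' := fun e he R hR hCR =>
  (h e (hd.trans he) R hR (hC R hCR)).mono (fun _ _ _ h => h) (hκ _)

variable [∀ i, IsProbabilityMeasure (D i)]

theorem measure_box_update (R : Fin n → Set Plane) (i : Fin n) (S : Set Plane) :
    Measure.pi D (box (Function.update R i S)) = D i S * ∏ j ∈ Finset.univ \ {i}, D j (R j) := by
  classical
  rw [box, Measure.pi_pi, ← Finset.prod_update_of_mem (Finset.mem_univ i)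
    (fun j => D j (R j)) (D i S)]
  refine Finset.prod_congr rfl fun j _ => ?_
  rcases eq_or_ne j i with rfl | hj
  · simp
  · simp [hj]

theorem measure_box_eq (R : Fin n → Set Plane) (i : Fin n) :
    Measure.pi D (box R) = D i (R i) * ∏ j ∈ Finset.univ \ {i}, D j (R j) := by
  rw [← measure_box_update, Function.update_eq_self]

theorem measure_box_add_of_line (hD : ∀ i, IsContinuousDist (D i)) (R : Fin n → Set Plane)
    (i : Fin n) {a v : Plane} (hv : v ≠ 0) :
    Measure.pi D (box (Function.update R i (R i ∩ (DirLine.mk a v).left))) +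
      Measure.pi D (box (Function.update R i (R i ∩ (DirLine.mk a v).right))) =
      Measure.pi D (box R) := by
  rw [measure_box_update, measure_box_update, measure_box_eq R i, ← add_mul, inter_comm,
    inter_comm (R i), measure_inter_add_of_line (hD i) (R i) hv]

theorem measure_box_halving {R : Fin n → Set Plane} {i : Fin n} {a v : Plane}
    (h : D i ((DirLine.mk a v).left ∩ R i) = D i ((DirLine.mk a v).right ∩ R i)) :
    Measure.pi D (box (Function.update R i (R i ∩ (DirLine.mk a v).left))) =
      Measure.pi D (box (Function.update R i (R i ∩ (DirLine.mk a v).right))) := by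
  rw [measure_box_update, measure_box_update, inter_comm, inter_comm (R i), h]

theorem add_le_measure_box (κ : Measure (Input n)) {R : Fin n → Set Plane} (i : Fin n)
    (hR : ∀ i, MeasurableSet (R i)) (a v : Plane) :
    κ (box (Function.update R i (R i ∩ (DirLine.mk a v).left))) +
      κ (box (Function.update R i (R i ∩ (DirLine.mk a v).right))) ≤ κ (box R) := by
  rw [← measure_union]
  · exact measure_mono (union_subset (box_mono (update_inter_le _ _ _))
      (box_mono (update_inter_le _ _ _)))
  · rw [Set.disjoint_left]
    intro P h1 h2
    exact DirLine.not_mem_right (mem_box_update_inter.1 h1).2 (mem_box_update_inter.1 h2).2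
  · exact measurableSet_box (measurableSet_update_inter hR _ (DirLine.measurableSet_right _))

theorem Solvable.step (hD : ∀ i, IsContinuousDist (D i)) {φ : α → Input n → Prop} {d : ℕ}
    {R : Fin n → Set Plane} (hR : ∀ i, MeasurableSet (R i)) {i : Fin n} {a v : Plane} (hv : v ≠ 0)
    (hh : D i ((DirLine.mk a v).left ∩ R i) = D i ((DirLine.mk a v).right ∩ R i)) {c₁ c₂ : ℝ≥0∞}
    (h₁ : Solvable D φ (d + 1) (Function.update R i (R i ∩ (DirLine.mk a v).left)) c₁)
    (h₂ : Solvable D φ (d + 1) (Function.update R i (R i ∩ (DirLine.mk a v).right)) c₂) :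
    Solvable D φ d R (c₁ + c₂ + Measure.pi D (box R)) := by
  obtain ⟨T₁, e₁, f₁, g₁⟩ := h₁
  obtain ⟨T₂, e₂, f₂, g₂⟩ := h₂
  set Rl := Function.update R i (R i ∩ (DirLine.mk a v).left) with hRl
  set Rr := Function.update R i (R i ∩ (DirLine.mk a v).right) with hRr
  have ml : MeasurableSet (box Rl) :=
    measurableSet_box (measurableSet_update_inter hR _ (DirLine.measurableSet_left _))
  have mr : MeasurableSet (box Rr) :=
    measurableSet_box (measurableSet_update_inter hR _ (DirLine.measurableSet_right _))
  let q : Query n := ⟨i, .fixed a v hv, fun h => h⟩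
  refine ⟨.node q T₁ T₂, fun _ => ⟨a, v, hv, rfl, hh, e₁, e₂⟩, ?_, ?_⟩
  · rintro P hP γ (⟨h, h'⟩ | ⟨h, h'⟩)
    · exact f₁ P (mem_box_update_inter.2 ⟨hP, h⟩) γ h'
    · exact f₂ P (mem_box_update_inter.2 ⟨hP, h⟩) γ h'
  · have hsub : box R ≤ᵐ[Measure.pi D] (box Rl ∪ box Rr : Set (Input n)) := by
      filter_upwards [q.ae_isLeft_or_isRight hD] with P h hP
      rcases h with h | h
      · exact Or.inl (mem_box_update_inter.2 ⟨hP, h⟩)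
      · exact Or.inr (mem_box_update_inter.2 ⟨hP, h⟩)
    have hl : ∫⁻ P in box Rl, ((LinTree.node q T₁ T₂).leafDepth P : ℝ≥0∞) ∂(Measure.pi D) ≤
        c₁ + Measure.pi D (box Rl) := by
      calc _ = ∫⁻ P in box Rl, ((T₁.leafDepth P : ℝ≥0∞) + 1) ∂(Measure.pi D) := by
            refine setLIntegral_congr_fun ml fun P hP => ?_
            have : q.IsLeft P := (mem_box_update_inter.1 hP).2
            simp [LinTree.leafDepth, this]
        _ ≤ _ := by
            rw [lintegral_add_right _ measurable_const]
            simpa using g₁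
    have hr : ∫⁻ P in box Rr, ((LinTree.node q T₁ T₂).leafDepth P : ℝ≥0∞) ∂(Measure.pi D) ≤
        c₂ + Measure.pi D (box Rr) := by
      calc _ = ∫⁻ P in box Rr, ((T₂.leafDepth P : ℝ≥0∞) + 1) ∂(Measure.pi D) := by
            refine setLIntegral_congr_fun mr fun P hP => ?_
            have h1 : q.IsRight P := (mem_box_update_inter.1 hP).2
            have : ¬ q.IsLeft P := fun h => DirLine.not_mem_right h h1
            simp [LinTree.leafDepth, this]
        _ ≤ _ := by
            rw [lintegral_add_right _ measurable_const]
            simpa using g₂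
    calc _ ≤ ∫⁻ P in box Rl ∪ box Rr, ((LinTree.node q T₁ T₂).leafDepth P : ℝ≥0∞)
            ∂(Measure.pi D) := lintegral_mono' (Measure.restrict_mono_ae hsub) le_rfl
      _ ≤ _ := lintegral_union_le _ _ _
      _ ≤ _ := add_le_add hl hr
      _ = c₁ + c₂ + Measure.pi D (box R) := by
            rw [← measure_box_add_of_line hD R i (a := a) hv]; ring

variable {φ : α → Input n → Prop} {κ : Measure (Input n)} {d : ℕ}
  {C : (Fin n → Set Plane) → Prop}

theorem Solves.fixedLine (hD : ∀ i, IsContinuousDist (D i)) (hC : ∀ R R', R' ≤ R → C R → C R')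
    (i : Fin n) {a v : Plane} (hv : v ≠ 0) (hbase : Solves D φ κ (n ^ 2 + 1) C)
    (hl : Solves D φ κ d fun R => C R ∧ R i ⊆ (DirLine.mk a v).left)
    (hr : Solves D φ κ d fun R => C R ∧ R i ⊆ (DirLine.mk a v).right) :
    Solves D φ (κ + (2 : ℝ≥0∞) • Measure.pi D) d C := by
  suffices H : ∀ f d', n ^ 2 + 1 ≤ d' + f → d ≤ d' → ∀ R : Fin n → Set Plane,
      (∀ i, MeasurableSet (R i)) → C R →
      Solvable D φ d' R (κ (box R) + 2 * Measure.pi D (box R)) by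
    intro d' hd' R hR hCR
    simpa using H (n ^ 2 + 1) d' (by omega) hd' R hR hCR
  intro f
  induction f with
  | zero =>
    intro d' h1 _ R hR hCR
    exact (hbase d' (by omega) R hR hCR).mono (fun _ _ _ h => h) le_self_add
  | succ f ih =>
    intro d' h1 h2 R hR hCR
    obtain ⟨t, a', v', hv', hh, H⟩ :=
      exists_halving_line (hD i) (hR i) (levelLines_cross hv (R i))
    have mL := measurableSet_update_inter hR i (DirLine.mk a' v').measurableSet_left
    have mR := measurableSet_update_inter hR i (DirLine.mk a' v').measurableSet_right
    have cL := hC R _ (update_inter_le R i (DirLine.mk a' v').left) hCR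
    have cR := hC R _ (update_inter_le R i (DirLine.mk a' v').right) hCR
    have hκ := add_le_measure_box κ i hR a' v'
    have hm := measure_box_add_of_line hD R i (a := a') hv'
    have he := measure_box_halving (R := R) hh
    have hsub : ∀ p, cross v (p - a) = cross v p - cross v a := fun p => by
      simp only [cross, Prod.fst_sub, Prod.snd_sub]; ring
    rcases le_total (cross v a) t with ht | ht
    · have s1 := hl (d' + 1) (by omega) _ mL ⟨cL, fun p hp => ?_⟩
      · have s2 := ih (d' + 1) (by omega) (by omega) _ mR cR
        refine (s1.step hD hR hv' hh s2).mono (fun _ _ _ h => h) ?_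
        rw [← hm, he]
        refine le_trans (le_of_eq ?_) (add_le_add_left hκ _)
        ring
      · simp only [Function.update_self] at hp
        have := ((H p hp.1).1.1 hp.2)
        change 0 < cross v (p - a)
        rw [hsub]; linarith
    · have s1 := hr (d' + 1) (by omega) _ mR ⟨cR, fun p hp => ?_⟩
      · have s2 := ih (d' + 1) (by omega) (by omega) _ mL cL
        refine (s2.step hD hR hv' hh s1).mono (fun _ _ _ h => h) ?_
        rw [← hm, he]
        refine le_trans (le_of_eq ?_) (add_le_add_left hκ _)
        ring
      · simp only [Function.update_self] at hp
        have := ((H p hp.1).2.1 hp.2)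
        change cross v (p - a) < 0
        rw [hsub]; linarith

/-- The values of `f` on `S` lie below those of `g` on `S'`. -/
def ValuesBelow (f : Plane → ℝ) (S : Set Plane) (g : Plane → ℝ) (S' : Set Plane) : Prop :=
  ∃ t, (∀ p ∈ S, f p < t) ∧ ∀ p ∈ S', t < g p

theorem Solves.separate (hD : ∀ i, IsContinuousDist (D i)) (hC : ∀ R R', R' ≤ R → C R → C R')
    {i j : Fin n} (hij : i ≠ j) {f g : Plane → ℝ} (hf : ∀ R, C R → LevelLines f (R i))
    (hg : ∀ R, C R → LevelLines g (R j)) {e : ℝ≥0∞}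
    (hgood : Solves D φ κ d fun R => C R ∧
      (ValuesBelow f (R i) g (R j) ∨ ValuesBelow g (R j) f (R i)))
    (hall : Solves D φ (κ + (4 * e) • Measure.pi D) d C) :
    Solves D φ (κ + (2 + 3 * e) • Measure.pi D) d C := by
  intro d' hd' R hR hCR
  obtain ⟨s, a, v, hv, hh, H⟩ := exists_halving_line (hD i) (hR i) (hf R hCR)
  obtain ⟨t, b, w, hw, hk, K⟩ := exists_halving_line (hD j) (hR j) (hg R hCR)
  set R₁ := Function.update R i (R i ∩ (DirLine.mk a v).left) with hR₁
  set R₂ := Function.update R i (R i ∩ (DirLine.mk a v).right) with hR₂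
  have m₁ : ∀ k, MeasurableSet (R₁ k) :=
    measurableSet_update_inter hR i (DirLine.mk a v).measurableSet_left
  have m₂ : ∀ k, MeasurableSet (R₂ k) :=
    measurableSet_update_inter hR i (DirLine.mk a v).measurableSet_right
  have c₁ : C R₁ := hC R _ (update_inter_le R i _) hCR
  have c₂ : C R₂ := hC R _ (update_inter_le R i _) hCR
  have e₁ : R₁ j = R j := by simp [hR₁, hij.symm]
  have e₂ : R₂ j = R j := by simp [hR₂, hij.symm]
  have k₁ : D j ((DirLine.mk b w).left ∩ R₁ j) = D j ((DirLine.mk b w).right ∩ R₁ j) := by rwa [e₁]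
  have k₂ : D j ((DirLine.mk b w).left ∩ R₂ j) = D j ((DirLine.mk b w).right ∩ R₂ j) := by rwa [e₂]
  have u₁ := measurableSet_update_inter m₁ j (DirLine.mk b w).measurableSet_left
  have u₂ := measurableSet_update_inter m₁ j (DirLine.mk b w).measurableSet_right
  have u₃ := measurableSet_update_inter m₂ j (DirLine.mk b w).measurableSet_left
  have u₄ := measurableSet_update_inter m₂ j (DirLine.mk b w).measurableSet_right
  have C₁ := hC _ _ (update_inter_le R₁ j (DirLine.mk b w).left) c₁
  have C₂ := hC _ _ (update_inter_le R₁ j (DirLine.mk b w).right) c₁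
  have C₃ := hC _ _ (update_inter_le R₂ j (DirLine.mk b w).left) c₂
  have C₄ := hC _ _ (update_inter_le R₂ j (DirLine.mk b w).right) c₂
  have p₁ := hall (d' + 1 + 1) (by omega) _ u₁ C₁
  have p₂ := hall (d' + 1 + 1) (by omega) _ u₂ C₂
  have p₃ := hall (d' + 1 + 1) (by omega) _ u₃ C₃
  have p₄ := hall (d' + 1 + 1) (by omega) _ u₄ C₄
  have hκ := add_le_measure_box κ i hR a v
  have hκ₁ := add_le_measure_box κ j m₁ b w
  have hκ₂ := add_le_measure_box κ j m₂ b w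
  have hm := measure_box_add_of_line hD R i (a := a) hv
  have hm₁ := measure_box_add_of_line hD R₁ j (a := b) hw
  have hm₂ := measure_box_add_of_line hD R₂ j (a := b) hw
  have he := measure_box_halving (R := R) hh
  have he₁ := measure_box_halving k₁
  have he₂ := measure_box_halving k₂
  rw [← hR₁, ← hR₂] at hκ hm he
  rw [he₁] at hm₁
  rw [he₂] at hm₂
  have he₃ : Measure.pi D (box (Function.update R₁ j (R₁ j ∩ (DirLine.mk b w).right))) =
      Measure.pi D (box (Function.update R₂ j (R₂ j ∩ (DirLine.mk b w).right))) := by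
    rw [← hm₁, ← hm₂, ← two_mul, ← two_mul] at he
    exact (ENNReal.mul_right_inj (by simp) (by simp)).1 he
  have key : ∀ x₁ x₂ x₃ x₄ y₁ y₂ y z m : ℝ≥0∞, x₁ + x₂ ≤ y₁ → x₃ + x₄ ≤ y₂ → y₁ + y₂ ≤ y →
      z = x₁ + x₂ + x₃ + x₄ + (8 * m + 12 * e * m) → z ≤ y + (2 + 3 * e) * (4 * m) := by
    intro x₁ x₂ x₃ x₄ y₁ y₂ y z m h1 h2 h3 hz
    rw [hz]
    refine add_le_add ?_ (le_of_eq (by ring))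
    calc x₁ + x₂ + x₃ + x₄ = (x₁ + x₂) + (x₃ + x₄) := by ring
      _ ≤ y := (add_le_add h1 h2).trans h3
  have hmm : Measure.pi D (box R) =
      4 * Measure.pi D (box (Function.update R₂ j (R₂ j ∩ (DirLine.mk b w).right))) := by
    rw [← hm, he, ← hm₂]; ring
  rcases le_total s t with hst | hst
  · have p₃' := hgood (d' + 1 + 1) (by omega) _ u₃ ⟨C₃, Or.inl ⟨s, fun p hp => ?_, fun p hp => ?_⟩⟩
    · refine ((p₁.step hD m₁ hw k₁ p₂).step hD hR hv hh (p₃'.step hD m₂ hw k₂ p₄)).mono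
        (fun _ _ _ h => h) ?_
      simp only [Measure.add_apply, Measure.smul_apply, smul_eq_mul, he₁, he₃, ← hm₁, ← hm₂, hmm]
      refine key _ _ _ _ _ _ _ _ _ hκ₁ hκ₂ hκ ?_
      ring
    · rw [Function.update_of_ne hij, hR₂, Function.update_self] at hp
      exact (H p hp.1).2.1 hp.2
    · rw [Function.update_self, e₂] at hp
      exact hst.trans_lt ((K p hp.1).1.1 hp.2)
  · have p₂' := hgood (d' + 1 + 1) (by omega) _ u₂ ⟨C₂, Or.inr ⟨s, fun p hp => ?_, fun p hp => ?_⟩⟩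
    · refine ((p₁.step hD m₁ hw k₁ p₂').step hD hR hv hh (p₃.step hD m₂ hw k₂ p₄)).mono
        (fun _ _ _ h => h) ?_
      simp only [Measure.add_apply, Measure.smul_apply, smul_eq_mul, he₁, he₂, he₃, ← hm₁, ← hm₂,
        hmm]
      refine key _ _ _ _ _ _ _ _ _ hκ₁ hκ₂ hκ ?_
      ring
    · rw [Function.update_self, e₁] at hp
      exact ((K p hp.1).2.1 hp.2).trans_le hst
    · rw [Function.update_of_ne hij, hR₁, Function.update_self] at hp
      exact (H p hp.1).1.1 hp.2

end Simulation

/-! ### Ham sandwich lines -/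

section HamSandwich

open Filter Topology

theorem exists_common_half {F G : ℝ → ℝ → ℝ} (Fs : ∀ h, Antitone (F h)) (Gs : ∀ h, Monotone (G h))
    (cF : ∀ s, Continuous fun h => F h s) (cF' : ∀ h, Continuous (F h))
    (cG : ∀ s, Continuous fun h => G h s) (cG' : ∀ h, Continuous (G h))
    (Fbot : ∀ h, Tendsto (F h) atBot (𝓝 1)) (Ftop : ∀ h, Tendsto (F h) atTop (𝓝 0))
    (Gbot : ∀ h, Tendsto (G h) atBot (𝓝 0)) (Gtop : ∀ h, Tendsto (G h) atTop (𝓝 1))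
    (F0 : Tendsto (fun h => F h 0) atBot (𝓝 0)) (F1 : Tendsto (fun h => F h 0) atTop (𝓝 1))
    (G0 : Tendsto (fun h => G h 0) atBot (𝓝 0)) (G1 : Tendsto (fun h => G h 0) atTop (𝓝 1)) :
    ∃ h s, F h s = 1 / 2 ∧ G h s = 1 / 2 := by
  have half0 : (0 : ℝ) < 1 / 2 := by norm_num
  have half1 : (1 / 2 : ℝ) < 1 := by norm_num
  have hz : ∀ h, ∃ s, F h s = G h s := fun h => by
    obtain ⟨s₁, h1, h2⟩ := (((Ftop h).eventually (gt_mem_nhds half0)).and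
      ((Gtop h).eventually (lt_mem_nhds half1))).exists
    obtain ⟨s₂, h3, h4⟩ := (((Fbot h).eventually (lt_mem_nhds half1)).and
      ((Gbot h).eventually (gt_mem_nhds half0))).exists
    exact intermediate_value_univ₂ (cF' h) (cG' h) (h1.trans h2).le (h4.trans h3).le
  choose z hz using hz
  have hb : ∀ h s, min (F h s) (G h s) ≤ F h (z h) ∧ F h (z h) ≤ max (F h s) (G h s) := by
    intro h s
    rcases le_total s (z h) with hs | hs
    · exact ⟨(min_le_right _ _).trans ((Gs h hs).trans (hz h).ge),
        (Fs h hs).trans (le_max_left _ _)⟩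
    · exact ⟨(min_le_left _ _).trans (Fs h hs),
        (hz h).le.trans ((Gs h hs).trans (le_max_right _ _))⟩
  have hc : Continuous fun h => F h (z h) := by
    refine continuous_iff_continuousAt.2 fun h₀ => ?_
    refine tendsto_of_tendsto_of_tendsto_of_le_of_le (g := fun h => min (F h (z h₀)) (G h (z h₀)))
      (h := fun h => max (F h (z h₀)) (G h (z h₀))) ?_ ?_ (fun h => (hb h _).1)
      (fun h => (hb h _).2)
    · have := ((cF (z h₀)).min (cG (z h₀))).tendsto h₀
      simpa [hz h₀] using this
    · have := ((cF (z h₀)).max (cG (z h₀))).tendsto h₀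
      simpa [hz h₀] using this
  obtain ⟨h₁, a1, a2⟩ := ((F0.eventually (gt_mem_nhds half0)).and
    (G0.eventually (gt_mem_nhds half0))).exists
  obtain ⟨h₂, b1, b2⟩ := ((F1.eventually (lt_mem_nhds half1)).and
    (G1.eventually (lt_mem_nhds half1))).exists
  obtain ⟨h, hh⟩ := mem_range_of_exists_le_of_exists_ge hc
    ⟨h₁, (hb h₁ 0).2.trans (max_le a1.le a2.le)⟩ ⟨h₂, (le_min b1.le b2.le).trans (hb h₂ 0).1⟩
  exact ⟨h, z h, hh, (hz h).symm.trans hh⟩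

theorem mem_left_slope_iff {x h s : ℝ} {p : Plane} :
    p ∈ (DirLine.mk (x, h) (1, s)).left ↔ h + s * (p.1 - x) < p.2 := by
  rw [mem_left_iff]; constructor <;> intro H <;> simp at H ⊢ <;> linarith

theorem mem_right_slope_iff {x h s : ℝ} {p : Plane} :
    p ∈ (DirLine.mk (x, h) (1, s)).right ↔ p.2 < h + s * (p.1 - x) := by
  rw [mem_right_iff]; constructor <;> intro H <;> simp at H ⊢ <;> linarith

variable {μ ν : Measure Plane} [IsProbabilityMeasure μ] [IsProbabilityMeasure ν]

theorem halving_of_half {S : Set Plane} (hμ : IsContinuousDist μ) {a v : Plane} (hv : v ≠ 0)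
    (h : μ ((DirLine.mk a v).right ∩ S) = μ S / 2) :
    μ ((DirLine.mk a v).left ∩ S) = μ ((DirLine.mk a v).right ∩ S) := by
  have h2 := measure_inter_add_of_line hμ S (a := a) hv
  rw [h] at h2 ⊢
  nth_rewrite 2 [← ENNReal.add_halves (μ S)] at h2
  exact (ENNReal.add_left_inj (ENNReal.div_ne_top (measure_ne_top _ _) two_ne_zero)).1 h2

/-- The share of `S` below a line. -/
noncomputable def belowShare (μ : Measure Plane) (S : Set Plane) (x h s : ℝ) : ℝ :=
  (μ ((DirLine.mk (x, h) (1, s)).right ∩ S)).toReal / (μ S).toReal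

theorem tendsto_belowShare {S A : Set Plane} (hS : MeasurableSet S) (hA : MeasurableSet A)
    {x : ℝ} {l : Filter ℝ} [l.IsCountablyGenerated] {f g : ℝ → ℝ}
    (H : ∀ᵐ p ∂μ, p ∈ S → ∀ᶠ t in l, p.2 < f t + g t * (p.1 - x) ↔ p ∈ A) :
    Tendsto (fun t => belowShare μ S x (f t) (g t)) l (𝓝 ((μ (A ∩ S)).toReal / (μ S).toReal)) := by
  refine Tendsto.div_const ((ENNReal.tendsto_toReal (measure_ne_top _ _)).comp ?_) _
  refine tendsto_measure_of_ae_tendsto_indicator_of_isFiniteMeasure _ (hA.inter hS)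
    (fun t => (DirLine.measurableSet_right _).inter hS) ?_
  filter_upwards [H] with p hp
  by_cases hpS : p ∈ S
  · filter_upwards [hp hpS] with t ht
    exact and_congr_left fun _ => mem_right_slope_iff.trans ht
  · exact Eventually.of_forall fun t => ⟨fun h => absurd h.2 hpS, fun h => absurd h.2 hpS⟩

theorem continuous_belowShare {S : Set Plane} (hμ : IsContinuousDist μ) (hS : MeasurableSet S)
    {x : ℝ} {f g : ℝ → ℝ} (hf : Continuous f) (hg : Continuous g) :
    Continuous fun t => belowShare μ S x (f t) (g t) := by
  refine continuous_iff_continuousAt.2 fun t => ?_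
  refine tendsto_belowShare (A := (DirLine.mk (x, f t) (1, g t)).right) hS
    (DirLine.measurableSet_right _) ?_
  have : ∀ᵐ p ∂μ, cross (1, g t) (p - (x, f t)) ≠ 0 := by
    rw [ae_iff]
    simpa using hμ.measure_line (x, f t) (v := (1, g t)) (by simp [Prod.ext_iff])
  filter_upwards [this] with p hp _
  have hc : ContinuousAt (fun t => f t + g t * (p.1 - x)) t := by fun_prop
  have hp' : p.2 ≠ f t + g t * (p.1 - x) := by
    intro h; apply hp; simp [cross]; linarith
  rcases lt_or_gt_of_ne hp' with h | h
  · filter_upwards [hc.eventually (lt_mem_nhds h)] with t' ht'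
    simp [mem_right_slope_iff, h, ht']
  · filter_upwards [hc.eventually (gt_mem_nhds h)] with t' ht'
    simp [mem_right_slope_iff, h.not_gt, ht'.not_gt]

theorem tendsto_belowShare_one {S : Set Plane} (hS : MeasurableSet S) (h0 : μ S ≠ 0) {x : ℝ}
    {l : Filter ℝ} [l.IsCountablyGenerated] {f g : ℝ → ℝ}
    (H : ∀ p ∈ S, Tendsto (fun t => f t + g t * (p.1 - x)) l atTop) :
    Tendsto (fun t => belowShare μ S x (f t) (g t)) l (𝓝 1) := by
  have := tendsto_belowShare (μ := μ) (A := univ) (l := l) (x := x) (f := f) (g := g) hS .univ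
    (ae_of_all _ fun p hp => by simpa using (H p hp).eventually_gt_atTop p.2)
  rwa [univ_inter, div_self] at this
  exact ENNReal.toReal_ne_zero.2 ⟨h0, measure_ne_top _ _⟩

theorem tendsto_belowShare_zero {S : Set Plane} (hS : MeasurableSet S) {x : ℝ}
    {l : Filter ℝ} [l.IsCountablyGenerated] {f g : ℝ → ℝ}
    (H : ∀ p ∈ S, Tendsto (fun t => f t + g t * (p.1 - x)) l atBot) :
    Tendsto (fun t => belowShare μ S x (f t) (g t)) l (𝓝 0) := by
  have := tendsto_belowShare (μ := μ) (A := ∅) (l := l) (x := x) (f := f) (g := g) hS .empty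
    (ae_of_all _ fun p hp => by simpa using (H p hp).eventually_le_atBot p.2)
  simpa using this

theorem belowShare_mono {S : Set Plane} {x h s h' s' : ℝ}
    (H : ∀ p ∈ S, h + s * (p.1 - x) ≤ h' + s' * (p.1 - x)) :
    belowShare μ S x h s ≤ belowShare μ S x h' s' := by
  refine div_le_div_of_nonneg_right (ENNReal.toReal_mono (measure_ne_top _ _)
    (measure_mono fun p hp => ⟨?_, hp.2⟩)) ENNReal.toReal_nonneg
  exact mem_right_slope_iff.2 ((mem_right_slope_iff.1 hp.1).trans_le (H p hp.2))

theorem halving_of_belowShare {S : Set Plane} (hμ : IsContinuousDist μ) {x h s : ℝ}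
    (h0 : μ S ≠ 0) (H : belowShare μ S x h s = 1 / 2) :
    μ ((DirLine.mk (x, h) (1, s)).left ∩ S) = μ ((DirLine.mk (x, h) (1, s)).right ∩ S) := by
  refine halving_of_half hμ (by simp [Prod.ext_iff]) ?_
  have h1 : (μ S).toReal ≠ 0 := ENNReal.toReal_ne_zero.2 ⟨h0, measure_ne_top _ _⟩
  rw [belowShare, div_eq_div_iff h1 two_ne_zero] at H
  rw [← ENNReal.toReal_eq_toReal_iff' (measure_ne_top _ _)
    (ENNReal.div_ne_top (measure_ne_top _ _) two_ne_zero), ENNReal.toReal_div]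
  simp only [ENNReal.toReal_ofNat]
  linarith

theorem exists_halving_slope (hμ : IsContinuousDist μ) {S : Set Plane} (hS : MeasurableSet S)
    (x : ℝ) : ∃ h, μ ((DirLine.mk (x, h) (1, 0)).left ∩ S) =
      μ ((DirLine.mk (x, h) (1, 0)).right ∩ S) := by
  obtain ⟨t, a, v, hv, hh, H⟩ := exists_halving_line hμ hS
    (levelLines_cross (v := (1, 0)) (by simp [Prod.ext_iff]) S)
  refine ⟨t, ?_⟩
  convert hh using 2
  · ext p
    refine and_congr_left fun hp => ?_
    rw [(H p hp).1, mem_left_slope_iff]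
    simp [cross]
  · ext p
    refine and_congr_left fun hp => ?_
    rw [(H p hp).2, mem_right_slope_iff]
    simp [cross]

theorem exists_hamSandwich (hμ : IsContinuousDist μ) (hν : IsContinuousDist ν) {S S' : Set Plane}
    (hS : MeasurableSet S) (hS' : MeasurableSet S') {x : ℝ} (hx : ∀ p ∈ S, p.1 < x)
    (hx' : ∀ p ∈ S', x < p.1) : ∃ h s,
      μ ((DirLine.mk (x, h) (1, s)).left ∩ S) = μ ((DirLine.mk (x, h) (1, s)).right ∩ S) ∧
      ν ((DirLine.mk (x, h) (1, s)).left ∩ S') = ν ((DirLine.mk (x, h) (1, s)).right ∩ S') := by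
  rcases eq_or_ne (μ S) 0 with h0 | h0
  · obtain ⟨h, hh⟩ := exists_halving_slope hν hS' x
    exact ⟨h, 0, by rw [measure_mono_null inter_subset_right h0,
      measure_mono_null inter_subset_right h0], hh⟩
  rcases eq_or_ne (ν S') 0 with h0' | h0'
  · obtain ⟨h, hh⟩ := exists_halving_slope hμ hS x
    exact ⟨h, 0, hh, by rw [measure_mono_null inter_subset_right h0',
      measure_mono_null inter_subset_right h0']⟩
  have l1 : ∀ h c : ℝ, 0 < c → Tendsto (fun s => h + s * c) atTop atTop := fun h c hc =>
    tendsto_atTop_add_const_left _ _ (tendsto_id.atTop_mul_const hc)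
  have l2 : ∀ h c : ℝ, 0 < c → Tendsto (fun s => h + s * c) atBot atBot := fun h c hc =>
    tendsto_atBot_add_const_left _ _ (tendsto_id.atBot_mul_const hc)
  have l3 : ∀ h c : ℝ, c < 0 → Tendsto (fun s => h + s * c) atTop atBot := fun h c hc =>
    tendsto_atBot_add_const_left _ _ (tendsto_id.atTop_mul_const_of_neg hc)
  have l4 : ∀ h c : ℝ, c < 0 → Tendsto (fun s => h + s * c) atBot atTop := fun h c hc =>
    tendsto_atTop_add_const_left _ _ (tendsto_id.atBot_mul_const_of_neg hc)
  obtain ⟨h, s, h1, h2⟩ := exists_common_half (F := belowShare μ S x) (G := belowShare ν S' x)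
    (fun h s t hst => belowShare_mono fun p hp => by nlinarith [hx p hp])
    (fun h s t hst => belowShare_mono fun p hp => by nlinarith [hx' p hp])
    (fun s => continuous_belowShare hμ hS continuous_id continuous_const)
    (fun h => continuous_belowShare hμ hS continuous_const continuous_id)
    (fun s => continuous_belowShare hν hS' continuous_id continuous_const)
    (fun h => continuous_belowShare hν hS' continuous_const continuous_id)
    (fun h => tendsto_belowShare_one (f := fun _ => h) (g := id) hS h0
      fun p hp => l4 h _ (sub_neg.2 (hx p hp)))
    (fun h => tendsto_belowShare_zero (f := fun _ => h) (g := id) hS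
      fun p hp => l3 h _ (sub_neg.2 (hx p hp)))
    (fun h => tendsto_belowShare_zero (f := fun _ => h) (g := id) hS'
      fun p hp => l2 h _ (sub_pos.2 (hx' p hp)))
    (fun h => tendsto_belowShare_one (f := fun _ => h) (g := id) hS' h0'
      fun p hp => l1 h _ (sub_pos.2 (hx' p hp)))
    (tendsto_belowShare_zero (f := id) (g := fun _ => 0) hS fun p _ => by
      simp only [id, zero_mul, add_zero]; exact tendsto_id)
    (tendsto_belowShare_one (f := id) (g := fun _ => 0) hS h0 fun p _ => by
      simp only [id, zero_mul, add_zero]; exact tendsto_id)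
    (tendsto_belowShare_zero (f := id) (g := fun _ => 0) hS' fun p _ => by
      simp only [id, zero_mul, add_zero]; exact tendsto_id)
    (tendsto_belowShare_one (f := id) (g := fun _ => 0) hS' h0' fun p _ => by
      simp only [id, zero_mul, add_zero]; exact tendsto_id)
  exact ⟨h, s, halving_of_belowShare hμ h0 h1, halving_of_belowShare hν h0' h2⟩

end HamSandwich

/-! ### Entropy-sensitive simulation of queries -/

section QuerySimulation

variable {n : ℕ} {α : Type} {D : Fin n → Measure Plane} [∀ i, IsProbabilityMeasure (D i)]
  {φ : α → Input n → Prop} {κ : Measure (Input n)} {d : ℕ}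
  {C : (Fin n → Set Plane) → Prop}

theorem left_neg (a v : Plane) : (DirLine.mk a (-v)).left = (DirLine.mk a v).right := by
  ext p
  rw [mem_left_iff, mem_right_iff]
  simp only [Prod.fst_neg, Prod.snd_neg]
  constructor <;> intro h <;> linarith

theorem right_neg (a v : Plane) : (DirLine.mk a (-v)).right = (DirLine.mk a v).left := by
  rw [← left_neg, neg_neg]

theorem Solves.majority (hD : ∀ i, IsContinuousDist (D i)) {R : Fin n → Set Plane}
    (hR : ∀ i, MeasurableSet (R i)) (i : Fin n) {a v : Plane} (hv : v ≠ 0)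
    (hmaj : D i ((DirLine.mk a v).right ∩ R i) ≤ D i ((DirLine.mk a v).left ∩ R i)) {e : ℝ≥0∞}
    (hbase : Solves D φ κ (n ^ 2 + 1) (· ≤ R))
    (hgood : Solves D φ κ d fun R' => R' ≤ R ∧ R' i ⊆ (DirLine.mk a v).left)
    (hall : Solves D φ (κ + (8 * e) • Measure.pi D) d (· ≤ R)) {d' : ℕ} (hd : d ≤ d') :
    Solvable D φ d' R (κ (box R) + (2 + 4 * e) * Measure.pi D (box R)) := by
  set G : Set (Input n) := {P | P i ∈ (DirLine.mk a v).right} with hG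
  have mG : MeasurableSet G := (measurable_pi_apply i) (DirLine.measurableSet_right _)
  set κ' := κ + (8 * e) • (Measure.pi D).restrict G with hκ'
  have hle : κ ≤ κ' := fun s => by rw [hκ', Measure.add_apply]; exact le_self_add
  have key := Solves.fixedLine (κ := κ') (d := d) hD (C := (· ≤ R)) (fun _ _ h h' => h.trans h') i
    (a := a) hv (hbase.mono hle le_rfl fun _ h => h) (hgood.mono hle le_rfl fun _ h => h) ?_
  · refine (key d' hd R hR le_rfl).mono (fun _ _ _ h => h) ?_
    have hGR : G ∩ box R = box (Function.update R i (R i ∩ (DirLine.mk a v).right)) := by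
      ext P; rw [mem_box_update_inter, and_comm]; rfl
    have h2 : 2 * Measure.pi D (box (Function.update R i (R i ∩ (DirLine.mk a v).right))) ≤
        Measure.pi D (box R) := by
      rw [← measure_box_add_of_line hD R i (a := a) hv, two_mul]
      refine add_le_add_left ?_ _
      rw [measure_box_update, measure_box_update, inter_comm, inter_comm (R i)]
      exact mul_le_mul_left hmaj _
    simp only [hκ', Measure.add_apply, Measure.smul_apply, smul_eq_mul]
    rw [Measure.restrict_apply' mG, inter_comm, hGR]
    calc _ = κ (box R) + (2 * Measure.pi D (box R) + 4 * e *
          (2 * Measure.pi D (box (Function.update R i (R i ∩ (DirLine.mk a v).right))))) := by ring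
      _ ≤ κ (box R) + (2 * Measure.pi D (box R) + 4 * e * Measure.pi D (box R)) := by gcongr
      _ = _ := by ring
  · intro d'' hd'' R' hR' hC
    refine (hall d'' hd'' R' hR' hC.1).mono (fun _ _ _ h => h) (le_of_eq ?_)
    simp only [hκ', Measure.add_apply, Measure.smul_apply, smul_eq_mul]
    rw [Measure.restrict_apply' mG, inter_eq_self_of_subset_left]
    intro P hP
    exact hC.2 (hP i (mem_univ i))

theorem Solves.hamSandwich (hD : ∀ i, IsContinuousDist (D i)) (hC : ∀ R R', R' ≤ R → C R → C R')
    {a b c : Fin n} (hac : a ≠ c) (hab : a ≠ b) (hbc : b ≠ c)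
    (hx : ∀ R, C R → ∃ x, (∀ p ∈ R a, p.1 < x) ∧ ∀ p ∈ R c, x < p.1) {e : ℝ≥0∞}
    (hbase : Solves D φ κ (n ^ 2 + 1) C)
    (hgood : Solves D φ κ d fun R => C R ∧ ∃ x h s,
      (R a ⊆ (DirLine.mk (x, h) (1, s)).left ∧ R c ⊆ (DirLine.mk (x, h) (1, s)).left ∧
        R b ⊆ (DirLine.mk (x, h) (1, s)).right) ∨
      (R a ⊆ (DirLine.mk (x, h) (1, s)).right ∧ R c ⊆ (DirLine.mk (x, h) (1, s)).right ∧
        R b ⊆ (DirLine.mk (x, h) (1, s)).left))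
    (hall : Solves D φ (κ + (8 * e) • Measure.pi D) d C) :
    Solves D φ (κ + (4 + 7 * e) • Measure.pi D) d C := by
  intro d' hd' R hR hCR
  obtain ⟨x, xa, xc⟩ := hx R hCR
  obtain ⟨h, s, hh, hk⟩ := exists_hamSandwich (hD a) (hD c) (hR a) (hR c) xa xc
  set l := DirLine.mk (x, h) (1, s) with hl
  have hv : ((1, s) : Plane) ≠ 0 := by simp [Prod.ext_iff]
  set R₁ := Function.update R a (R a ∩ l.left) with hR₁
  set R₂ := Function.update R a (R a ∩ l.right) with hR₂
  have m₁ : ∀ k, MeasurableSet (R₁ k) := measurableSet_update_inter hR a l.measurableSet_left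
  have m₂ : ∀ k, MeasurableSet (R₂ k) := measurableSet_update_inter hR a l.measurableSet_right
  have c₁ : C R₁ := hC R _ (update_inter_le R a _) hCR
  have c₂ : C R₂ := hC R _ (update_inter_le R a _) hCR
  have e₁ : R₁ c = R c := by simp [hR₁, hac.symm]
  have e₂ : R₂ c = R c := by simp [hR₂, hac.symm]
  have k₁ : D c (l.left ∩ R₁ c) = D c (l.right ∩ R₁ c) := by rwa [e₁]
  have k₂ : D c (l.left ∩ R₂ c) = D c (l.right ∩ R₂ c) := by rwa [e₂]
  set R₁₁ := Function.update R₁ c (R₁ c ∩ l.left) with hR₁₁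
  set R₁₂ := Function.update R₁ c (R₁ c ∩ l.right) with hR₁₂
  set R₂₁ := Function.update R₂ c (R₂ c ∩ l.left) with hR₂₁
  set R₂₂ := Function.update R₂ c (R₂ c ∩ l.right) with hR₂₂
  have u₁ : ∀ k, MeasurableSet (R₁₁ k) := measurableSet_update_inter m₁ c l.measurableSet_left
  have u₂ : ∀ k, MeasurableSet (R₁₂ k) := measurableSet_update_inter m₁ c l.measurableSet_right
  have u₃ : ∀ k, MeasurableSet (R₂₁ k) := measurableSet_update_inter m₂ c l.measurableSet_left
  have u₄ : ∀ k, MeasurableSet (R₂₂ k) := measurableSet_update_inter m₂ c l.measurableSet_right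
  have C₁ : C R₁₁ := hC _ _ (update_inter_le R₁ c _) c₁
  have C₂ : C R₁₂ := hC _ _ (update_inter_le R₁ c _) c₁
  have C₃ : C R₂₁ := hC _ _ (update_inter_le R₂ c _) c₂
  have C₄ : C R₂₂ := hC _ _ (update_inter_le R₂ c _) c₂
  have p₁ := hall (d' + 1 + 1) (by omega) _ u₁ C₁
  have p₂ := hall (d' + 1 + 1) (by omega) _ u₂ C₂
  have p₃ := hall (d' + 1 + 1) (by omega) _ u₃ C₃
  have p₄ := hall (d' + 1 + 1) (by omega) _ u₄ C₄
  have hκ : κ (box R₁) + κ (box R₂) ≤ κ (box R) := add_le_measure_box κ a hR (x, h) (1, s)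
  have hκ₁ : κ (box R₁₁) + κ (box R₁₂) ≤ κ (box R₁) := add_le_measure_box κ c m₁ (x, h) (1, s)
  have hκ₂ : κ (box R₂₁) + κ (box R₂₂) ≤ κ (box R₂) := add_le_measure_box κ c m₂ (x, h) (1, s)
  have hm : Measure.pi D (box R₁) + Measure.pi D (box R₂) = Measure.pi D (box R) :=
    measure_box_add_of_line hD R a (a := (x, h)) hv
  have hm₁ : Measure.pi D (box R₁₁) + Measure.pi D (box R₁₂) = Measure.pi D (box R₁) :=
    measure_box_add_of_line hD R₁ c (a := (x, h)) hv
  have hm₂ : Measure.pi D (box R₂₁) + Measure.pi D (box R₂₂) = Measure.pi D (box R₂) :=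
    measure_box_add_of_line hD R₂ c (a := (x, h)) hv
  have he : Measure.pi D (box R₁) = Measure.pi D (box R₂) := measure_box_halving (R := R) hh
  have he₁ : Measure.pi D (box R₁₁) = Measure.pi D (box R₁₂) := measure_box_halving k₁
  have he₂ : Measure.pi D (box R₂₁) = Measure.pi D (box R₂₂) := measure_box_halving k₂
  rw [he₁] at hm₁
  rw [he₂] at hm₂
  have he₃ : Measure.pi D (box R₁₂) = Measure.pi D (box R₂₂) := by
    rw [← hm₁, ← hm₂, ← two_mul, ← two_mul] at he
    exact (ENNReal.mul_right_inj (by simp) (by simp)).1 he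
  have key : ∀ x₁ x₂ x₃ x₄ y₁ y₂ y z m : ℝ≥0∞, x₁ + x₂ ≤ y₁ → x₃ + x₄ ≤ y₂ → y₁ + y₂ ≤ y →
      z = x₁ + x₂ + x₃ + x₄ + (10 * m + 28 * e * m) → z ≤ y + (4 + 7 * e) * (4 * m) := by
    intro x₁ x₂ x₃ x₄ y₁ y₂ y z m h1 h2 h3 hz
    rw [hz]
    refine add_le_add ?_ ?_
    · calc x₁ + x₂ + x₃ + x₄ = (x₁ + x₂) + (x₃ + x₄) := by ring
        _ ≤ y := (add_le_add h1 h2).trans h3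
    · calc 10 * m + 28 * e * m ≤ 16 * m + 28 * e * m := by gcongr; norm_num
        _ = _ := by ring
  have hmm : Measure.pi D (box R) = 4 * Measure.pi D (box R₂₂) := by
    rw [← hm, he, ← hm₂]; ring
  have hb₁ : R₁₁ b = R b := by simp [hR₁₁, hR₁, hab.symm, hbc]
  have hb₂ : R₂₂ b = R b := by simp [hR₂₂, hR₂, hab.symm, hbc]
  rcases le_total (D b (l.right ∩ R b)) (D b (l.left ∩ R b)) with hmaj | hmaj
  · have p₄' := Solves.majority (d := d) (d' := d' + 1 + 1) hD u₄ b hv (by rw [hb₂]; exact hmaj)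
      (hbase.mono le_rfl le_rfl fun _ h => hC _ _ h C₄)
      (hgood.mono le_rfl le_rfl fun R' h' => ⟨hC _ _ h'.1 C₄, x, h, s, Or.inr ⟨?_, ?_, h'.2⟩⟩)
      (hall.mono le_rfl le_rfl fun _ h => hC _ _ h C₄) (by omega)
    · refine ((p₁.step hD m₁ hv k₁ p₂).step hD hR hv hh (p₃.step hD m₂ hv k₂ p₄')).mono
        (fun _ _ _ h => h) ?_
      simp only [Measure.add_apply, Measure.smul_apply, smul_eq_mul]
      rw [← hm₁, ← hm₂, he₁, he₂, he₃, hmm]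
      refine key _ _ _ _ _ _ _ _ _ hκ₁ hκ₂ hκ ?_
      ring
    · exact (h'.1 a).trans (show R₂₂ a ⊆ l.right by simp [hR₂₂, hR₂, hac])
    · exact (h'.1 c).trans (show R₂₂ c ⊆ l.right by simp [hR₂₂])
  · have p₁' := Solves.majority (d := d) (d' := d' + 1 + 1) hD u₁ b (a := (x, h))
      (v := -(1, s)) (neg_ne_zero.2 hv) (by rw [hb₁, left_neg, right_neg]; exact hmaj)
      (hbase.mono le_rfl le_rfl fun _ h => hC _ _ h C₁)
      (hgood.mono le_rfl le_rfl fun R' h' => ⟨hC _ _ h'.1 C₁, x, h, s,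
        Or.inl ⟨?_, ?_, (left_neg (x, h) (1, s)) ▸ h'.2⟩⟩)
      (hall.mono le_rfl le_rfl fun _ h => hC _ _ h C₁) (by omega)
    · refine ((p₁'.step hD m₁ hv k₁ p₂).step hD hR hv hh (p₃.step hD m₂ hv k₂ p₄)).mono
        (fun _ _ _ h => h) ?_
      simp only [Measure.add_apply, Measure.smul_apply, smul_eq_mul]
      rw [← hm₁, ← hm₂, he₁, he₂, he₃, hmm]
      refine key _ _ _ _ _ _ _ _ _ hκ₁ hκ₂ hκ ?_
      ring
    · exact (h'.1 a).trans (show R₁₁ a ⊆ l.left by simp [hR₁₁, hR₁, hac])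
    · exact (h'.1 c).trans (show R₁₁ c ⊆ l.left by simp [hR₁₁])

theorem Solves.retry (hD : ∀ i, IsContinuousDist (D i)) (i : Fin n) {B : ℝ≥0∞}
    (hbase : Solves D φ κ (n ^ 2 + 1) fun _ => True)
    (hround : ∀ d, Solves D φ (κ + (B + 1) • Measure.pi D) d (fun _ => True) →
      Solves D φ (κ + B • Measure.pi D) d fun _ => True) :
    Solves D φ (κ + (B + 1) • Measure.pi D) 0 fun _ => True := by
  have hle : κ ≤ κ + (B + 1) • Measure.pi D := fun s => by
    rw [Measure.add_apply]; exact le_self_add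
  suffices H : ∀ f d, n ^ 2 + 1 ≤ d + f →
      Solves D φ (κ + (B + 1) • Measure.pi D) d fun _ => True from H (n ^ 2 + 1) 0 (by omega)
  intro f
  induction f with
  | zero => intro d hd; exact hbase.mono hle hd fun _ h => h
  | succ f ih =>
    intro d hd d' hd' R hR _
    have h1 := hround (d + 1) (ih (d + 1) (by omega))
    obtain ⟨t, a, v, hv, hh, -⟩ := exists_halving_line (hD i) (hR i)
      (levelLines_cross (v := (1, 0)) (by simp [Prod.ext_iff]) (R i))
    have s1 := h1 (d' + 1) (by omega) _
      (measurableSet_update_inter hR i (DirLine.mk a v).measurableSet_left) trivial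
    have s2 := h1 (d' + 1) (by omega) _
      (measurableSet_update_inter hR i (DirLine.mk a v).measurableSet_right) trivial
    refine (s1.step hD hR hv hh s2).mono (fun _ _ _ h => h) ?_
    calc _ ≤ (κ + B • Measure.pi D) (box R) + Measure.pi D (box R) :=
          add_le_add_left (add_le_measure_box _ i hR a v) _
      _ = _ := by
          simp only [Measure.add_apply, Measure.smul_apply, smul_eq_mul]; ring

/-- The outcome of the query is the same for all inputs in `box R`. -/
def Query.Resolved (q : Query n) (R : Fin n → Set Plane) : Prop :=
  (∀ P ∈ box R, q.IsLeft P) ∨ ∀ P ∈ box R, q.IsRight P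

theorem ValuesBelow.mono {f g : Plane → ℝ} {S S' T T' : Set Plane} (h : ValuesBelow f S g S')
    (h1 : T ⊆ S) (h2 : T' ⊆ S') : ValuesBelow f T g T' := by
  obtain ⟨t, h3, h4⟩ := h
  exact ⟨t, fun p hp => h3 p (h1 hp), fun p hp => h4 p (h2 hp)⟩

end QuerySimulation

section QueryTypes

variable {n : ℕ} {α : Type} {D : Fin n → Measure Plane} [∀ i, IsProbabilityMeasure (D i)]
  {φ : α → Input n → Prop} {κ : Measure (Input n)} {d : ℕ}

theorem add_smul_add_smul (μ : Measure (Input n)) {a b c : ℝ≥0∞} (h : a + b = c) :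
    κ + a • μ + b • μ = κ + c • μ := by rw [add_assoc, ← add_smul, h]

theorem le_add_smul (μ : Measure (Input n)) (a : ℝ≥0∞) : κ ≤ κ + a • μ := fun s => by
  rw [Measure.add_apply]; exact le_self_add

theorem Solves.slopeQuery (hD : ∀ i, IsContinuousDist (D i)) {i j : Fin n} {v : Plane} {hv : v ≠ 0}
    (hi : ¬ (LineSpec.slope j v hv).Uses i)
    (hbase : Solves D φ κ (n ^ 2 + 1) fun _ => True)
    (hgood : Solves D φ κ 0 (Query.Resolved ⟨i, .slope j v hv, hi⟩)) :
    Solves D φ (κ + (12 : ℝ≥0∞) • Measure.pi D) 0 fun _ => True := by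
  have key := Solves.retry hD i (κ := κ) (B := 11) hbase fun d hd => ?_
  · convert key using 3; norm_num
  have := Solves.separate (κ := κ) (d := d) (e := 3) hD (C := fun _ => True)
    (fun _ _ _ h => h) (i := i) (j := j) hi (f := fun p => cross v p)
    (g := fun p => cross v p) (fun R _ => levelLines_cross hv _) (fun R _ => levelLines_cross hv _)
    (hgood.mono le_rfl (Nat.zero_le d) ?_) (by convert hd using 3; norm_num)
  · convert this using 3; norm_num
  · have hs : ∀ P : Input n, cross v (P i - P j) = cross v (P i) - cross v (P j) := fun P => by
      simp only [cross, Prod.fst_sub, Prod.snd_sub]; ring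
    rintro R ⟨-, ⟨t, h1, h2⟩ | ⟨t, h1, h2⟩⟩
    · refine Or.inr fun P hP => ?_
      change cross v (P i - P j) < 0
      rw [hs]; linarith [h1 _ (hP i trivial), h2 _ (hP j trivial)]
    · refine Or.inl fun P hP => ?_
      change 0 < cross v (P i - P j)
      rw [hs]; linarith [h1 _ (hP j trivial), h2 _ (hP i trivial)]

/-- `S` lies strictly on one side of the vertical line through `q`. -/
def OneSide (q : Plane) (S : Set Plane) : Prop :=
  S ⊆ (DirLine.mk q (0, 1)).left ∨ S ⊆ (DirLine.mk q (0, 1)).right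

theorem OneSide.lt_or_gt {q : Plane} {S : Set Plane} (h : OneSide q S) :
    (∀ p ∈ S, p.1 - q.1 < 0) ∨ ∀ p ∈ S, 0 < p.1 - q.1 := by
  refine h.imp (fun h p hp => ?_) fun h p hp => ?_
  · have := mem_left_iff.1 (h hp); simp at this; linarith
  · have := mem_right_iff.1 (h hp); simp at this; linarith

theorem levelLines_slope {q : Plane} {S : Set Plane} (h : OneSide q S) :
    LevelLines (fun p => (p.2 - q.2) / (p.1 - q.1)) S := fun t => by
  rcases h.lt_or_gt with h | h
  · refine ⟨q, (-1, -t), by simp [Prod.ext_iff], fun p hp => ?_⟩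
    rw [mem_left_iff, mem_right_iff, lt_div_iff_of_neg (h p hp), div_lt_iff_of_neg (h p hp)]
    constructor <;> constructor <;> intro H <;> simp at H ⊢ <;> linarith
  · refine ⟨q, (1, t), by simp [Prod.ext_iff], fun p hp => ?_⟩
    rw [mem_left_iff, mem_right_iff, lt_div_iff₀ (h p hp), div_lt_iff₀ (h p hp)]
    constructor <;> constructor <;> intro H <;> simp at H ⊢ <;> linarith

theorem Solves.pivotQuery (hD : ∀ i, IsContinuousDist (D i)) {i j : Fin n} {q : Plane}
    (hi : ¬ (LineSpec.pivot q j).Uses i)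
    (hbase : Solves D φ κ (n ^ 2 + 1) fun _ => True)
    (hgood : Solves D φ κ 0 (Query.Resolved ⟨i, .pivot q j, hi⟩)) :
    Solves D φ (κ + (28 : ℝ≥0∞) • Measure.pi D) 0 fun _ => True := by
  have key := Solves.retry hD i (κ := κ) (B := 27) hbase fun d hd => ?_
  · convert key using 3; norm_num
  set κ' := κ + (23 : ℝ≥0∞) • Measure.pi D with hκ'
  have hu : ((0, 1) : Plane) ≠ 0 := by simp [Prod.ext_iff]
  have hle := le_add_smul (κ := κ) (Measure.pi D) 23
  have main : Solves D φ κ' d fun R => OneSide q (R i) ∧ OneSide q (R j) := by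
    have := Solves.separate (κ := κ) (d := d) (e := 7) hD
      (C := fun R => OneSide q (R i) ∧ OneSide q (R j))
      (fun R R' h hC => ⟨hC.1.imp (h i).trans (h i).trans, hC.2.imp (h j).trans (h j).trans⟩)
      (i := i) (j := j) hi (f := fun p => (p.2 - q.2) / (p.1 - q.1))
      (g := fun p => (p.2 - q.2) / (p.1 - q.1)) (fun R h => levelLines_slope h.1)
      (fun R h => levelLines_slope h.2) (hgood.mono le_rfl (Nat.zero_le d) ?_)
      (hd.mono (le_of_eq (by norm_num)) le_rfl fun _ _ => trivial)
    · convert this using 3; norm_num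
    · rintro R ⟨⟨h1, h2⟩, hR⟩
      have hs : ∀ P : Input n, P i ∈ R i → P j ∈ R j → cross (P j - q) (P i - q) =
          ((P i).1 - q.1) * ((P j).1 - q.1) * (((P i).2 - q.2) / ((P i).1 - q.1) -
            ((P j).2 - q.2) / ((P j).1 - q.1)) := fun P hPi hPj => by
        have n1 : (P i).1 - q.1 ≠ 0 := by
          rcases h1.lt_or_gt with h | h
          exacts [(h _ hPi).ne, (h _ hPi).ne']
        have n2 : (P j).1 - q.1 ≠ 0 := by
          rcases h2.lt_or_gt with h | h
          exacts [(h _ hPj).ne, (h _ hPj).ne']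
        simp only [cross, Prod.fst_sub, Prod.snd_sub]
        field_simp
      have hsign : (∀ P ∈ box R, 0 < ((P i).1 - q.1) * ((P j).1 - q.1)) ∨
          ∀ P ∈ box R, ((P i).1 - q.1) * ((P j).1 - q.1) < 0 := by
        rcases h1.lt_or_gt with h | h <;> rcases h2.lt_or_gt with h' | h'
        · exact Or.inl fun P hP =>
            mul_pos_of_neg_of_neg (h _ (hP i trivial)) (h' _ (hP j trivial))
        · exact Or.inr fun P hP =>
            mul_neg_of_neg_of_pos (h _ (hP i trivial)) (h' _ (hP j trivial))
        · exact Or.inr fun P hP =>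
            mul_neg_of_pos_of_neg (h _ (hP i trivial)) (h' _ (hP j trivial))
        · exact Or.inl fun P hP => mul_pos (h _ (hP i trivial)) (h' _ (hP j trivial))
      rcases hR with ⟨t, h3, h4⟩ | ⟨t, h3, h4⟩
      · rcases hsign with hs' | hs'
        · refine Or.inr fun P hP => ?_
          change cross (P j - q) (P i - q) < 0
          rw [hs P (hP i trivial) (hP j trivial)]
          exact mul_neg_of_pos_of_neg (hs' P hP)
            (by linarith [h3 _ (hP i trivial), h4 _ (hP j trivial)])
        · refine Or.inl fun P hP => ?_
          change 0 < cross (P j - q) (P i - q)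
          rw [hs P (hP i trivial) (hP j trivial)]
          exact mul_pos_of_neg_of_neg (hs' P hP)
            (by linarith [h3 _ (hP i trivial), h4 _ (hP j trivial)])
      · rcases hsign with hs' | hs'
        · refine Or.inl fun P hP => ?_
          change 0 < cross (P j - q) (P i - q)
          rw [hs P (hP i trivial) (hP j trivial)]
          exact mul_pos (hs' P hP) (by linarith [h3 _ (hP j trivial), h4 _ (hP i trivial)])
        · refine Or.inr fun P hP => ?_
          change cross (P j - q) (P i - q) < 0
          rw [hs P (hP i trivial) (hP j trivial)]
          exact mul_neg_of_neg_of_pos (hs' P hP)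
            (by linarith [h3 _ (hP j trivial), h4 _ (hP i trivial)])
  have main' : Solves D φ (κ' + (2 : ℝ≥0∞) • Measure.pi D) d fun R => OneSide q (R i) :=
    Solves.fixedLine hD (fun R R' h hC => hC.imp (h i).trans (h i).trans) j hu
      (hbase.mono hle le_rfl fun _ _ => trivial)
      (main.mono le_rfl le_rfl fun R h => ⟨h.1, Or.inl h.2⟩)
      (main.mono le_rfl le_rfl fun R h => ⟨h.1, Or.inr h.2⟩)
  have := Solves.fixedLine hD (C := fun _ => True) (fun R R' h hC => hC) i hu
      (hbase.mono (hle.trans (le_add_smul _ 2)) le_rfl fun _ _ => trivial)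
      (main'.mono le_rfl le_rfl fun R h => Or.inl h.2)
      (main'.mono le_rfl le_rfl fun R h => Or.inr h.2)
  refine this.mono (le_of_eq ?_) le_rfl fun _ _ => trivial
  rw [add_smul_add_smul _ rfl, add_smul_add_smul _ rfl]
  norm_num

/-- The orientation of a triple of points. -/
def orient (p q r : Plane) : ℝ := cross (q - p) (r - p)

/-- The sets `S`, `S'`, `S''` are separated by vertical lines, from left to right. -/
def LeftToRight (S S' S'' : Set Plane) : Prop :=
  ValuesBelow (cross (0, -1)) S (cross (0, -1)) S' ∧
  ValuesBelow (cross (0, -1)) S' (cross (0, -1)) S'' ∧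
  ValuesBelow (cross (0, -1)) S (cross (0, -1)) S''

theorem cross_zero_neg_one (p : Plane) : cross (0, -1) p = p.1 := by simp [cross]

theorem orient_pos_of_below {x h s : ℝ} {p q r : Plane} (hpq : p.1 < q.1) (hqr : q.1 < r.1)
    (hp : p ∈ (DirLine.mk (x, h) (1, s)).left) (hr : r ∈ (DirLine.mk (x, h) (1, s)).left)
    (hq : q ∈ (DirLine.mk (x, h) (1, s)).right) : 0 < orient p q r := by
  rw [mem_left_slope_iff] at hp hr
  rw [mem_right_slope_iff] at hq
  have : orient p q r = (r.2 - (h + s * (r.1 - x))) * (q.1 - p.1) +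
      (p.2 - (h + s * (p.1 - x))) * (r.1 - q.1) - (q.2 - (h + s * (q.1 - x))) * (r.1 - p.1) := by
    simp only [orient, cross, Prod.fst_sub, Prod.snd_sub]; ring
  rw [this]
  have h1 := mul_pos (sub_pos.2 hr) (sub_pos.2 hpq)
  have h2 := mul_pos (sub_pos.2 hp) (sub_pos.2 hqr)
  have h3 := mul_pos (sub_pos.2 hq) (sub_pos.2 (hpq.trans hqr))
  linarith

theorem orient_neg_of_above {x h s : ℝ} {p q r : Plane} (hpq : p.1 < q.1) (hqr : q.1 < r.1)
    (hp : p ∈ (DirLine.mk (x, h) (1, s)).right) (hr : r ∈ (DirLine.mk (x, h) (1, s)).right)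
    (hq : q ∈ (DirLine.mk (x, h) (1, s)).left) : orient p q r < 0 := by
  rw [mem_right_slope_iff] at hp hr
  rw [mem_left_slope_iff] at hq
  have : orient p q r = (r.2 - (h + s * (r.1 - x))) * (q.1 - p.1) +
      (p.2 - (h + s * (p.1 - x))) * (r.1 - q.1) - (q.2 - (h + s * (q.1 - x))) * (r.1 - p.1) := by
    simp only [orient, cross, Prod.fst_sub, Prod.snd_sub]; ring
  rw [this]
  have h1 := mul_pos (sub_pos.2 hr) (sub_pos.2 hpq)
  have h2 := mul_pos (sub_pos.2 hp) (sub_pos.2 hqr)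
  have h3 := mul_pos (sub_pos.2 hq) (sub_pos.2 (hpq.trans hqr))
  linarith

theorem Solves.orderedTriple (hD : ∀ i, IsContinuousDist (D i)) (q : Query n) {a b c : Fin n}
    (hac : a ≠ c) (hab : a ≠ b) (hbc : b ≠ c)
    (hq : ((∀ P, q.IsLeft P ↔ 0 < orient (P a) (P b) (P c)) ∧
        ∀ P, q.IsRight P ↔ orient (P a) (P b) (P c) < 0) ∨
      ((∀ P, q.IsLeft P ↔ orient (P a) (P b) (P c) < 0) ∧
        ∀ P, q.IsRight P ↔ 0 < orient (P a) (P b) (P c)))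
    {e : ℝ≥0∞} (hbase : Solves D φ κ (n ^ 2 + 1) fun _ => True)
    (hgood : Solves D φ κ d q.Resolved)
    (hall : Solves D φ (κ + (8 * e) • Measure.pi D) d fun _ => True) :
    Solves D φ (κ + (4 + 7 * e) • Measure.pi D) d fun R => LeftToRight (R a) (R b) (R c) := by
  refine Solves.hamSandwich hD (fun R R' h hC => ⟨hC.1.mono (h a) (h b), hC.2.1.mono (h b) (h c),
    hC.2.2.mono (h a) (h c)⟩) hac hab hbc ?_ (hbase.mono le_rfl le_rfl fun _ _ => trivial)
    (hgood.mono le_rfl le_rfl ?_) (hall.mono le_rfl le_rfl fun _ _ => trivial)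
  · rintro R ⟨-, -, t, h1, h2⟩
    simp only [cross_zero_neg_one] at h1 h2
    exact ⟨t, h1, h2⟩
  · rintro R ⟨⟨⟨t, h1, h2⟩, ⟨u, h3, h4⟩, -⟩, x, h, s, hR⟩
    simp only [cross_zero_neg_one] at h1 h2 h3 h4
    have hor : (∀ P ∈ box R, 0 < orient (P a) (P b) (P c)) ∨
        ∀ P ∈ box R, orient (P a) (P b) (P c) < 0 := by
      rcases hR with ⟨ha, hc, hb⟩ | ⟨ha, hc, hb⟩
      · exact Or.inl fun P hP => orient_pos_of_below
          ((h1 _ (hP a trivial)).trans (h2 _ (hP b trivial)))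
          ((h3 _ (hP b trivial)).trans (h4 _ (hP c trivial)))
          (ha (hP a trivial)) (hc (hP c trivial)) (hb (hP b trivial))
      · exact Or.inr fun P hP => orient_neg_of_above
          ((h1 _ (hP a trivial)).trans (h2 _ (hP b trivial)))
          ((h3 _ (hP b trivial)).trans (h4 _ (hP c trivial)))
          (ha (hP a trivial)) (hc (hP c trivial)) (hb (hP b trivial))
    rcases hq with ⟨q1, q2⟩ | ⟨q1, q2⟩ <;> rcases hor with ho | ho
    · exact Or.inl fun P hP => (q1 P).2 (ho P hP)
    · exact Or.inr fun P hP => (q2 P).2 (ho P hP)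
    · exact Or.inr fun P hP => (q2 P).2 (ho P hP)
    · exact Or.inl fun P hP => (q1 P).2 (ho P hP)

/-- The sets `S` and `S'` are separated by a vertical line. -/
def XSeparated (S S' : Set Plane) : Prop :=
  ValuesBelow (cross (0, -1)) S (cross (0, -1)) S' ∨
    ValuesBelow (cross (0, -1)) S' (cross (0, -1)) S

theorem XSeparated.mono {S S' T T' : Set Plane} (h : XSeparated S S') (h1 : T ⊆ S)
    (h2 : T' ⊆ S') : XSeparated T T' :=
  h.imp (fun h => h.mono h1 h2) fun h => h.mono h2 h1

theorem ValuesBelow.trans {f : Plane → ℝ} {S S' S'' : Set Plane} (h : ValuesBelow f S f S')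
    (h' : ValuesBelow f S' f S'') (hne : S'.Nonempty) : ValuesBelow f S f S'' := by
  obtain ⟨t, h1, h2⟩ := h
  obtain ⟨u, h3, h4⟩ := h'
  obtain ⟨p, hp⟩ := hne
  exact ⟨t, h1, fun r hr => ((h2 p hp).trans (h3 p hp)).trans (h4 r hr)⟩

theorem leftToRight_cases {S S' S'' : Set Plane} (h1 : XSeparated S S') (h2 : XSeparated S' S'')
    (h3 : XSeparated S S'') (hne : S'.Nonempty) :
    LeftToRight S S' S'' ∨ LeftToRight S S'' S' ∨ LeftToRight S' S S'' ∨ LeftToRight S' S'' S ∨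
      LeftToRight S'' S S' ∨ LeftToRight S'' S' S := by
  rcases h1 with h1 | h1 <;> rcases h2 with h2 | h2
  · exact Or.inl ⟨h1, h2, h1.trans h2 hne⟩
  · rcases h3 with h3 | h3
    · exact Or.inr (Or.inl ⟨h3, h2, h1⟩)
    · exact Or.inr (Or.inr (Or.inr (Or.inr (Or.inl ⟨h3, h1, h2⟩))))
  · rcases h3 with h3 | h3
    · exact Or.inr (Or.inr (Or.inl ⟨h1, h3, h2⟩))
    · exact Or.inr (Or.inr (Or.inr (Or.inl ⟨h2, h3, h1⟩)))
  · exact Or.inr (Or.inr (Or.inr (Or.inr (Or.inr ⟨h2, h1, h2.trans h1 hne⟩))))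

theorem Solves.pairQuery (hD : ∀ i, IsContinuousDist (D i)) {i j k : Fin n} {hjk : j ≠ k}
    (hi : ¬ (LineSpec.pair j k hjk).Uses i)
    (hbase : Solves D φ κ (n ^ 2 + 1) fun _ => True)
    (hgood : Solves D φ κ 0 (Query.Resolved ⟨i, .pair j k hjk, hi⟩)) :
    Solves D φ (κ + (1888 : ℝ≥0∞) • Measure.pi D) 0 fun _ => True := by
  have key := Solves.retry hD i (κ := κ) (B := 1887) hbase fun d hd => ?_
  · convert key using 3; norm_num
  have hij : i ≠ j := fun h => hi (Or.inl h)
  have hik : i ≠ k := fun h => hi (Or.inr h)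
  set q : Query n := ⟨i, .pair j k hjk, hi⟩ with hq
  have hgood' : Solves D φ κ d q.Resolved := hgood.mono le_rfl (Nat.zero_le _) fun _ h => h
  have hd' : Solves D φ (κ + (8 * 236 : ℝ≥0∞) • Measure.pi D) d fun _ => True := by
    convert hd using 3; norm_num
  have o : ∀ P : Input n, orient (P j) (P k) (P i) = cross (P k - P j) (P i - P j) := fun _ => rfl
  have s1 : ∀ P : Input n, orient (P i) (P j) (P k) = cross (P k - P j) (P i - P j) := fun P => by
    simp only [orient, cross, Prod.fst_sub, Prod.snd_sub]; ring
  have s2 : ∀ P : Input n, orient (P i) (P k) (P j) = -cross (P k - P j) (P i - P j) := fun P => by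
    simp only [orient, cross, Prod.fst_sub, Prod.snd_sub]; ring
  have s3 : ∀ P : Input n, orient (P j) (P i) (P k) = -cross (P k - P j) (P i - P j) := fun P => by
    simp only [orient, cross, Prod.fst_sub, Prod.snd_sub]; ring
  have s5 : ∀ P : Input n, orient (P k) (P i) (P j) = cross (P k - P j) (P i - P j) := fun P => by
    simp only [orient, cross, Prod.fst_sub, Prod.snd_sub]; ring
  have s6 : ∀ P : Input n, orient (P k) (P j) (P i) = -cross (P k - P j) (P i - P j) := fun P => by
    simp only [orient, cross, Prod.fst_sub, Prod.snd_sub]; ring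
  have L : ∀ P : Input n, q.IsLeft P ↔ 0 < cross (P k - P j) (P i - P j) := fun _ => Iff.rfl
  have Rt : ∀ P : Input n, q.IsRight P ↔ cross (P k - P j) (P i - P j) < 0 := fun _ => Iff.rfl
  have t1 := Solves.orderedTriple hD q hik hij hjk (Or.inl ⟨fun P => by rw [s1, L],
    fun P => by rw [s1, Rt]⟩) hbase hgood' hd'
  have t2 := Solves.orderedTriple hD q hij hik hjk.symm (Or.inr ⟨fun P => by
    rw [s2, L, neg_lt_zero], fun P => by rw [s2, Rt, neg_pos]⟩) hbase hgood' hd'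
  have t3 := Solves.orderedTriple hD q hjk hij.symm hik (Or.inr ⟨fun P => by
    rw [s3, L, neg_lt_zero], fun P => by rw [s3, Rt, neg_pos]⟩) hbase hgood' hd'
  have t4 := Solves.orderedTriple hD q hij.symm hjk hik.symm (Or.inl ⟨fun P => by rw [o, L],
    fun P => by rw [o, Rt]⟩) hbase hgood' hd'
  have t5 := Solves.orderedTriple hD q hjk.symm hik.symm hij (Or.inl ⟨fun P => by rw [s5, L],
    fun P => by rw [s5, Rt]⟩) hbase hgood' hd'
  have t6 := Solves.orderedTriple hD q hik.symm hjk.symm hij.symm (Or.inr ⟨fun P => by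
    rw [s6, L, neg_lt_zero], fun P => by rw [s6, Rt, neg_pos]⟩) hbase hgood' hd'
  have eA : (4 + 7 * 236 : ℝ≥0∞) = 1656 := by norm_num
  rw [eA] at t1 t2 t3 t4 t5 t6
  have u1 : Solves D φ (κ + (1656 : ℝ≥0∞) • Measure.pi D) d fun R =>
      (XSeparated (R i) (R j) ∧ XSeparated (R j) (R k)) ∧ XSeparated (R i) (R k) := by
    rintro d' hd' R hR ⟨⟨h1, h2⟩, h3⟩
    rcases (R j).eq_empty_or_nonempty with hne | hne
    · refine (hgood' d' hd' R hR (Or.inl fun P hP => ?_)).mono (fun _ _ _ h => h)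
        (le_add_smul _ _ _)
      have := hP j trivial
      rw [hne] at this
      exact this.elim
    · rcases leftToRight_cases h1 h2 h3 hne with h | h | h | h | h | h
      exacts [t1 d' hd' R hR h, t2 d' hd' R hR h, t3 d' hd' R hR h, t4 d' hd' R hR h,
        t5 d' hd' R hR h, t6 d' hd' R hR h]
  have hl : ((0, -1) : Plane) ≠ 0 := by simp [Prod.ext_iff]
  have u2 : Solves D φ (κ + (1832 : ℝ≥0∞) • Measure.pi D) d fun R =>
      XSeparated (R i) (R j) ∧ XSeparated (R j) (R k) := by
    have := Solves.separate (e := 58) hD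
      (C := fun R => XSeparated (R i) (R j) ∧ XSeparated (R j) (R k))
      (fun R R' h hC => ⟨hC.1.mono (h i) (h j), hC.2.mono (h j) (h k)⟩) hik
      (fun R _ => levelLines_cross hl _) (fun R _ => levelLines_cross hl _) u1
      (hd.mono (le_of_eq (by rw [add_smul_add_smul _ rfl]; norm_num)) le_rfl fun _ _ => trivial)
    rw [add_smul_add_smul _ rfl] at this
    convert this using 3; norm_num
  have u3 : Solves D φ (κ + (1876 : ℝ≥0∞) • Measure.pi D) d fun R => XSeparated (R i) (R j) := by
    have := Solves.separate (e := 14) hD (C := fun R => XSeparated (R i) (R j))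
      (fun R R' h hC => hC.mono (h i) (h j)) hjk
      (fun R _ => levelLines_cross hl _) (fun R _ => levelLines_cross hl _) u2
      (hd.mono (le_of_eq (by rw [add_smul_add_smul _ rfl]; norm_num)) le_rfl fun _ _ => trivial)
    rw [add_smul_add_smul _ rfl] at this
    convert this using 3; norm_num
  have := Solves.separate (e := 3) hD (C := fun _ => True) (fun R R' h hC => hC) hij
    (fun R _ => levelLines_cross hl _) (fun R _ => levelLines_cross hl _)
    (u3.mono le_rfl le_rfl fun R h => h.2)
    (hd.mono (le_of_eq (by rw [add_smul_add_smul _ rfl]; norm_num)) le_rfl fun _ _ => trivial)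
  rw [add_smul_add_smul _ rfl] at this
  convert this using 3; norm_num

theorem Solves.query (hD : ∀ i, IsContinuousDist (D i)) (q : Query n)
    (hbase : Solves D φ κ (n ^ 2 + 1) fun _ => True) (hgood : Solves D φ κ 0 q.Resolved) :
    Solves D φ (κ + (1888 : ℝ≥0∞) • Measure.pi D) 0 fun _ => True := by
  have hmono : ∀ c : ℝ≥0∞, c ≤ 1888 →
      κ + c • Measure.pi D ≤ κ + (1888 : ℝ≥0∞) • Measure.pi D := fun c hc s => by
    simp only [Measure.add_apply, Measure.smul_apply, smul_eq_mul]; gcongr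
  obtain ⟨i, s, hi⟩ := q
  cases s with
  | fixed a v hv =>
    refine (Solves.fixedLine hD (fun _ _ _ h => h) i (a := a) hv hbase
      (hgood.mono le_rfl le_rfl fun R h => Or.inl fun P hP => h.2 (hP i trivial))
      (hgood.mono le_rfl le_rfl fun R h => Or.inr fun P hP => h.2 (hP i trivial))).mono
      (hmono 2 (by norm_num)) le_rfl fun _ h => h
  | slope j v hv =>
    exact (Solves.slopeQuery hD hi hbase hgood).mono (hmono 12 (by norm_num)) le_rfl fun _ h => h
  | pivot p j =>
    exact (Solves.pivotQuery hD hi hbase hgood).mono (hmono 28 (by norm_num)) le_rfl fun _ h => h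
  | pair j k hjk => exact Solves.pairQuery hD hi hbase hgood

/-- Every linear comparison tree can be simulated by an entropy-sensitive tree with only a
constant factor loss in expected depth. -/
theorem LinTree.exists_entropySensitive (hD : ∀ i, IsContinuousDist (D i)) (T : LinTree n α) :
    ∃ T' : LinTree n α, T'.EntropySensitive D ∧ (∀ P γ, T'.LeadsTo P γ → T.LeadsTo P γ) ∧
      T'.expectedDepth D ≤ 1889 * T.expectedDepth D := by
  suffices H : Solves D (fun γ P => T.LeadsTo P γ)
      ((Measure.pi D).withDensity fun P => 1889 * (T.leafDepth P : ℝ≥0∞)) 0 fun _ => True by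
    obtain ⟨T', h1, h2, h3⟩ := H 0 le_rfl (fun _ => univ) (fun _ => .univ) trivial
    have hb : box (fun _ : Fin n => (univ : Set Plane)) = univ := by simp [box]
    rw [hb] at h2 h3
    refine ⟨T', h1, fun P γ => h2 P trivial γ, ?_⟩
    rw [withDensity_apply _ .univ, Measure.restrict_univ,
      lintegral_const_mul _ T.measurable_leafDepth] at h3
    exact h3
  induction T with
  | leaf a =>
    intro d _ R hR _
    exact ⟨leaf a, trivial, fun _ _ _ h => h, by simp [leafDepth]⟩
  | node q l r hl hr =>
    classical
    set g : Input n → ℝ≥0∞ := fun P =>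
      if q.IsLeft P then (l.leafDepth P : ℝ≥0∞) else r.leafDepth P with hg
    have mg : Measurable g :=
      Measurable.ite q.measurableSet_isLeft l.measurable_leafDepth r.measurable_leafDepth
    have hnode : ∀ P, ((node q l r).leafDepth P : ℝ≥0∞) = g P + 1 := fun P => by
      simp only [leafDepth, hg]; split_ifs <;> simp
    set κ := (Measure.pi D).withDensity (fun P => 1889 * g P) + (1 : ℝ≥0∞) • Measure.pi D with hκ
    have hκ' : ((Measure.pi D).withDensity fun P => 1889 * ((node q l r).leafDepth P : ℝ≥0∞)) =
        κ + (1888 : ℝ≥0∞) • Measure.pi D := by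
      rw [hκ, add_smul_add_smul _ rfl, ← withDensity_const,
        ← withDensity_add_right _ measurable_const]
      congr 1
      funext P
      simp only [hnode, mul_add, mul_one, Pi.add_apply]
      norm_num
    rw [hκ']
    refine Solves.query hD q ?_ ?_
    · intro d hd R hR _
      refine ⟨node q l r, fun h => absurd h (by omega), fun _ _ _ h => h, ?_⟩
      simp only [hnode]
      rw [lintegral_add_right _ measurable_const, hκ, Measure.add_apply,
        withDensity_apply _ (measurableSet_box hR), lintegral_const_mul _ mg]
      simp only [lintegral_const, Measure.restrict_apply_univ, Measure.smul_apply, smul_eq_mul]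
      gcongr
      exact le_mul_of_one_le_left zero_le (by norm_num)
    · rintro d hd R hR (h | h)
      · refine (hl d hd R hR trivial).mono (fun P hP γ hγ => Or.inl ⟨h P hP, hγ⟩) ?_
        refine le_trans ?_ (le_add_smul _ _ _)
        rw [withDensity_apply _ (measurableSet_box hR), withDensity_apply _ (measurableSet_box hR)]
        refine (setLIntegral_congr_fun (measurableSet_box hR) fun P hP => ?_).le
        simp [hg, h P hP]
      · refine (hr d hd R hR trivial).mono (fun P hP γ hγ => Or.inr ⟨h P hP, hγ⟩) ?_
        refine le_trans ?_ (le_add_smul _ _ _)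
        rw [withDensity_apply _ (measurableSet_box hR), withDensity_apply _ (measurableSet_box hR)]
        refine (setLIntegral_congr_fun (measurableSet_box hR) fun P hP => ?_).le
        have : ¬ q.IsLeft P := fun h' => DirLine.not_mem_right h' (h P hP)
        simp [hg, this]

end QueryTypes

/-! ### Witness pairs -/

theorem below_segment_iff {p q r : Plane} (hqr : q.1 < r.1) (h1 : q.1 ≤ p.1) (h2 : p.1 ≤ r.1) :
    Below p (segment ℝ q r) ↔
      p.2 * (r.1 - q.1) < q.2 * (r.1 - p.1) + r.2 * (p.1 - q.1) := by
  have h0 : 0 < r.1 - q.1 := sub_pos.2 hqr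
  constructor
  · rintro ⟨y, hy, a, b, ha, hb, hab, h⟩
    have e1 : a * q.1 + b * r.1 = p.1 := by simpa using congrArg Prod.fst h
    have e2 : a * q.2 + b * r.2 = y := by simpa using congrArg Prod.snd h
    have ha' : a = 1 - b := by linarith
    subst ha'
    have e3 : p.1 - q.1 = b * (r.1 - q.1) := by linarith
    have e4 : r.1 - p.1 = (1 - b) * (r.1 - q.1) := by linarith
    rw [e3, e4, ← mul_assoc, ← mul_assoc, ← add_mul]
    refine mul_lt_mul_of_pos_right ?_ h0
    linarith
  · intro h
    refine ⟨(q.2 * (r.1 - p.1) + r.2 * (p.1 - q.1)) / (r.1 - q.1), by rwa [lt_div_iff₀ h0],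
      (r.1 - p.1) / (r.1 - q.1), (p.1 - q.1) / (r.1 - q.1),
      div_nonneg (by linarith) h0.le, div_nonneg (by linarith) h0.le, ?_, ?_⟩
    · rw [← add_div, div_eq_one_iff_eq h0.ne']; ring
    · refine Prod.ext ?_ ?_
      · simp only [Prod.fst_add, Prod.smul_fst, smul_eq_mul]; field_simp; ring
      · simp only [Prod.snd_add, Prod.smul_snd, smul_eq_mul]; field_simp

theorem lss_comm (q r : Plane) : lss q r = lss r q := by
  unfold lss; rw [min_comm, max_comm, segment_symm]

theorem mem_lss_iff_of_lt {p q r : Plane} (h : q.1 < r.1) : p ∈ lss q r ↔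
    q.1 < p.1 ∧ p.1 < r.1 ∧ p.2 * (r.1 - q.1) < q.2 * (r.1 - p.1) + r.2 * (p.1 - q.1) := by
  unfold lss
  rw [mem_ofPred_eq, min_eq_left h.le, max_eq_right h.le]
  exact and_congr_right fun h1 => and_congr_right fun h2 => below_segment_iff h h1.le h2.le

theorem mem_lss_iff {p q r : Plane} : p ∈ lss q r ↔
    (q.1 < p.1 ∧ p.1 < r.1 ∧ p.2 * (r.1 - q.1) < q.2 * (r.1 - p.1) + r.2 * (p.1 - q.1)) ∨
    (r.1 < p.1 ∧ p.1 < q.1 ∧ p.2 * (q.1 - r.1) < r.2 * (q.1 - p.1) + q.2 * (p.1 - r.1)) := by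
  rcases lt_trichotomy q.1 r.1 with h | h | h
  · rw [mem_lss_iff_of_lt h]
    exact ⟨Or.inl, fun h' => h'.resolve_right fun h' => by linarith⟩
  · constructor
    · rintro ⟨h1, h2, -⟩
      rw [h, min_self] at h1
      rw [h, max_self] at h2
      linarith
    · rintro (h' | h') <;> linarith
  · rw [lss_comm, mem_lss_iff_of_lt h]
    exact ⟨Or.inr, fun h' => h'.resolve_left fun h' => by linarith⟩

theorem ne_of_mem_lss {p q r : Plane} (h : p ∈ lss q r) : q.1 ≠ r.1 ∧ p.1 ≠ q.1 ∧ p.1 ≠ r.1 := by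
  rcases mem_lss_iff.1 h with h | h
  · exact ⟨by linarith, by linarith, by linarith⟩
  · exact ⟨by linarith, by linarith, by linarith⟩

/-- Reflection at the vertical axis. -/
def mirror (p : Plane) : Plane := (-p.1, p.2)

theorem mirror_mem_lss {p q r : Plane} : mirror p ∈ lss (mirror q) (mirror r) ↔ p ∈ lss q r := by
  rw [mem_lss_iff, mem_lss_iff, or_comm]
  simp only [mirror, neg_lt_neg_iff]
  refine or_congr ?_ ?_ <;>
  · rw [and_left_comm]
    refine and_congr_right fun _ => and_congr_right fun _ => ?_
    constructor <;> intro h <;> linarith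

theorem lss_subst_aux {p q r s t : Plane} (h : p ∈ lss q r) (h' : q ∈ lss s t)
    (hq : q.1 < p.1) (hs : s.1 < t.1) (ht : p = t ∨ p.1 ≠ t.1) :
    p ∈ lss s r ∨ p ∈ lss t r ∨ p ∈ lss s t := by
  obtain ⟨h1, h2, h3⟩ := (mem_lss_iff.1 h).resolve_right fun h' => by linarith
  obtain ⟨h4, h5, h6⟩ := (mem_lss_iff_of_lt hs).1 h'
  set E : Plane → ℝ := fun a => (a.2 - p.2) * (r.1 - p.1) - (r.2 - p.2) * (a.1 - p.1) with hE
  have hEq : 0 < E q := by simp only [hE]; linarith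
  have hst : 0 < E s * (t.1 - q.1) + E t * (q.1 - s.1) := by
    have e : E s * (t.1 - q.1) + E t * (q.1 - s.1) = E q * (t.1 - s.1) +
        (r.1 - p.1) * (s.2 * (t.1 - q.1) + t.2 * (q.1 - s.1) - q.2 * (t.1 - s.1)) := by
      simp only [hE]; ring
    rw [e]
    exact add_pos (mul_pos hEq (sub_pos.2 hs)) (mul_pos (sub_pos.2 h2) (sub_pos.2 h6))
  have hin : ∀ a : Plane, a.1 < p.1 → 0 < E a → p ∈ lss a r := fun a ha hEa => by
    refine mem_lss_iff.2 (Or.inl ⟨ha, h2, ?_⟩)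
    simp only [hE] at hEa; linarith
  rcases lt_or_ge 0 (E s) with hEs | hEs
  · exact Or.inl (hin s (h4.trans hq) hEs)
  have hEt : 0 < E t := by
    by_contra hle
    have := mul_nonpos_of_nonpos_of_nonneg hEs (sub_pos.2 h5).le
    have := mul_nonpos_of_nonpos_of_nonneg (not_lt.1 hle) (sub_pos.2 h4).le
    linarith
  rcases lt_or_ge t.1 p.1 with htp | htp
  · exact Or.inr (Or.inl (hin t htp hEt))
  have hpt : p.1 < t.1 := by
    refine lt_of_le_of_ne htp ?_
    rcases ht with ht | ht
    · exfalso
      rw [← ht] at hEt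
      simp [hE] at hEt
    · exact ht
  refine Or.inr (Or.inr ((mem_lss_iff_of_lt hs).2 ⟨h4.trans hq, hpt, ?_⟩))
  have key : 0 < E s * (t.1 - p.1) + E t * (p.1 - s.1) := by
    have a1 : 0 ≤ -E s * (p.1 - q.1) := mul_nonneg (by linarith) (by linarith)
    have a2 : 0 < E t * (p.1 - q.1) := mul_pos hEt (by linarith)
    linarith
  have e : E s * (t.1 - p.1) + E t * (p.1 - s.1) = (r.1 - p.1) *
      (s.2 * (t.1 - p.1) + t.2 * (p.1 - s.1) - p.2 * (t.1 - s.1)) := by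
    simp only [hE]; ring
  rw [e] at key
  exact sub_pos.1 ((mul_pos_iff_of_pos_left (sub_pos.2 h2)).1 key)

/-- If `q` belongs to a witness pair of `p`, it can be replaced by a point of its own witness
pair, or the latter is a witness pair of `p`. -/
theorem lss_subst {p q r s t : Plane} (h : p ∈ lss q r) (h' : q ∈ lss s t)
    (hs : p = s ∨ p.1 ≠ s.1) (ht : p = t ∨ p.1 ≠ t.1) :
    p ∈ lss s r ∨ p ∈ lss t r ∨ p ∈ lss s t := by
  have key : ∀ p q r s t : Plane, p ∈ lss q r → q ∈ lss s t → q.1 < p.1 → (p = s ∨ p.1 ≠ s.1) →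
      (p = t ∨ p.1 ≠ t.1) → p ∈ lss s r ∨ p ∈ lss t r ∨ p ∈ lss s t := by
    intro p q r s t h h' hq hs ht
    rcases lt_or_gt_of_ne (ne_of_mem_lss h').1 with hst | hst
    · exact lss_subst_aux h h' hq hst ht
    · rw [lss_comm] at h'
      rcases lss_subst_aux h h' hq hst hs with h | h | h
      exacts [Or.inr (Or.inl h), Or.inl h, Or.inr (Or.inr (lss_comm _ _ ▸ h))]
  have hm : ∀ a b : Plane, (a = b ∨ a.1 ≠ b.1) → mirror a = mirror b ∨ (mirror a).1 ≠ (mirror b).1 :=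
    fun a b hab => hab.imp (congrArg _) fun h => by simpa [mirror] using h
  rcases lt_or_gt_of_ne (ne_of_mem_lss h).2.1 with hq | hq
  · have := key (mirror p) (mirror q) (mirror r) (mirror s) (mirror t) (mirror_mem_lss.2 h)
      (mirror_mem_lss.2 h') (by simpa [mirror] using hq) (hm _ _ hs) (hm _ _ ht)
    simpa only [mirror_mem_lss] using this
  · exact key p q r s t h h' hq hs ht

/-! ### Extremal certificates -/

namespace LinTree

variable {n : ℕ}

/-- Ask whether the point `i` is to the left of the vertical line through the point `j`. -/
noncomputable def askLeftOf (i j : Fin n) : LinTree n Bool :=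
  ask i (.slope j (0, 1) (by simp [Prod.ext_iff]))

theorem askLeftOf_true {P : Input n} {i j : Fin n} (h : (askLeftOf i j).LeadsTo P true) :
    (P i).1 < (P j).1 := by
  have := mem_left_iff.1 (ask_true h)
  simp at this; exact this

theorem askLeftOf_false {P : Input n} {i j : Fin n} (h : (askLeftOf i j).LeadsTo P false)
    (hij : i ≠ j) : (P j).1 < (P i).1 := by
  have := mem_right_iff.1 (ask_false h hij)
  simp at this; exact this

open Classical in
/-- Ask whether the point `i` is below the line through the points `j` and `k`, of which `j` is
to the left of `k`. -/
noncomputable def askBelow (i j k : Fin n) : LinTree n Bool :=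
  if h : j = k then leaf false else (ask i (.pair j k h)).map not

theorem height_askBelow (i j k : Fin n) : (askBelow i j k).height ≤ 1 := by
  unfold askBelow
  split_ifs
  · simp [height]
  · rw [height_map]; exact height_ask _ _

theorem askBelow_iff {P : Input n} {i j k : Fin n} {b : Bool} (h : (askBelow i j k).LeadsTo P b)
    (h1 : (P j).1 < (P i).1) (h2 : (P i).1 < (P k).1) :
    b = true ↔ P i ∈ lss (P j) (P k) := by
  have h3 := h1.trans h2
  have hjk : j ≠ k := by rintro rfl; exact lt_irrefl _ h3
  have hu : ¬ (LineSpec.pair j k hjk).Uses i := by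
    rintro (rfl | rfl)
    exacts [lt_irrefl _ h1, lt_irrefl _ h2]
  unfold askBelow at h
  rw [dif_neg hjk, leadsTo_map] at h
  obtain ⟨c, hc, rfl⟩ := h
  rw [mem_lss_iff_of_lt h3]
  cases c
  · have := mem_right_iff.1 (ask_false hc hu)
    simp only [Prod.fst_sub, Prod.snd_sub] at this
    simp only [Bool.not_false, true_iff]
    exact ⟨h1, h2, by linarith⟩
  · have := mem_left_iff.1 (ask_true hc)
    simp only [Prod.fst_sub, Prod.snd_sub] at this
    simp only [Bool.not_true, Bool.false_eq_true, false_iff]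
    rintro ⟨-, -, h⟩
    linarith

open Classical in
/-- Decide whether `q` and `r` are a witness pair for `p`. -/
noncomputable def askWitness (p q r : Fin n) : LinTree n Bool :=
  if p = q ∨ p = r then leaf false else
    (askLeftOf p q).bind fun b => (askLeftOf p r).bind fun b' =>
      if b = b' then leaf false else if b then askBelow p r q else askBelow p q r

theorem height_askWitness (p q r : Fin n) : (askWitness p q r).height ≤ 3 := by
  unfold askWitness
  split_ifs
  · simp [height]
  · refine (height_bind_le (B := 2) fun b => ?_).trans (Nat.add_le_add_right (height_ask _ _) 2)
    refine (height_bind_le (B := 1) fun b' => ?_).trans (Nat.add_le_add_right (height_ask _ _) 1)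
    split_ifs
    · simp [height]
    · exact height_askBelow _ _ _
    · exact height_askBelow _ _ _

theorem askWitness_spec {P : Input n} {p q r : Fin n} {b : Bool}
    (h : (askWitness p q r).LeadsTo P b) :
    (b = true ↔ P p ∈ lss (P q) (P r)) ∧ (p = q ∨ p = r ∨ (P p).1 ≠ (P q).1) := by
  unfold askWitness at h
  split_ifs at h with h0
  · obtain rfl : false = b := h
    refine ⟨⟨fun h => absurd h (by simp), fun h => ?_⟩, h0.imp id Or.inl⟩
    rcases h0 with rfl | rfl
    exacts [absurd rfl (ne_of_mem_lss h).2.1, absurd rfl (ne_of_mem_lss h).2.2]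
  · rw [not_or] at h0
    rw [leadsTo_bind] at h
    obtain ⟨b₁, h1, h⟩ := h
    rw [leadsTo_bind] at h
    obtain ⟨b₂, h2, h⟩ := h
    cases b₁ <;> cases b₂ <;> simp only [if_true, reduceCtorEq, if_false, Bool.false_eq_true] at h
    · have h1 := askLeftOf_false h1 h0.1
      have h2 := askLeftOf_false h2 h0.2
      obtain rfl : false = b := h
      refine ⟨⟨fun h => absurd h (by simp), fun h => ?_⟩, Or.inr (Or.inr h1.ne')⟩
      rcases mem_lss_iff.1 h with h | h <;> linarith
    · have h1 := askLeftOf_false h1 h0.1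
      have h2 := askLeftOf_true h2
      exact ⟨askBelow_iff h h1 h2, Or.inr (Or.inr h1.ne')⟩
    · have h1 := askLeftOf_true h1
      have h2 := askLeftOf_false h2 h0.2
      rw [lss_comm]
      exact ⟨askBelow_iff h h2 h1, Or.inr (Or.inr h1.ne)⟩
    · have h1 := askLeftOf_true h1
      have h2 := askLeftOf_true h2
      obtain rfl : false = b := h
      refine ⟨⟨fun h => absurd h (by simp), fun h => ?_⟩, Or.inr (Or.inr h1.ne)⟩
      rcases mem_lss_iff.1 h with h | h <;> linarith

/-- Replace the point `q` of the witness pair `(q, r)` of `p`, by means of the witness pair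
`(s, t)` of `q`. -/
noncomputable def replaceWitness (p r s t : Fin n) : LinTree n (Fin n × Fin n) :=
  (askWitness p s r).bind fun b => if b then leaf (s, r) else
    (askWitness p t r).bind fun b => if b then leaf (t, r) else leaf (s, t)

theorem height_replaceWitness (p r s t : Fin n) : (replaceWitness p r s t).height ≤ 6 := by
  refine (height_bind_le (B := 3) fun b => ?_).trans
    (Nat.add_le_add_right (height_askWitness _ _ _) 3)
  split_ifs
  · simp [height]
  · refine (height_bind_le (B := 0) fun b => ?_).trans (height_askWitness _ _ _)
    split_ifs <;> simp [height]

/-- `P i` lies below the segment of the pair `a`. -/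
def WitnessedBy (P : Input n) (i : Fin n) (a : Fin n × Fin n) : Prop := P i ∈ lss (P a.1) (P a.2)

theorem replaceWitness_spec {P : Input n} {p q r s t : Fin n} {w : Fin n × Fin n}
    (h : (replaceWitness p r s t).LeadsTo P w) (hp : P p ∈ lss (P q) (P r))
    (hq : P q ∈ lss (P s) (P t)) :
    WitnessedBy P p w ∧ ∀ u, u = w.1 ∨ u = w.2 → u = r ∨ u = s ∨ u = t := by
  have hpr : p ≠ r := by rintro rfl; exact (ne_of_mem_lss hp).2.2 rfl
  unfold replaceWitness at h
  rw [leadsTo_bind] at h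
  obtain ⟨b, h1, h⟩ := h
  obtain ⟨h1, h1'⟩ := askWitness_spec h1
  cases b <;> simp only [if_true, if_false, Bool.false_eq_true] at h
  · rw [leadsTo_bind] at h
    obtain ⟨b, h2, h⟩ := h
    obtain ⟨h2, h2'⟩ := askWitness_spec h2
    cases b <;> simp only [if_true, if_false, Bool.false_eq_true] at h <;>
      obtain rfl : _ = w := h
    · refine ⟨?_, by rintro u (h | h) <;> simp [h]⟩
      simp only [Bool.false_eq_true, false_iff] at h1 h2
      have := lss_subst hp hq (h1'.elim (fun h => Or.inl (h ▸ rfl)) fun h => Or.inr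
        (h.resolve_left hpr)) (h2'.elim (fun h => Or.inl (h ▸ rfl)) fun h => Or.inr
        (h.resolve_left hpr))
      exact (this.resolve_left h1).resolve_left h2
    · exact ⟨h2.1 rfl, by rintro u (h | h) <;> simp [h]⟩
  · obtain rfl : _ = w := h
    exact ⟨h1.1 rfl, by rintro u (h | h) <;> simp [h]⟩

open Classical in
/-- Remove the point `q` from the witness pair `a` of `p`, by means of the witness pair `b`
of `q`. -/
noncomputable def substWitness (p : Fin n) (a : Fin n × Fin n) (q : Fin n) (b : Fin n × Fin n) :
    LinTree n (Fin n × Fin n) :=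
  if a.1 = q then replaceWitness p a.2 b.1 b.2 else
    if a.2 = q then replaceWitness p a.1 b.1 b.2 else leaf a

theorem height_substWitness (p : Fin n) (a : Fin n × Fin n) (q : Fin n) (b : Fin n × Fin n) :
    (substWitness p a q b).height ≤ 6 := by
  unfold substWitness
  split_ifs
  exacts [height_replaceWitness _ _ _ _, height_replaceWitness _ _ _ _, by simp [height]]

theorem substWitness_spec {P : Input n} {p q : Fin n} {a b w : Fin n × Fin n}
    (h : (substWitness p a q b).LeadsTo P w) (hp : WitnessedBy P p a) (hq : WitnessedBy P q b) :
    WitnessedBy P p w ∧ ∀ u, u = w.1 ∨ u = w.2 →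
      ((u = a.1 ∨ u = a.2) ∧ u ≠ q) ∨ u = b.1 ∨ u = b.2 := by
  have hne : a.1 ≠ a.2 := fun h => (ne_of_mem_lss hp).1 (by rw [h])
  unfold substWitness at h
  split_ifs at h with h1 h2
  · subst h1
    obtain ⟨h3, h4⟩ := replaceWitness_spec h hp hq
    refine ⟨h3, fun u hu => ?_⟩
    rcases h4 u hu with rfl | h | h
    exacts [Or.inl ⟨Or.inr rfl, hne.symm⟩, Or.inr (Or.inl h), Or.inr (Or.inr h)]
  · subst h2
    obtain ⟨h3, h4⟩ := replaceWitness_spec h ((lss_comm _ _).subset hp) hq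
    refine ⟨h3, fun u hu => ?_⟩
    rcases h4 u hu with rfl | h | h
    exacts [Or.inl ⟨Or.inl rfl, hne⟩, Or.inr (Or.inl h), Or.inr (Or.inr h)]
  · obtain rfl : a = w := h
    refine ⟨hp, fun u hu => Or.inl ⟨hu, ?_⟩⟩
    rintro rfl
    exact hu.elim (fun h => h1 h.symm) fun h => h2 h.symm

open Classical in
theorem exists_few_occurrences {S : Finset (Fin n)} (hS : S.Nonempty) (W : Fin n → Fin n × Fin n) :
    ∃ p ∈ S, (S.filter fun i => p = (W i).1 ∨ p = (W i).2).card ≤ 2 := by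
  by_contra! hlt
  have h1 := Finset.sum_card_bipartiteAbove_eq_sum_card_bipartiteBelow (s := S) (t := S)
    (fun p i => p = (W i).1 ∨ p = (W i).2)
  have h2 : ∑ i ∈ S, (Finset.bipartiteBelow (fun p i => p = (W i).1 ∨ p = (W i).2) S i).card ≤
      ∑ _i ∈ S, 2 := by
    refine Finset.sum_le_sum fun i _ => ?_
    refine (Finset.card_le_card (t := {(W i).1, (W i).2}) fun p hp => ?_).trans Finset.card_le_two
    simpa [Finset.bipartiteBelow] using (Finset.mem_filter.1 hp).2
  have h3 : ∑ _i ∈ S, 2 < ∑ p ∈ S,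
      (Finset.bipartiteAbove (fun p i => p = (W i).1 ∨ p = (W i).2) S p).card :=
    Finset.sum_lt_sum_of_nonempty hS fun p hp => hlt p hp
  omega

open Classical in
/-- Convert the witness pairs of the points in `S` into pairs of points outside `S`. The points
are eliminated one by one, each time a point that occurs in few pairs. -/
noncomputable def eliminate : ℕ → Finset (Fin n) → (Fin n → Fin n × Fin n) →
    LinTree n (Fin n → Fin n × Fin n)
  | 0, _, W => leaf W
  | m + 1, S, W =>
    if hS : S.Nonempty then
      let p := (exists_few_occurrences hS W).choose
      (pi fun i => if i ∈ S ∧ (p = (W i).1 ∨ p = (W i).2) then substWitness i (W i) p (W p)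
        else leaf (W i)).bind fun W₁ =>
      (eliminate m (S.erase p) W₁).bind fun W₂ =>
      (if (W p).1 ∈ S.erase p then substWitness p (W p) (W p).1 (W₂ (W p).1)
        else leaf (W p)).bind fun a =>
      (if (W p).2 ∈ S.erase p then substWitness p a (W p).2 (W₂ (W p).2) else leaf a).map
        fun a' => Function.update W₂ p a'
    else leaf W

theorem height_eliminate (m : ℕ) (S : Finset (Fin n)) (W : Fin n → Fin n × Fin n) :
    (eliminate m S W).height ≤ 24 * m := by
  classical
  induction m generalizing S W with
  | zero => simp [eliminate, height]
  | succ m ih =>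
    unfold eliminate
    split_ifs with hS
    · set p := (exists_few_occurrences hS W).choose with hp
      have hcard := (exists_few_occurrences hS W).choose_spec.2
      rw [← hp] at hcard
      refine (height_bind_le (B := 24 * m + 12) fun W₁ => ?_).trans
        (?_ : _ ≤ 12 + (24 * m + 12)) |>.trans (by omega)
      · refine (height_bind_le (B := 12) fun W₂ => ?_).trans (Nat.add_le_add_right (ih _ _) 12)
        refine (height_bind_le (B := 6) fun a => ?_).trans (Nat.add_le_add_right ?_ 6)
        · rw [height_map]
          split_ifs
          exacts [height_substWitness _ _ _ _, by simp [height]]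
        · split_ifs
          exacts [height_substWitness _ _ _ _, by simp [height]]
      · refine Nat.add_le_add_right ((height_pi_le _).trans ?_) _
        calc _ ≤ ∑ i, (if i ∈ S ∧ (p = (W i).1 ∨ p = (W i).2) then 6 else 0) := by
              refine Finset.sum_le_sum fun i _ => ?_
              split_ifs
              exacts [height_substWitness _ _ _ _, by simp [height]]
          _ ≤ 12 := by
              rw [← Finset.sum_filter, Finset.sum_const, smul_eq_mul]
              have : (Finset.univ.filter fun i => i ∈ S ∧ (p = (W i).1 ∨ p = (W i).2)) =
                  S.filter fun i => p = (W i).1 ∨ p = (W i).2 := by ext; simp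
              rw [this]
              omega
    · simp [height]

theorem eliminate_spec {P : Input n} (E : Fin n → Prop) {m : ℕ} {S : Finset (Fin n)}
    {W W' : Fin n → Fin n × Fin n} (h : (eliminate m S W).LeadsTo P W') (hS : S.card ≤ m)
    (hW : ∀ i ∈ S, WitnessedBy P i (W i) ∧ ∀ u, u = (W i).1 ∨ u = (W i).2 → E u ∨ u ∈ S) :
    ∀ i ∈ S, WitnessedBy P i (W' i) ∧ ∀ u, u = (W' i).1 ∨ u = (W' i).2 → E u := by
  classical
  induction m generalizing S W W' with
  | zero =>
    simp only [nonpos_iff_eq_zero, Finset.card_eq_zero] at hS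
    simp [hS]
  | succ m ih =>
    unfold eliminate at h
    split_ifs at h with hne
    · set p := (exists_few_occurrences hne W).choose with hp
      have hpS := (exists_few_occurrences hne W).choose_spec.1
      rw [← hp] at hpS
      simp only [leadsTo_bind, leadsTo_map] at h
      obtain ⟨W₁, h1, W₂, h2, a, h3, a', h4, rfl⟩ := h
      obtain ⟨wp, wp'⟩ := hW p hpS
      have hpne : ∀ u, u = (W p).1 ∨ u = (W p).2 → u ≠ p := by
        rintro u (hu | hu) rfl
        · exact (ne_of_mem_lss wp).2.1 (by rw [← hu])
        · exact (ne_of_mem_lss wp).2.2 (by rw [← hu])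
      have hpE : ∀ u, u = (W p).1 ∨ u = (W p).2 → E u ∨ u ∈ S.erase p := fun u hu =>
        (wp' u hu).imp id fun h => Finset.mem_erase.2 ⟨hpne u hu, h⟩
      have hW₁ : ∀ i ∈ S.erase p, WitnessedBy P i (W₁ i) ∧
          ∀ u, u = (W₁ i).1 ∨ u = (W₁ i).2 → E u ∨ u ∈ S.erase p := by
        intro i hi
        have hiS := (Finset.mem_erase.1 hi).2
        have h1i := h1.of_pi i
        obtain ⟨wi, wi'⟩ := hW i hiS
        split_ifs at h1i with hc
        · obtain ⟨h5, h6⟩ := substWitness_spec h1i wi wp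
          refine ⟨h5, fun u hu => ?_⟩
          rcases h6 u hu with ⟨h7, h8⟩ | h7
          · exact (wi' u h7).imp id fun h => Finset.mem_erase.2 ⟨h8, h⟩
          · exact hpE u h7
        · have h1i : W i = W₁ i := h1i
          rw [← h1i]
          refine ⟨wi, fun u hu => (wi' u hu).imp id fun h => Finset.mem_erase.2 ⟨?_, h⟩⟩
          rintro rfl
          exact hc ⟨hiS, hu⟩
      have hW₂ := ih h2 (by rw [Finset.card_erase_of_mem hpS]; omega) hW₁
      have ha : WitnessedBy P p a ∧ ∀ u, u = a.1 ∨ u = a.2 → E u ∨ u = (W p).2 := by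
        split_ifs at h3 with hc
        · obtain ⟨h5, h6⟩ := substWitness_spec h3 wp (hW₂ _ hc).1
          refine ⟨h5, fun u hu => ?_⟩
          rcases h6 u hu with ⟨h7, h8⟩ | h7
          · exact Or.inr (h7.resolve_left h8)
          · exact Or.inl ((hW₂ _ hc).2 u h7)
        · obtain rfl : W p = a := h3
          refine ⟨wp, fun u hu => hu.imp (fun h => ?_) id⟩
          subst h
          exact (hpE _ (Or.inl rfl)).resolve_right hc
      have ha' : WitnessedBy P p a' ∧ ∀ u, u = a'.1 ∨ u = a'.2 → E u := by
        split_ifs at h4 with hc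
        · obtain ⟨h5, h6⟩ := substWitness_spec h4 ha.1 (hW₂ _ hc).1
          refine ⟨h5, fun u hu => ?_⟩
          rcases h6 u hu with ⟨h7, h8⟩ | h7
          · exact (ha.2 u h7).resolve_right h8
          · exact (hW₂ _ hc).2 u h7
        · obtain rfl : a = a' := h4
          refine ⟨ha.1, fun u hu => (ha.2 u hu).elim id fun h => ?_⟩
          subst h
          exact (hpE _ (Or.inr rfl)).resolve_right hc
      intro i hi
      rcases eq_or_ne i p with rfl | hip
      · simpa using ha'
      · simpa [Function.update_of_ne hip] using hW₂ i (Finset.mem_erase.2 ⟨hip, hi⟩)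
    · rw [Finset.not_nonempty_iff_eq_empty] at hne
      simp [hne]

open Classical in
/-- Convert a convex hull certificate into an extremal one. -/
noncomputable def toExtremal (γ : HullCert n) : LinTree n (HullCert n) :=
  (eliminate n (Finset.univ.filter (· ∉ γ.hull)) γ.witness).map fun W => ⟨γ.hull, W⟩

theorem height_toExtremal (γ : HullCert n) : (toExtremal γ).height ≤ 24 * n := by
  unfold toExtremal
  rw [height_map]
  exact height_eliminate _ _ _

theorem toExtremal_spec {P : Input n} {γ γ' : HullCert n} (hγ : γ.Valid P)
    (h : (toExtremal γ).LeadsTo P γ') : γ'.ValidExtremal P := by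
  classical
  unfold toExtremal at h
  rw [leadsTo_map] at h
  obtain ⟨W, h, rfl⟩ := h
  have hmem := hγ.1.1
  have key := eliminate_spec (· ∈ γ.hull) h ((Finset.card_le_univ _).trans (by simp)) fun i hi => by
    refine ⟨hγ.2 i ?_, fun u _ => ?_⟩
    · rw [← hmem]; simpa using hi
    · by_cases hu : u ∈ γ.hull <;> simp [hu]
  refine ⟨⟨hγ.1, fun i hi => ?_⟩, fun i hi => ?_⟩
  · exact (key i (by simpa [hmem] using hi)).1
  · have := (key i (by simpa [hmem] using hi)).2
    exact ⟨(hmem _).1 (this _ (Or.inl rfl)), (hmem _).1 (this _ (Or.inr rfl))⟩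

end LinTree

/-! ### Extremal points -/

theorem dot_sub_dot (v p q : Plane) : dot v p - dot v q = v.1 * (p.1 - q.1) + v.2 * (p.2 - q.2) := by
  unfold dot; ring

theorem convexHull_subset_dot_le {n : ℕ} {P : Input n} {v : Plane} {c : ℝ}
    (h : ∀ j, dot v (P j) ≤ c) {q : Plane} (hq : q ∈ convexHull ℝ (range P)) : dot v q ≤ c := by
  have hc : Convex ℝ {q : Plane | dot v q ≤ c} := by
    have : IsLinearMap ℝ (dot v) := by
      constructor
      · intro x y; simp [dot]; ring
      · intro a x; simp [dot]; ring
    exact convex_halfSpace_le this c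
  refine convexHull_min ?_ hc hq
  rintro _ ⟨j, rfl⟩
  exact h j

theorem IsExtremalFor.isExtremal {n : ℕ} {P : Input n} {v : Plane} {i : Fin n}
    (h : IsExtremalFor v P i) (hv : 0 < v.2) : IsExtremal P i := fun q hq hx => by
  have h1 := convexHull_subset_dot_le h hq
  unfold dot at h1
  rw [hx] at h1
  by_contra hlt
  have := mul_lt_mul_of_pos_left (not_le.1 hlt) hv
  linarith

theorem IsExtremal.le_of_segment {n : ℕ} {P : Input n} {i j k : Fin n} (h : IsExtremal P i)
    (hjk : (P j).1 < (P k).1) (h1 : (P j).1 ≤ (P i).1) (h2 : (P i).1 ≤ (P k).1) :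
    (P j).2 * ((P k).1 - (P i).1) + (P k).2 * ((P i).1 - (P j).1) ≤
      (P i).2 * ((P k).1 - (P j).1) := by
  by_contra hlt
  obtain ⟨y, hy, hs⟩ := (below_segment_iff hjk h1 h2).2 (not_le.1 hlt)
  have : ((P i).1, y) ∈ convexHull ℝ (range P) :=
    segment_subset_convexHull (mem_range_self j) (mem_range_self k) hs
  exact absurd (h _ this rfl) (not_le.2 hy)

theorem IsExtremal.not_mem_lss {n : ℕ} {P : Input n} {i j k : Fin n} (h : IsExtremal P i)
    (hjk : (P j).1 < (P k).1) : P i ∉ lss (P j) (P k) := fun hl => by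
  obtain ⟨h1, h2, h3⟩ := (mem_lss_iff_of_lt hjk).1 hl
  exact absurd (h.le_of_segment hjk h1.le h2.le) (not_le.2 h3)

theorem mem_lss_of_dot_lt {v a b c : Plane} (hv : 0 < v.2) (h1 : a.1 < b.1) (h2 : b.1 < c.1)
    (h3 : dot v b ≤ dot v a) (h4 : dot v b ≤ dot v c) (h5 : dot v b < dot v a ∨ dot v b < dot v c) :
    b ∈ lss a c := by
  refine (mem_lss_iff_of_lt (h1.trans h2)).2 ⟨h1, h2, ?_⟩
  have e : v.2 * (a.2 * (c.1 - b.1) + c.2 * (b.1 - a.1) - b.2 * (c.1 - a.1)) =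
      (dot v a - dot v b) * (c.1 - b.1) + (dot v c - dot v b) * (b.1 - a.1) := by
    rw [dot_sub_dot, dot_sub_dot]; ring
  have h6 : 0 < (dot v a - dot v b) * (c.1 - b.1) + (dot v c - dot v b) * (b.1 - a.1) := by
    rcases h5 with h5 | h5
    · exact add_pos_of_pos_of_nonneg (mul_pos (by linarith) (by linarith))
        (mul_nonneg (by linarith) (by linarith))
    · exact add_pos_of_nonneg_of_pos (mul_nonneg (by linarith) (by linarith))
        (mul_pos (by linarith) (by linarith))
  rw [← e] at h6
  exact sub_pos.1 ((mul_pos_iff_of_pos_left hv).1 h6)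

namespace LinTree

variable {n k : ℕ}

/-! ### Finding the canonical extremal points -/

/-- Find the point of the sorted list `l` that is extremal in direction `v`. -/
noncomputable def maxSearch (v : Plane) (hv : 0 < v.2) (i₀ : Fin n) (l : List (Fin n)) :
    LinTree n (Fin n) :=
  (search (fun t => ask (l.getD t i₀) (.slope (l.getD (t - 1) i₀) (v.2, -v.1)
    (by simp [Prod.ext_iff, hv.ne']))) (Nat.clog 2 n) 0 l.length).map fun t => l.getD t i₀

theorem height_maxSearch (v : Plane) (hv : 0 < v.2) (i₀ : Fin n) (l : List (Fin n)) :
    (maxSearch v hv i₀ l).height ≤ Nat.clog 2 n := by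
  unfold maxSearch
  rw [height_map]
  exact height_search_le (fun _ => height_ask _ _) _ _ _

theorem maxSearch_spec {P : Input n} {v : Plane} {hv : 0 < v.2} {i₀ e : Fin n} {l : List (Fin n)}
    (h : (maxSearch v hv i₀ l).LeadsTo P e) (hl : IsSortedListOf P (IsExtremal P) l) :
    IsExtremalFor v P e ∧ ∀ i, IsExtremalFor v P i → i = e := by
  have hsort : ∀ s t, s < t → t < l.length → (P (l.getD s i₀)).1 < (P (l.getD t i₀)).1 := by
    intro s t hst ht
    rw [List.getD_eq_getElem _ _ (hst.trans ht), List.getD_eq_getElem _ _ ht]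
    exact List.pairwise_iff_getElem.1 hl.2 s t (hst.trans ht) ht hst
  have hext : ∀ t, t < l.length → IsExtremal P (l.getD t i₀) := fun t ht => by
    rw [← hl.1, List.getD_eq_getElem _ _ ht]
    exact List.getElem_mem ht
  obtain ⟨m, -, hm⟩ := Finset.exists_max_image (Finset.univ : Finset (Fin n))
    (fun i => dot v (P i)) ⟨i₀, Finset.mem_univ _⟩
  have hm : IsExtremalFor v P m := fun j => hm j (Finset.mem_univ j)
  have hpos : ∀ i, IsExtremalFor v P i → ∃ t, t < l.length ∧ l.getD t i₀ = i := fun i hi => by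
    obtain ⟨t, ht, h⟩ := List.mem_iff_getElem.1 ((hl.1 i).2 (hi.isExtremal hv))
    exact ⟨t, ht, by rw [List.getD_eq_getElem _ _ ht, h]⟩
  obtain ⟨t₀, ht₀, htm⟩ := hpos m hm
  unfold maxSearch at h
  rw [leadsTo_map] at h
  obtain ⟨j, hj, rfl⟩ := h
  have hnd : l.Nodup := hl.2.imp fun {a b} h => by rintro rfl; exact lt_irrefl _ h
  have hlen : l.length ≤ n := by simpa using hnd.length_le_card
  obtain ⟨-, hjl, hleft, hright⟩ := hj.of_search (by omega)
    ((Nat.sub_le _ _).trans (hlen.trans (Nat.le_pow_clog one_lt_two n)))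
  have hmax : ∀ t, t < l.length → t ≠ j →
      dot v (P (l.getD t i₀)) < dot v (P (l.getD j i₀)) := by
    intro t ht htj
    by_contra hle
    rw [not_lt] at hle
    rcases lt_or_gt_of_ne htj with htj | htj
    · have hlt := ask_true (hleft.resolve_left (by omega))
      have hlt' : dot v (P (l.getD (j - 1) i₀)) < dot v (P (l.getD j i₀)) := by
        have := mem_left_iff.1 hlt
        have e := dot_sub_dot v (P (l.getD j i₀)) (P (l.getD (j - 1) i₀))
        simp only at this
        linarith
      rcases eq_or_ne t (j - 1) with rfl | ht'
      · linarith
      · exact (hext (j - 1) (by omega)).not_mem_lss (hsort t j htj hjl)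
          (mem_lss_of_dot_lt hv (hsort _ _ (by omega) (by omega)) (hsort _ _ (by omega) hjl)
            (by linarith) hlt'.le (Or.inr hlt'))
    · have hne : ¬ (LineSpec.slope (l.getD (j + 1 - 1) i₀) (v.2, -v.1)
          (by simp [Prod.ext_iff, hv.ne'])).Uses (l.getD (j + 1) i₀) := fun h => by
        have h' : l.getD (j + 1) i₀ = l.getD j i₀ := h
        have := hsort j (j + 1) (by omega) (by omega)
        rw [h'] at this
        exact lt_irrefl _ this
      have hlt := ask_false (hright.resolve_left (by omega)) hne
      have hlt' : dot v (P (l.getD (j + 1) i₀)) < dot v (P (l.getD j i₀)) := by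
        have := mem_right_iff.1 hlt
        have e := dot_sub_dot v (P (l.getD (j + 1) i₀)) (P (l.getD j i₀))
        simp only [Nat.add_sub_cancel] at this
        linarith
      rcases eq_or_ne t (j + 1) with rfl | ht'
      · linarith
      · exact (hext (j + 1) (by omega)).not_mem_lss (hsort j t htj ht)
          (mem_lss_of_dot_lt hv (hsort _ _ (by omega) (by omega)) (hsort _ _ (by omega) ht)
            hlt'.le (by linarith) (Or.inl hlt'))
  have huniq : ∀ i, IsExtremalFor v P i → i = l.getD j i₀ := fun i hi => by
    obtain ⟨t, ht, rfl⟩ := hpos i hi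
    rcases eq_or_ne t j with rfl | htj
    · rfl
    · exact absurd (hi (l.getD j i₀)) (not_le.2 (hmax t ht htj))
  exact ⟨huniq m hm ▸ hm, huniq⟩

end LinTree

/-- `E` assigns to each canonical direction the unique extremal point. -/
def IsArgmax {n k : ℕ} (L : CanonicalLines k) (P : Input n) (E : Fin k → Fin n) : Prop :=
  ∀ i, IsExtremalFor (L.dir i) P (E i) ∧ ∀ j, IsExtremalFor (L.dir i) P j → j = E i

theorem IsArgmax.vExtremal_iff {n k : ℕ} {L : CanonicalLines k} {P : Input n}
    {E : Fin k → Fin n} (h : IsArgmax L P E) (j : Fin n) : L.VExtremal P j ↔ ∃ i, E i = j := by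
  constructor
  · rintro ⟨i, hi, -⟩
    exact ⟨i, ((h i).2 j hi).symm⟩
  · rintro ⟨i, rfl⟩
    exact ⟨i, (h i).1, fun j hj => by rw [(h i).2 j hj]⟩

/-! ### Neighbors -/

theorem exists_minimal_option {n : ℕ} (S : Fin n → Prop) (key : Fin n → ℤ) :
    ∃ o : Option (Fin n), (∀ f ∈ o, S f) ∧ ∀ f, S f → ∃ g ∈ o, key g ≤ key f := by
  classical
  rcases (Finset.univ.filter S).eq_empty_or_nonempty with h | h
  · refine ⟨none, by simp, fun f hf => ?_⟩
    have : f ∈ Finset.univ.filter S := by simpa using hf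
    simp [h] at this
  · obtain ⟨g, hg, hmin⟩ := Finset.exists_min_image _ key h
    refine ⟨some g, ?_, fun f hf => ⟨g, rfl, hmin f (by simpa using hf)⟩⟩
    rintro f hf
    obtain rfl : g = f := by simpa using hf
    simpa using hg

/-- The first point of the list `l` with property `V` that is not before `q`. -/
noncomputable def nextIn {n : ℕ} (l : List (Fin n)) (V : Fin n → Prop) (q : Fin n) :
    Option (Fin n) :=
  (exists_minimal_option (fun f => V f ∧ f ∈ l ∧ l.idxOf q ≤ l.idxOf f)
    fun f => l.idxOf f).choose

/-- The last point of the list `l` with property `V` that is not after `q`. -/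
noncomputable def prevIn {n : ℕ} (l : List (Fin n)) (V : Fin n → Prop) (q : Fin n) :
    Option (Fin n) :=
  (exists_minimal_option (fun f => V f ∧ f ∈ l ∧ l.idxOf f ≤ l.idxOf q)
    fun f => -l.idxOf f).choose

theorem IsSortedListOf.idxOf_lt_iff {n : ℕ} {P : Input n} {S : Fin n → Prop} {l : List (Fin n)}
    (h : IsSortedListOf P S l) {a b : Fin n} (ha : a ∈ l) (hb : b ∈ l) :
    l.idxOf a < l.idxOf b ↔ (P a).1 < (P b).1 := by
  have key : ∀ a b, a ∈ l → b ∈ l → l.idxOf a < l.idxOf b → (P a).1 < (P b).1 := by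
    intro a b ha hb hab
    have := List.pairwise_iff_getElem.1 h.2 _ _ (List.idxOf_lt_length_of_mem ha)
      (List.idxOf_lt_length_of_mem hb) hab
    simpa using this
  refine ⟨key a b ha hb, fun hlt => ?_⟩
  rcases lt_trichotomy (l.idxOf a) (l.idxOf b) with h' | h' | h'
  · exact h'
  · rw [(List.idxOf_inj ha).1 h'] at hlt
    exact absurd hlt (lt_irrefl _)
  · exact absurd (key b a hb ha h') hlt.not_gt

theorem IsSortedListOf.idxOf_le_iff {n : ℕ} {P : Input n} {S : Fin n → Prop} {l : List (Fin n)}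
    (h : IsSortedListOf P S l) {a b : Fin n} (ha : a ∈ l) (hb : b ∈ l) :
    l.idxOf a ≤ l.idxOf b ↔ (P a).1 ≤ (P b).1 := by
  rw [← not_lt, ← not_lt, h.idxOf_lt_iff hb ha]

theorem nextIn_spec {n : ℕ} {P : Input n} {S V : Fin n → Prop} {l : List (Fin n)}
    (h : IsSortedListOf P S l) (hV : ∀ f, V f → f ∈ l) {q : Fin n} (hq : q ∈ l) :
    (∀ f ∈ nextIn l V q, V f ∧ (P q).1 ≤ (P f).1) ∧
      ∀ f, V f → (P q).1 ≤ (P f).1 → ∃ g ∈ nextIn l V q, (P g).1 ≤ (P f).1 := by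
  obtain ⟨h1, h2⟩ := (exists_minimal_option (fun f => V f ∧ f ∈ l ∧ l.idxOf q ≤ l.idxOf f)
    fun f => l.idxOf f).choose_spec
  refine ⟨fun f hf => ⟨(h1 f hf).1, (h.idxOf_le_iff hq (h1 f hf).2.1).1 (h1 f hf).2.2⟩,
    fun f hf hqf => ?_⟩
  obtain ⟨g, hg, hgf⟩ := h2 f ⟨hf, hV f hf, (h.idxOf_le_iff hq (hV f hf)).2 hqf⟩
  exact ⟨g, hg, (h.idxOf_le_iff (h1 g hg).2.1 (hV f hf)).1 (by exact_mod_cast hgf)⟩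

theorem prevIn_spec {n : ℕ} {P : Input n} {S V : Fin n → Prop} {l : List (Fin n)}
    (h : IsSortedListOf P S l) (hV : ∀ f, V f → f ∈ l) {q : Fin n} (hq : q ∈ l) :
    (∀ f ∈ prevIn l V q, V f ∧ (P f).1 ≤ (P q).1) ∧
      ∀ f, V f → (P f).1 ≤ (P q).1 → ∃ g ∈ prevIn l V q, (P f).1 ≤ (P g).1 := by
  obtain ⟨h1, h2⟩ := (exists_minimal_option (fun f => V f ∧ f ∈ l ∧ l.idxOf f ≤ l.idxOf q)
    fun f => -l.idxOf f).choose_spec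
  refine ⟨fun f hf => ⟨(h1 f hf).1, (h.idxOf_le_iff (h1 f hf).2.1 hq).1 (h1 f hf).2.2⟩,
    fun f hf hqf => ?_⟩
  obtain ⟨g, hg, hgf⟩ := h2 f ⟨hf, hV f hf, (h.idxOf_le_iff (hV f hf) hq).2 hqf⟩
  exact ⟨g, hg, (h.idxOf_le_iff (hV f hf) (h1 g hg).2.1).1 (by
    have := neg_le_neg_iff.1 hgf; exact_mod_cast this)⟩

/-! ### `V`-extremal certificates -/

theorem mem_lss_of_extremal {n : ℕ} {P : Input n} {p q r f g : Fin n}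
    (hp : P p ∈ lss (P q) (P r)) (hqr : (P q).1 < (P r).1) (hf : IsExtremal P f)
    (hg : IsExtremal P g) (h1 : (P q).1 ≤ (P f).1) (h2 : (P f).1 < (P p).1)
    (h3 : (P p).1 < (P g).1) (h4 : (P g).1 ≤ (P r).1) : P p ∈ lss (P f) (P g) := by
  have hfg := h2.trans h3
  refine (mem_lss_iff_of_lt hfg).2 ⟨h2, h3, ?_⟩
  obtain ⟨-, -, h5⟩ := (mem_lss_iff_of_lt hqr).1 hp
  have h6 := hf.le_of_segment hqr h1 (hfg.le.trans h4)
  have h7 := hg.le_of_segment hqr (h1.trans hfg.le) h4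
  have a1 := mul_le_mul_of_nonneg_right h6 (sub_pos.2 h3).le
  have a2 := mul_le_mul_of_nonneg_right h7 (sub_pos.2 h2).le
  have a3 := mul_lt_mul_of_pos_right h5 (sub_pos.2 hfg)
  refine lt_of_mul_lt_mul_left ?_ (sub_pos.2 hqr).le
  linarith

namespace LinTree

variable {n k : ℕ}

/-- Find the information on the point `p` in a `V`-extremal certificate, if `p` has the witness
pair `(q, r)` with `q` to the left of `r`. -/
noncomputable def witnessInfo (l : List (Fin n)) (V : Fin n → Prop) (p q r : Fin n) :
    LinTree n (VInfo n) :=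
  match nextIn l V q with
  | none => leaf (.between (prevIn l V q) none)
  | some f => (askLeftOf p f).bind fun b => if b then leaf (.between (prevIn l V q) (some f)) else
    match prevIn l V r with
    | none => leaf (.between none (nextIn l V r))
    | some g => (askLeftOf p g).bind fun b => if b then leaf (.witness f g) else
        leaf (.between (some g) (nextIn l V r))

theorem height_witnessInfo (l : List (Fin n)) (V : Fin n → Prop) (p q r : Fin n) :
    (witnessInfo l V p q r).height ≤ 2 := by
  unfold witnessInfo
  split
  · simp [height]
  · refine (height_bind_le (B := 1) fun b => ?_).trans (Nat.add_le_add_right (height_ask _ _) 1)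
    split_ifs
    · simp [height]
    · split
      · simp [height]
      · refine (height_bind_le (B := 0) fun b => ?_).trans (height_ask _ _)
        split_ifs <;> simp [height]

theorem between_valid {L : CanonicalLines k} {P : Input n} {l : List (Fin n)} {V : Fin n → Prop}
    (hl : IsSortedListOf P (IsExtremal P) l) (hV : ∀ j, L.VExtremal P j ↔ V j)
    (hVl : ∀ f, V f → f ∈ l) {p q : Fin n} (hq : q ∈ l)
    (h1 : ∀ e ∈ prevIn l V q, (P e).1 ≤ (P p).1) (h2 : ∀ e ∈ nextIn l V q, (P p).1 ≤ (P e).1)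
    (h3 : ∀ e ∈ prevIn l V q, e ∉ nextIn l V q) :
    (VInfo.between (prevIn l V q) (nextIn l V q)).Valid L P p := by
  obtain ⟨a1, a2⟩ := prevIn_spec hl hVl hq
  obtain ⟨b1, b2⟩ := nextIn_spec hl hVl hq
  refine ⟨fun e he => ⟨(hV e).2 (a1 e he).1, h1 e he⟩, fun e he => ⟨(hV e).2 (b1 e he).1, h2 e he⟩,
    h3, fun j hj => ?_⟩
  rcases le_total (P j).1 (P q).1 with h | h
  · exact Or.inl (a2 j ((hV j).1 hj) h)
  · exact Or.inr (b2 j ((hV j).1 hj) h)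

theorem witnessInfo_spec {L : CanonicalLines k} {P : Input n} {l : List (Fin n)}
    {V : Fin n → Prop} (hl : IsSortedListOf P (IsExtremal P) l) (hV : ∀ j, L.VExtremal P j ↔ V j)
    (hVl : ∀ f, V f → f ∈ l) {p q r : Fin n} (hq : q ∈ l) (hr : r ∈ l) (hpl : p ∉ l)
    (hp : P p ∈ lss (P q) (P r)) (hqr : (P q).1 < (P r).1) {w : VInfo n}
    (h : (witnessInfo l V p q r).LeadsTo P w) : w.Valid L P p := by
  obtain ⟨c1, c2, -⟩ := (mem_lss_iff_of_lt hqr).1 hp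
  obtain ⟨a1, a2⟩ := prevIn_spec hl hVl hq
  obtain ⟨b1, b2⟩ := nextIn_spec hl hVl hq
  obtain ⟨a1', a2'⟩ := prevIn_spec hl hVl hr
  obtain ⟨b1', b2'⟩ := nextIn_spec hl hVl hr
  unfold witnessInfo at h
  split at h
  next hn =>
    obtain rfl : _ = w := h
    rw [← hn]
    exact between_valid hl hV hVl hq (fun e he => ((a1 e he).2.trans_lt c1).le) (by simp [hn])
      (by simp [hn])
  next f hn =>
    have hf := b1 f hn
    have hpf : p ≠ f := by rintro rfl; exact hpl (hVl _ hf.1)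
    rw [leadsTo_bind] at h
    obtain ⟨b, hb, h⟩ := h
    cases b <;> simp only [if_true, if_false, Bool.false_eq_true] at h
    · have hb := askLeftOf_false hb hpf
      split at h
      next hn' =>
        obtain rfl : _ = w := h
        rw [← hn']
        exact between_valid hl hV hVl hr (by simp [hn']) (fun e he => c2.le.trans (b1' e he).2)
          (by simp [hn'])
      next g hn' =>
        have hg := a1' g hn'
        have hpg : p ≠ g := by rintro rfl; exact hpl (hVl _ hg.1)
        rw [leadsTo_bind] at h
        obtain ⟨b, hb', h⟩ := h
        cases b <;> simp only [if_true, if_false, Bool.false_eq_true] at h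
        · obtain rfl : _ = w := h
          have hb' := askLeftOf_false hb' hpg
          rw [← hn']
          refine between_valid hl hV hVl hr (fun e he => ?_) (fun e he => c2.le.trans (b1' e he).2)
            fun e he he' => ?_
          · obtain rfl : g = e := by rw [hn'] at he; simpa using he
            exact hb'.le
          · obtain rfl : g = e := by rw [hn'] at he; simpa using he
            linarith [(b1' _ he').2]
        · obtain rfl : _ = w := h
          have hb' := askLeftOf_true hb'
          exact ⟨(hV f).2 hf.1, (hV g).2 hg.1, mem_lss_of_extremal hp hqr ((hl.1 f).1 (hVl f hf.1))
            ((hl.1 g).1 (hVl g hg.1)) hf.2 hb hb' hg.2⟩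
    · have hb := askLeftOf_true hb
      obtain rfl : _ = w := h
      rw [← hn]
      refine between_valid hl hV hVl hq (fun e he => ((a1 e he).2.trans_lt c1).le)
        (fun e he => ?_) fun e he he' => ?_
      · obtain rfl : f = e := by rw [hn] at he; simpa using he
        exact hb.le
      · obtain rfl : f = e := by rw [hn] at he'; simpa using he'
        linarith [(a1 _ he).2]

open Classical in
/-- Find the information on the point `p` in a `V`-extremal certificate. -/
noncomputable def pointInfo (γ : HullCert n) (V : Fin n → Prop) (p : Fin n) :
    LinTree n (VInfo n) :=
  if p ∈ γ.hull then leaf (.between (prevIn γ.hull V p) (nextIn γ.hull V p))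
  else if γ.hull.idxOf (γ.witness p).1 < γ.hull.idxOf (γ.witness p).2 then
    witnessInfo γ.hull V p (γ.witness p).1 (γ.witness p).2
  else witnessInfo γ.hull V p (γ.witness p).2 (γ.witness p).1

theorem height_pointInfo (γ : HullCert n) (V : Fin n → Prop) (p : Fin n) :
    (pointInfo γ V p).height ≤ 2 := by
  unfold pointInfo
  split_ifs
  exacts [by simp [height], height_witnessInfo _ _ _ _ _, height_witnessInfo _ _ _ _ _]

theorem pointInfo_spec {L : CanonicalLines k} {P : Input n} {γ : HullCert n}
    {V : Fin n → Prop} (hγ : γ.ValidExtremal P) (hV : ∀ j, L.VExtremal P j ↔ V j)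
    (hVl : ∀ f, V f → f ∈ γ.hull) {p : Fin n} (hp : ¬ L.VExtremal P p) {w : VInfo n}
    (h : (pointInfo γ V p).LeadsTo P w) : w.Valid L P p := by
  have hl := hγ.1.1
  unfold pointInfo at h
  split_ifs at h with h1 h2
  · obtain rfl : _ = w := h
    obtain ⟨a1, a2⟩ := prevIn_spec hl hVl h1
    obtain ⟨b1, b2⟩ := nextIn_spec hl hVl h1
    refine between_valid hl hV hVl h1 (fun e he => (a1 e he).2) (fun e he => (b1 e he).2)
      fun e he he' => hp ?_
    have hx := le_antisymm (a1 e he).2 (b1 e he').2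
    have : e = p := by
      have hel := hVl e (a1 e he).1
      have l1 := (hl.idxOf_le_iff hel h1).2 hx.le
      have l2 := (hl.idxOf_le_iff h1 hel).2 hx.ge
      exact (List.idxOf_inj hel).1 (le_antisymm l1 l2)
    rw [← this, hV]
    exact (a1 e he).1
  all_goals
    have hpe : ¬ IsExtremal P p := fun h => h1 ((hl.1 p).2 h)
    have hw := hγ.1.2 p hpe
    have hq := (hl.1 _).2 (hγ.2 p hpe).1
    have hr := (hl.1 _).2 (hγ.2 p hpe).2
  · exact witnessInfo_spec hl hV hVl hq hr h1 hw ((hl.idxOf_lt_iff hq hr).1 h2) h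
  · refine witnessInfo_spec hl hV hVl hr hq h1 ((lss_comm _ _).subset hw) ?_ h
    rw [hl.idxOf_lt_iff hq hr, not_lt] at h2
    exact lt_of_le_of_ne h2 (ne_of_mem_lss hw).1.symm

open Classical in
/-- Convert an extremal certificate into a `V`-extremal one; in addition, find the extremal
point for each canonical direction. -/
noncomputable def toVExtremal (L : CanonicalLines k) (i₀ : Fin n) (γ : HullCert n) :
    LinTree n (VCert n × (Fin k → Fin n)) :=
  (pi fun i => maxSearch (L.dir i) (L.upward i) i₀ γ.hull).bind fun E =>
    (pi fun p => pointInfo γ (fun j => ∃ i, E i = j) p).map fun w =>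
      (⟨γ.hull.filter fun j => ∃ i, E i = j, w⟩, E)

theorem height_toVExtremal (L : CanonicalLines k) (i₀ : Fin n) (γ : HullCert n) :
    (toVExtremal L i₀ γ).height ≤ k * Nat.clog 2 n + n * 2 := by
  unfold toVExtremal
  refine (height_bind_le (B := n * 2) fun E => ?_).trans (Nat.add_le_add_right ?_ _)
  · rw [height_map]
    refine (height_pi_le _).trans ((Finset.sum_le_sum fun p _ => height_pointInfo _ _ p).trans ?_)
    simp
  · refine (height_pi_le _).trans
      ((Finset.sum_le_sum fun i _ => height_maxSearch _ _ _ _).trans ?_)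
    simp

theorem toVExtremal_spec {L : CanonicalLines k} {i₀ : Fin n} {P : Input n} {γ : HullCert n}
    (hγ : γ.ValidExtremal P) {x : VCert n × (Fin k → Fin n)}
    (h : (toVExtremal L i₀ γ).LeadsTo P x) : x.1.Valid L P ∧ IsArgmax L P x.2 := by
  unfold toVExtremal at h
  simp only [leadsTo_bind, leadsTo_map] at h
  obtain ⟨E, hE, w, hw, rfl⟩ := h
  have hA : IsArgmax L P E := fun i => maxSearch_spec (hE.of_pi i) hγ.1.1
  have hl := hγ.1.1
  have hVl : ∀ f, (∃ i, E i = f) → f ∈ γ.hull := by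
    rintro _ ⟨i, rfl⟩
    exact (hl.1 _).2 ((hA i).1.isExtremal (L.upward i))
  refine ⟨⟨⟨fun j => ?_, hl.2.filter _⟩, fun p hp => ?_⟩, hA⟩
  · rw [hA.vExtremal_iff]
    simpa using fun i hi => hVl j ⟨i, hi⟩
  · exact pointInfo_spec hγ hA.vExtremal_iff hVl hp (hw.of_pi p)

end LinTree

/-! ### The geometry of the canonical hull -/

namespace CanonicalLines

variable {k : ℕ} (L : CanonicalLines k)

/-- The slope of the `i`-th canonical line. -/
noncomputable def slope (i : Fin k) : ℝ := -(L.dir i).1 / (L.dir i).2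

/-- The intercept of the `i`-th canonical line. -/
noncomputable def icpt (i : Fin k) : ℝ := L.height i / (L.dir i).2

theorem dot_sub_height (i : Fin k) (p : Plane) :
    dot (L.dir i) p - L.height i = (L.dir i).2 * (p.2 - (L.icpt i + L.slope i * p.1)) := by
  have := (L.upward i).ne'
  unfold dot slope icpt
  field_simp
  ring

theorem mem_above_iff {i : Fin k} {p : Plane} :
    p ∈ L.above i ↔ L.icpt i + L.slope i * p.1 < p.2 := by
  have h := L.dot_sub_height i p
  have hv := L.upward i
  change L.height i < dot (L.dir i) p ↔ _
  rw [← sub_pos, h, mul_pos_iff_of_pos_left hv, sub_pos]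

theorem mem_below_iff {i : Fin k} {p : Plane} :
    p ∈ L.below i ↔ p.2 < L.icpt i + L.slope i * p.1 := by
  have h := L.dot_sub_height i p
  have hv := L.upward i
  change dot (L.dir i) p < L.height i ↔ _
  rw [← sub_neg, h, mul_neg_iff, sub_neg]
  simp [hv, hv.not_gt]

theorem mem_hull_iff {p : Plane} : p ∈ L.hull ↔ ∀ i, p.2 < L.icpt i + L.slope i * p.1 := by
  simp [hull, mem_below_iff]

theorem slope_antitone : Antitone L.slope := by
  intro i j hij
  have h := L.clockwise i j hij
  unfold cross at h
  unfold slope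
  rw [div_le_div_iff₀ (L.upward j) (L.upward i)]
  linarith

theorem mem_closure_hull_iff {p : Plane} :
    p ∈ closure L.hull ↔ ∀ i, p.2 ≤ L.icpt i + L.slope i * p.1 := by
  constructor
  · intro h
    have hc : IsClosed {p : Plane | ∀ i, p.2 ≤ L.icpt i + L.slope i * p.1} := by
      simp only [ofPred_forall]
      exact isClosed_iInter fun i => isClosed_le (by fun_prop) (by fun_prop)
    exact closure_minimal (fun q hq i => (L.mem_hull_iff.1 hq i).le) hc h
  · intro h
    have ht : Filter.Tendsto (fun t : ℝ => ((p.1, p.2 - t) : Plane))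
        (nhdsWithin 0 (Ioi 0)) (nhds p) := by
      have : Continuous fun t : ℝ => ((p.1, p.2 - t) : Plane) := by fun_prop
      have h0 := this.tendsto 0
      simp only [sub_zero, Prod.mk.eta] at h0
      exact h0.mono_left nhdsWithin_le_nhds
    refine mem_closure_of_tendsto ht ?_
    filter_upwards [self_mem_nhdsWithin] with t ht
    refine L.mem_hull_iff.2 fun i => ?_
    have h1 := h i
    have h2 : (0 : ℝ) < t := ht
    simp only
    linarith

theorem exists_above_of_not_mem_closure {p : Plane} (h : p ∉ closure L.hull) :
    ∃ i, p ∈ L.above i := by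
  by_contra hne
  refine h (L.mem_closure_hull_iff.2 fun i => ?_)
  by_contra hlt
  exact hne ⟨i, L.mem_above_iff.2 (not_le.1 hlt)⟩

theorem hull_le_of_forall {p : Plane} {u : Plane} (h : ∀ q ∈ L.hull, cross u (q - p) ≤ 0) :
    ∀ q ∈ closure L.hull, cross u (q - p) ≤ 0 := by
  have hc : IsClosed {q : Plane | cross u (q - p) ≤ 0} :=
    isClosed_le (by unfold cross; fun_prop) continuous_const
  exact fun q hq => closure_minimal h hc hq

theorem exists_const_le_icpt : ∃ B : ℝ, ∀ i, B < L.icpt i := by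
  obtain ⟨B, hB⟩ := (Set.finite_range L.icpt).bddBelow
  exact ⟨B - 1, fun i => by have := hB (mem_range_self i); linarith⟩

theorem exists_hull_far_left : ∃ B : ℝ, ∀ m : ℝ, (∀ i, L.slope i ≤ m) → ∀ x ≤ 0,
    ((x, B + m * x) : Plane) ∈ L.hull := by
  obtain ⟨B, hB⟩ := L.exists_const_le_icpt
  refine ⟨B, fun m hm x hx => L.mem_hull_iff.2 fun i => ?_⟩
  have := mul_le_mul_of_nonpos_right (hm i) hx
  have := hB i
  simp only
  linarith

theorem exists_hull_far_right : ∃ B : ℝ, ∀ m : ℝ, (∀ i, m ≤ L.slope i) → ∀ x, 0 ≤ x →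
    ((x, B + m * x) : Plane) ∈ L.hull := by
  obtain ⟨B, hB⟩ := L.exists_const_le_icpt
  refine ⟨B, fun m hm x hx => L.mem_hull_iff.2 fun i => ?_⟩
  have := mul_le_mul_of_nonneg_right (hm i) hx
  have := hB i
  simp only
  linarith

theorem closure_hull_nonempty : (closure L.hull).Nonempty := by
  obtain ⟨B, hB⟩ := L.exists_const_le_icpt
  exact ⟨(0, B), L.mem_closure_hull_iff.2 fun i => by simpa using (hB i).le⟩

/-- The intercept of the line of slope `slope i` that supports the canonical hull. -/
noncomputable def supp (i : Fin k) : ℝ :=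
  sSup ((fun p : Plane => p.2 - L.slope i * p.1) '' closure L.hull)

theorem le_supp {i : Fin k} {p : Plane} (hp : p ∈ closure L.hull) :
    p.2 ≤ L.supp i + L.slope i * p.1 := by
  have hb : BddAbove ((fun p : Plane => p.2 - L.slope i * p.1) '' closure L.hull) := by
    refine ⟨L.icpt i, ?_⟩
    rintro _ ⟨q, hq, rfl⟩
    have := L.mem_closure_hull_iff.1 hq i
    simp only
    linarith
  have : p.2 - L.slope i * p.1 ≤ _ := le_csSup hb (mem_image_of_mem _ hp)
  unfold supp
  linarith

theorem supp_le {i : Fin k} {c : ℝ}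
    (h : ∀ p ∈ closure L.hull, p.2 ≤ c + L.slope i * p.1) : L.supp i ≤ c := by
  refine csSup_le (L.closure_hull_nonempty.image _) ?_
  rintro _ ⟨q, hq, rfl⟩
  have := h q hq
  simp only
  linarith

theorem supp_le_icpt (i : Fin k) : L.supp i ≤ L.icpt i :=
  L.supp_le fun _ hp => L.mem_closure_hull_iff.1 hp i

theorem above_supp {i : Fin k} {p : Plane} (h : p ∈ L.above i) :
    L.supp i + L.slope i * p.1 < p.2 := by
  have := L.mem_above_iff.1 h
  have := L.supp_le_icpt i
  linarith

/-! ### Vertices -/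

theorem mem_vertices_of_tight {a : Plane} (ha : a ∈ closure L.hull) {i j : Fin k}
    (hij : L.slope j < L.slope i) (hi : a.2 = L.icpt i + L.slope i * a.1)
    (hj : a.2 = L.icpt j + L.slope j * a.1) : a ∈ L.vertices := by
  have key : ∀ p ∈ closure L.hull, ∀ q ∈ closure L.hull, a ∈ openSegment ℝ p q → p = a := by
    rintro p hp q hq ⟨s, t, hs, ht, hst, rfl⟩
    simp only [Prod.fst_add, Prod.snd_add, Prod.smul_fst, Prod.smul_snd, smul_eq_mul] at hi hj
    have tight : ∀ m, (s * p.2 + t * q.2 = L.icpt m + L.slope m * (s * p.1 + t * q.1)) →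
        p.2 = L.icpt m + L.slope m * p.1 := by
      intro m hm
      have h1 := L.mem_closure_hull_iff.1 hp m
      have h2 := mul_le_mul_of_nonneg_left (L.mem_closure_hull_iff.1 hq m) ht.le
      refine h1.antisymm (le_of_mul_le_mul_left ?_ hs)
      have h3 : L.icpt m = s * L.icpt m + t * L.icpt m := by rw [← add_mul, hst, one_mul]
      linarith
    have e1 : ∀ m, p.2 = L.icpt m + L.slope m * p.1 →
        s * p.2 + t * q.2 = L.icpt m + L.slope m * (s * p.1 + t * q.1) →
        s * p.2 + t * q.2 = p.2 + L.slope m * (s * p.1 + t * q.1 - p.1) := by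
      intro m h1 h2; linarith
    have hi' := e1 i (tight i hi) hi
    have hj' := e1 j (tight j hj) hj
    have h0 : (L.slope i - L.slope j) * (s * p.1 + t * q.1 - p.1) = 0 := by linarith
    have h1 : s * p.1 + t * q.1 - p.1 = 0 :=
      (mul_eq_zero.1 h0).resolve_left (sub_pos.2 hij).ne'
    rw [h1, mul_zero, add_zero] at hi'
    refine Prod.ext ?_ ?_
    · simp only [Prod.fst_add, Prod.smul_fst, smul_eq_mul]; linarith
    · simp only [Prod.snd_add, Prod.smul_snd, smul_eq_mul]; linarith
  refine mem_extremePoints.2 ⟨ha, fun p hp q hq h => ⟨key p hp q hq h, key q hq p hp ?_⟩⟩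
  rwa [openSegment_symm]

theorem exists_tight_of_mem_vertices {a : Plane} (ha : a ∈ L.vertices) :
    ∃ i j, L.slope j < L.slope i ∧ a.2 = L.icpt i + L.slope i * a.1 ∧
      a.2 = L.icpt j + L.slope j * a.1 := by
  by_contra! hne
  obtain ⟨ha1, ha2⟩ := mem_extremePoints.1 ha
  obtain ⟨σ, hσ⟩ : ∃ σ, ∀ i, a.2 = L.icpt i + L.slope i * a.1 → L.slope i = σ := by
    by_cases h : ∃ i, a.2 = L.icpt i + L.slope i * a.1
    · obtain ⟨i, hi⟩ := h
      refine ⟨L.slope i, fun j hj => ?_⟩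
      rcases lt_trichotomy (L.slope j) (L.slope i) with h | h | h
      · exact absurd hj (hne i j h hi)
      · exact h
      · exact absurd hi (hne j i h hj)
    · exact ⟨0, fun i hi => absurd ⟨i, hi⟩ h⟩
  have hev : ∀ᶠ ε : ℝ in nhds 0, ∀ i, a.2 + ε * σ ≤ L.icpt i + L.slope i * (a.1 + ε) := by
    rw [Filter.eventually_all]
    intro i
    rcases (L.mem_closure_hull_iff.1 ha1 i).lt_or_eq with h | h
    · have h1 : Continuous fun ε : ℝ => a.2 + ε * σ := by fun_prop
      have h2 : Continuous fun ε : ℝ => L.icpt i + L.slope i * (a.1 + ε) := by fun_prop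
      have := h1.continuousAt.eventually_lt (x₀ := 0) h2.continuousAt (by simpa using h)
      exact this.mono fun _ h => h.le
    · refine Filter.Eventually.of_forall fun ε => ?_
      have := hσ i h
      subst this
      linarith
  obtain ⟨r, hr, hball⟩ := Metric.eventually_nhds_iff.1 hev
  have hmem : ∀ ε : ℝ, |ε| < r → ((a.1 + ε, a.2 + ε * σ) : Plane) ∈ closure L.hull :=
    fun ε hε => L.mem_closure_hull_iff.2 (hball (by simpa [Real.dist_eq] using hε))
  have h1 := ha2 _ (hmem (r / 2) (by rw [abs_of_pos] <;> linarith)) _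
    (hmem (-(r / 2)) (by rw [abs_neg, abs_of_pos] <;> linarith))
    ⟨1 / 2, 1 / 2, by norm_num, by norm_num, by norm_num, by
      refine Prod.ext ?_ ?_
      · simp only [Prod.fst_add, Prod.smul_fst, smul_eq_mul]; ring
      · simp only [Prod.snd_add, Prod.smul_snd, smul_eq_mul]; ring⟩
  have := congrArg Prod.fst h1.1
  simp only at this
  linarith

/-- The intersection point of two canonical lines. -/
noncomputable def cut (i j : Fin k) : Plane :=
  ((L.icpt j - L.icpt i) / (L.slope i - L.slope j),
    L.icpt i + L.slope i * ((L.icpt j - L.icpt i) / (L.slope i - L.slope j)))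

theorem vertices_subset_range : L.vertices ⊆ range fun x : Fin k × Fin k => L.cut x.1 x.2 := by
  intro a ha
  obtain ⟨i, j, hij, hi, hj⟩ := L.exists_tight_of_mem_vertices ha
  have h1 : a.1 = (L.icpt j - L.icpt i) / (L.slope i - L.slope j) := by
    rw [eq_div_iff (sub_pos.2 hij).ne']
    linarith
  refine ⟨(i, j), Prod.ext h1.symm ?_⟩
  simp only [cut]
  rw [← h1, hi]

theorem finite_vertices : L.vertices.Finite :=
  (finite_range _).subset L.vertices_subset_range

/-- The x-coordinates of the vertices in increasing order. -/
noncomputable def vertexCoords : List ℝ :=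
  (L.finite_vertices.toFinset.image Prod.fst).sort (· ≤ ·)

theorem mem_vertexCoords {x : ℝ} : x ∈ L.vertexCoords ↔ ∃ a ∈ L.vertices, a.1 = x := by
  simp [vertexCoords]

theorem length_vertexCoords_le : L.vertexCoords.length ≤ k * k := by
  classical
  rw [vertexCoords, Finset.length_sort]
  refine Finset.card_image_le.trans ?_
  have h : L.finite_vertices.toFinset ⊆
      (Finset.univ : Finset (Fin k × Fin k)).image fun x => L.cut x.1 x.2 := by
    intro a ha
    obtain ⟨x, hx⟩ := L.vertices_subset_range (L.finite_vertices.mem_toFinset.1 ha)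
    exact Finset.mem_image.2 ⟨x, Finset.mem_univ x, hx⟩
  refine (Finset.card_le_card h).trans (Finset.card_image_le.trans ?_)
  simp

theorem pairwise_vertexCoords : L.vertexCoords.Pairwise (· < ·) :=
  (Finset.sortedLT_sort _).pairwise

theorem exists_breakpoint {i j : Fin k} (hij : L.slope j < L.slope i) (hs : (j : ℕ) = i + 1) :
    ∃ a ∈ L.vertices, ∀ m, L.slope j ≤ m → m ≤ L.slope i →
      ∀ p ∈ closure L.hull, p.2 ≤ a.2 + m * (p.1 - a.1) := by
  have hi : (Finset.Iic i).Nonempty := ⟨i, by simp⟩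
  have hj : (Finset.Ici j).Nonempty := ⟨j, by simp⟩
  set g₁ : ℝ → ℝ := fun x => (Finset.Iic i).inf' hi fun t => L.icpt t + L.slope t * x with hg₁
  set g₂ : ℝ → ℝ := fun x => (Finset.Ici j).inf' hj fun t => L.icpt t + L.slope t * x with hg₂
  have hc₁ : Continuous g₁ := Continuous.finset_inf'_apply hi fun t _ => by fun_prop
  have hc₂ : Continuous g₂ := Continuous.finset_inf'_apply hj fun t _ => by fun_prop
  obtain ⟨B, hB⟩ := L.exists_const_le_icpt
  have hd := sub_pos.2 hij
  obtain ⟨X, hX0, hX1⟩ : ∃ X : ℝ, 0 ≤ X ∧ g₂ X ≤ g₁ X := by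
    set X := (L.icpt j - B) / (L.slope i - L.slope j)
    have hX : X * (L.slope i - L.slope j) = L.icpt j - B := div_mul_cancel₀ _ hd.ne'
    have hX0 : 0 ≤ X := div_nonneg (by have := hB j; linarith) hd.le
    refine ⟨X, hX0, (Finset.inf'_le _ (b := j) (by simp)).trans (Finset.le_inf' _ _ fun t ht => ?_)⟩
    have h1 := mul_le_mul_of_nonneg_right (L.slope_antitone (Finset.mem_Iic.1 ht)) hX0
    have h2 := hB t
    linarith
  obtain ⟨Y, hY0, hY1⟩ : ∃ Y : ℝ, Y ≤ 0 ∧ g₁ Y ≤ g₂ Y := by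
    set X := (L.icpt i - B) / (L.slope i - L.slope j)
    have hX : X * (L.slope i - L.slope j) = L.icpt i - B := div_mul_cancel₀ _ hd.ne'
    have hX0 : 0 ≤ X := div_nonneg (by have := hB i; linarith) hd.le
    refine ⟨-X, by linarith,
      (Finset.inf'_le _ (b := i) (by simp)).trans (Finset.le_inf' _ _ fun t ht => ?_)⟩
    have h1 := mul_le_mul_of_nonneg_right (L.slope_antitone (Finset.mem_Ici.1 ht)) hX0
    have h2 := hB t
    linarith
  obtain ⟨x, -, hx⟩ : (0 : ℝ) ∈ (fun x => g₁ x - g₂ x) '' Icc Y X :=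
    intermediate_value_Icc (hY0.trans hX0) (hc₁.sub hc₂).continuousOn
      ⟨sub_nonpos.2 hY1, sub_nonneg.2 hX1⟩
  have hx : g₁ x = g₂ x := sub_eq_zero.1 hx
  obtain ⟨t₁, ht₁, h₁⟩ := Finset.exists_mem_eq_inf' hi fun t => L.icpt t + L.slope t * x
  obtain ⟨t₂, ht₂, h₂⟩ := Finset.exists_mem_eq_inf' hj fun t => L.icpt t + L.slope t * x
  have hs₁ := L.slope_antitone (Finset.mem_Iic.1 ht₁)
  have hs₂ := L.slope_antitone (Finset.mem_Ici.1 ht₂)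
  have h₁ : g₁ x = L.icpt t₁ + L.slope t₁ * x := h₁
  have h₂ : g₁ x = L.icpt t₂ + L.slope t₂ * x := hx.trans h₂
  have hmem : ((x, g₁ x) : Plane) ∈ closure L.hull := L.mem_closure_hull_iff.2 fun t => by
    rcases Nat.lt_or_ge i t with h | h
    · simp only
      rw [hx]
      exact Finset.inf'_le _ (Finset.mem_Ici.2 (by rw [Fin.le_def]; omega))
    · exact Finset.inf'_le _ (Finset.mem_Iic.2 (by rw [Fin.le_def]; omega))
  refine ⟨(x, g₁ x), L.mem_vertices_of_tight hmem (i := t₁) (j := t₂) (by linarith) h₁ h₂,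
    fun m hm₁ hm₂ p hp => ?_⟩
  simp only
  rcases le_total x p.1 with h | h
  · have e1 := L.mem_closure_hull_iff.1 hp t₂
    have e2 := mul_le_mul_of_nonneg_right (hs₂.trans hm₁) (sub_nonneg.2 h)
    linarith
  · have e1 := L.mem_closure_hull_iff.1 hp t₁
    have e2 := mul_le_mul_of_nonpos_right (hm₂.trans hs₁) (sub_nonpos.2 h)
    linarith

/-- The vertex of the canonical hull on the supporting lines with the slopes of the lines
`i` and `i + 1`, if these are distinct. -/
noncomputable def breakpoint (i : ℕ) : Plane := by
  classical
  exact if h : ∃ h : i + 1 < k, L.slope ⟨i + 1, h⟩ < L.slope ⟨i, by omega⟩ then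
    (L.exists_breakpoint (i := ⟨i, by have := h.1; omega⟩) (j := ⟨i + 1, h.1⟩) h.2 rfl).choose
  else 0

/-- The slopes of the lines `i` and `i + 1` are distinct. -/
def Turns (i j : Fin k) : Prop := (j : ℕ) = i + 1 ∧ L.slope j < L.slope i

theorem breakpoint_spec {i j : Fin k} (h : L.Turns i j) :
    L.breakpoint i ∈ L.vertices ∧ ∀ m, L.slope j ≤ m → m ≤ L.slope i →
      ∀ p ∈ closure L.hull,
        p.2 ≤ (L.breakpoint i).2 + m * (p.1 - (L.breakpoint i).1) := by
  obtain ⟨i, hi⟩ := i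
  obtain ⟨j, hj⟩ := j
  obtain ⟨rfl, h2⟩ := h
  unfold breakpoint
  rw [dif_pos ⟨hj, h2⟩]
  exact (L.exists_breakpoint (i := ⟨i, hi⟩) (j := ⟨i + 1, hj⟩) h2 rfl).choose_spec

theorem vertices_subset : L.vertices ⊆ closure L.hull := extremePoints_subset

/-- `p` is above the supporting line of slope `slope i`. -/
def AboveSupp (i : Fin k) (p : Plane) : Prop := L.supp i + L.slope i * p.1 < p.2

/-- `p` is below the supporting line of slope `slope i`. -/
def BelowSupp (i : Fin k) (p : Plane) : Prop := p.2 < L.supp i + L.slope i * p.1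

variable {L} {i j t : Fin k} {p q e : Plane}

theorem AboveSupp.not_mem_closure (h : L.AboveSupp i p) : p ∉ closure L.hull := fun hp =>
  absurd (L.le_supp hp) (not_le.2 h)

theorem Turns.supp_left (h : L.Turns i j) :
    L.supp i = (L.breakpoint i).2 - L.slope i * (L.breakpoint i).1 := by
  obtain ⟨h1, h2⟩ := L.breakpoint_spec h
  refine (L.supp_le fun p hp => ?_).antisymm ?_
  · have := h2 _ h.2.le le_rfl p hp
    linarith
  · have := L.le_supp (i := i) (L.vertices_subset h1)
    linarith

theorem Turns.supp_right (h : L.Turns i j) :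
    L.supp j = (L.breakpoint i).2 - L.slope j * (L.breakpoint i).1 := by
  obtain ⟨h1, h2⟩ := L.breakpoint_spec h
  refine (L.supp_le fun p hp => ?_).antisymm ?_
  · have := h2 _ le_rfl h.2.le p hp
    linarith
  · have := L.le_supp (i := j) (L.vertices_subset h1)
    linarith

theorem supp_congr (h : L.slope i = L.slope j) : L.supp i = L.supp j := by
  unfold supp; rw [h]

theorem turns_of_above_below (hij : (j : ℕ) = i + 1) (hi : L.AboveSupp i p)
    (hj : L.BelowSupp j p) : L.Turns i j := by
  refine ⟨hij, (L.slope_antitone (Fin.le_def.2 (by omega))).lt_of_ne fun h => ?_⟩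
  unfold AboveSupp at hi
  unfold BelowSupp at hj
  rw [h, L.supp_congr h] at hj
  linarith

theorem turns_of_below_above (hij : (j : ℕ) = i + 1) (hi : L.BelowSupp i p)
    (hj : L.AboveSupp j p) : L.Turns i j := by
  refine ⟨hij, (L.slope_antitone (Fin.le_def.2 (by omega))).lt_of_ne fun h => ?_⟩
  unfold BelowSupp at hi
  unfold AboveSupp at hj
  rw [h, L.supp_congr h] at hj
  linarith

theorem Turns.isRightTangent (h : L.Turns i j) (hi : L.AboveSupp i p) (hj : L.BelowSupp j p) :
    L.IsRightTangent p (L.breakpoint i) := by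
  obtain ⟨h1, h2⟩ := L.breakpoint_spec h
  unfold AboveSupp at hi
  unfold BelowSupp at hj
  rw [h.supp_left] at hi
  rw [h.supp_right] at hj
  have hlt : p.1 < (L.breakpoint i).1 := by
    by_contra hle
    have := mul_le_mul_of_nonneg_right h.2.le (sub_nonneg.2 (not_lt.1 hle))
    linarith
  have hd := sub_pos.2 hlt
  refine ⟨h1, hlt, fun q hq => ?_⟩
  set a := L.breakpoint i
  have hm : (a.2 - p.2) / (a.1 - p.1) * (a.1 - p.1) = a.2 - p.2 := div_mul_cancel₀ _ hd.ne'
  have := h2 ((a.2 - p.2) / (a.1 - p.1)) (by rw [le_div_iff₀ hd]; linarith)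
    (by rw [div_le_iff₀ hd]; linarith) q (subset_closure hq)
  have := mul_le_mul_of_nonneg_left this hd.le
  have e2 : (a.1 - p.1) * (a.2 + (a.2 - p.2) / (a.1 - p.1) * (q.1 - a.1)) =
      (a.1 - p.1) * a.2 + (a.2 - p.2) / (a.1 - p.1) * (a.1 - p.1) * (q.1 - a.1) := by ring
  rw [e2, hm] at this
  simp only [cross, Prod.fst_sub, Prod.snd_sub]
  linarith

theorem Turns.isLeftTangent (h : L.Turns i j) (hi : L.BelowSupp i p) (hj : L.AboveSupp j p) :
    L.IsLeftTangent p (L.breakpoint i) := by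
  obtain ⟨h1, h2⟩ := L.breakpoint_spec h
  unfold AboveSupp at hj
  unfold BelowSupp at hi
  rw [h.supp_left] at hi
  rw [h.supp_right] at hj
  have hlt : (L.breakpoint i).1 < p.1 := by
    by_contra hle
    have := mul_le_mul_of_nonpos_right h.2.le (sub_nonpos.2 (not_lt.1 hle))
    linarith
  have hd := sub_pos.2 hlt
  refine ⟨h1, hlt, fun q hq => ?_⟩
  set a := L.breakpoint i
  have hm : (p.2 - a.2) / (p.1 - a.1) * (p.1 - a.1) = p.2 - a.2 := div_mul_cancel₀ _ hd.ne'
  have := h2 ((p.2 - a.2) / (p.1 - a.1)) (by rw [le_div_iff₀ hd]; linarith)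
    (by rw [div_le_iff₀ hd]; linarith) q (subset_closure hq)
  have := mul_le_mul_of_nonneg_left this hd.le
  have e2 : (p.1 - a.1) * (a.2 + (p.2 - a.2) / (p.1 - a.1) * (q.1 - a.1)) =
      (p.1 - a.1) * a.2 + (p.2 - a.2) / (p.1 - a.1) * (p.1 - a.1) * (q.1 - a.1) := by ring
  rw [e2, hm] at this
  simp only [cross, Prod.fst_sub, Prod.snd_sub]
  linarith

theorem not_exists_isRightTangent (hi : ∀ t, t ≤ i) (h : L.AboveSupp i p) :
    ¬ ∃ a, L.IsRightTangent p a := by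
  rintro ⟨a, ha, hlt, hq⟩
  obtain ⟨B, hB⟩ := L.exists_hull_far_right
  have hB := hB (L.slope i) fun t => L.slope_antitone (hi t)
  have h1 := L.le_supp (i := i) (L.vertices_subset ha)
  unfold AboveSupp at h
  have hd := sub_pos.2 hlt
  set c := (a.1 - p.1) * L.slope i - (a.2 - p.2) with hc
  have hc0 : 0 < c := by rw [hc]; linarith
  set x := |((a.1 - p.1) * (p.2 - B) - (a.2 - p.2) * p.1) / c| + 1 with hx
  have h2 := hq _ (hB x (by positivity))
  simp only [cross, Prod.fst_sub, Prod.snd_sub] at h2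
  have h3 : ((a.1 - p.1) * (p.2 - B) - (a.2 - p.2) * p.1) / c < x := by
    have := le_abs_self (((a.1 - p.1) * (p.2 - B) - (a.2 - p.2) * p.1) / c)
    linarith
  rw [div_lt_iff₀ hc0] at h3
  have e : x * c = x * ((a.1 - p.1) * L.slope i - (a.2 - p.2)) := rfl
  linarith

theorem not_exists_isLeftTangent (hi : ∀ t, i ≤ t) (h : L.AboveSupp i p) :
    ¬ ∃ a, L.IsLeftTangent p a := by
  rintro ⟨a, ha, hlt, hq⟩
  obtain ⟨B, hB⟩ := L.exists_hull_far_left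
  have hB := hB (L.slope i) fun t => L.slope_antitone (hi t)
  have h1 := L.le_supp (i := i) (L.vertices_subset ha)
  unfold AboveSupp at h
  have hd := sub_pos.2 hlt
  set c := (p.2 - a.2) - (p.1 - a.1) * L.slope i with hc
  have hc0 : 0 < c := by rw [hc]; linarith
  set x := |((p.1 - a.1) * (a.2 - B) - (p.2 - a.2) * a.1) / c| + 1 with hx
  have hx0 : 0 ≤ x := by positivity
  have h2 := hq _ (hB (-x) (by linarith))
  simp only [cross, Prod.fst_sub, Prod.snd_sub] at h2
  have h3 : ((p.1 - a.1) * (a.2 - B) - (p.2 - a.2) * a.1) / c < x := by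
    have := le_abs_self (((p.1 - a.1) * (a.2 - B) - (p.2 - a.2) * a.1) / c)
    linarith
  rw [div_lt_iff₀ hc0] at h3
  have e : x * c = x * ((p.2 - a.2) - (p.1 - a.1) * L.slope i) := rfl
  linarith

theorem Turns.belowSupp_of_gt (h : L.Turns i j) (hq : L.BelowSupp i q)
    (hlt : (L.breakpoint i).1 ≤ q.1) (ht : t ≤ i) : L.BelowSupp t q := by
  unfold BelowSupp at hq ⊢
  rw [h.supp_left] at hq
  have h1 := L.le_supp (i := t) (L.vertices_subset (L.breakpoint_spec h).1)
  have h2 := mul_le_mul_of_nonneg_right (L.slope_antitone ht) (sub_nonneg.2 hlt)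
  linarith

theorem Turns.breakpoint_le {i' j' : Fin k} (h : L.Turns i j) (h' : L.Turns i' j')
    (hi : i ≤ i') : (L.breakpoint i).1 ≤ (L.breakpoint i').1 := by
  rcases hi.eq_or_lt with rfl | hi
  · rfl
  by_contra! hlt
  have hs : L.slope i' < L.slope i :=
    (L.slope_antitone (Fin.le_def.2 (by have := h.1; have := Fin.lt_def.1 hi; omega))).trans_lt h.2
  have h1 := (L.breakpoint_spec h).2 _ h.2.le le_rfl _ (L.vertices_subset (L.breakpoint_spec h').1)
  have h2 := (L.breakpoint_spec h').2 _ h'.2.le le_rfl _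
    (L.vertices_subset (L.breakpoint_spec h).1)
  have h3 := mul_lt_mul_of_pos_right hs (sub_pos.2 hlt)
  linarith

/-! ### Tangents and pencils -/

variable (L)

/-- The position of the right end of the pencil slab of a point between the supporting lines `j`
and `j + 1`. -/
noncomputable def rightEnd (j : Fin k) : EReal :=
  if (j : ℕ) + 1 < k then ((L.breakpoint j).1 : EReal) else ⊤

/-- The position of the left end of the pencil slab of a point between the supporting lines
`j - 1` and `j`. -/
noncomputable def leftEnd (j : Fin k) : EReal :=
  if (j : ℕ) = 0 then ⊥ else ((L.breakpoint ((j : ℕ) - 1)).1 : EReal)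

/-- The line of the right arm of `e`, directed such that the arm is the boundary of the
halfplane on its left. -/
noncomputable def rightLine (j : Fin k) (e : Plane) : DirLine :=
  if (j : ℕ) + 1 < k then ⟨L.breakpoint j, e - L.breakpoint j⟩ else ⟨e, (-1, -L.slope j)⟩

/-- The line of the left arm of `e`, directed from left to right. -/
noncomputable def leftLine (j : Fin k) (e : Plane) : DirLine :=
  if (j : ℕ) = 0 then ⟨e, (1, L.slope j)⟩ else
    ⟨L.breakpoint ((j : ℕ) - 1), e - L.breakpoint ((j : ℕ) - 1)⟩

/-- The right tangent from `e` touches between the supporting lines `j` and `j + 1`. -/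
def RightTouch (j : Fin k) (e : Plane) : Prop :=
  L.AboveSupp j e ∧ ∀ t : Fin k, (t : ℕ) = j + 1 → L.BelowSupp t e

/-- The left tangent from `e` touches between the supporting lines `j - 1` and `j`. -/
def LeftTouch (j : Fin k) (e : Plane) : Prop :=
  L.AboveSupp j e ∧ ∀ t : Fin k, (j : ℕ) = t + 1 → L.BelowSupp t e

variable {L}

theorem RightTouch.cases (h : L.RightTouch j e) :
    (∃ t, L.Turns j t ∧ L.BelowSupp t e ∧ L.IsRightTangent e (L.breakpoint j) ∧
      L.rightEnd j = ((L.breakpoint j).1 : EReal) ∧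
      L.rightLine j e = ⟨L.breakpoint j, e - L.breakpoint j⟩) ∨
    ((∀ t, t ≤ j) ∧ (¬ ∃ a, L.IsRightTangent e a) ∧ L.rightEnd j = ⊤ ∧
      L.rightLine j e = ⟨e, (-1, -L.slope j)⟩) := by
  by_cases hj : (j : ℕ) + 1 < k
  · have hb := h.2 ⟨j + 1, hj⟩ rfl
    have ht := turns_of_above_below rfl h.1 hb
    exact Or.inl ⟨_, ht, hb, ht.isRightTangent h.1 hb, if_pos hj, if_pos hj⟩
  · have hl : ∀ t, t ≤ j := fun t => Fin.le_def.2 (by omega)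
    exact Or.inr ⟨hl, not_exists_isRightTangent hl h.1, if_neg hj, if_neg hj⟩

theorem LeftTouch.cases (h : L.LeftTouch j e) :
    (∃ t, L.Turns t j ∧ L.BelowSupp t e ∧ L.IsLeftTangent e (L.breakpoint t) ∧
      L.leftEnd j = ((L.breakpoint t).1 : EReal) ∧
      L.leftLine j e = ⟨L.breakpoint t, e - L.breakpoint t⟩) ∨
    ((∀ t, j ≤ t) ∧ (¬ ∃ a, L.IsLeftTangent e a) ∧ L.leftEnd j = ⊥ ∧
      L.leftLine j e = ⟨e, (1, L.slope j)⟩) := by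
  by_cases hj : (j : ℕ) = 0
  · have hl : ∀ t, j ≤ t := fun t => Fin.le_def.2 (by omega)
    exact Or.inr ⟨hl, not_exists_isLeftTangent hl h.1, if_pos hj, if_pos hj⟩
  · have hj' : (j : ℕ) = (j : ℕ) - 1 + 1 := by omega
    have hb := h.2 ⟨j - 1, by omega⟩ hj'
    have ht := turns_of_below_above hj' hb h.1
    exact Or.inl ⟨_, ht, hb, ht.isLeftTangent hb h.1, if_neg hj, if_neg hj⟩

theorem isPencilSlab {jl jr : Fin k} (hl : L.LeftTouch jl e) (hr : L.RightTouch jr e) :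
    L.IsPencilSlab e ⟨L.leftEnd jl, L.rightEnd jr⟩ := by
  refine ⟨hl.1.not_mem_closure, ?_, ?_⟩
  · rcases hl.cases with ⟨t, -, -, h1, h2, -⟩ | ⟨-, h1, h2, -⟩
    exacts [Or.inl ⟨_, h1, h2⟩, Or.inr ⟨h1, h2⟩]
  · rcases hr.cases with ⟨t, -, -, h1, h2, -⟩ | ⟨-, h1, h2, -⟩
    exacts [Or.inl ⟨_, h1, h2⟩, Or.inr ⟨h1, h2⟩]

theorem LeftTouch.leftEnd_lt (h : L.LeftTouch j e) : L.leftEnd j < (e.1 : EReal) := by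
  rcases h.cases with ⟨t, -, -, h1, h2, -⟩ | ⟨-, h1, h2, -⟩
  · rw [h2]; exact EReal.coe_lt_coe_iff.2 h1.2.1
  · rw [h2]; exact EReal.bot_lt_coe _

theorem RightTouch.lt_rightEnd (h : L.RightTouch j e) : (e.1 : EReal) < L.rightEnd j := by
  rcases h.cases with ⟨t, -, -, h1, h2, -⟩ | ⟨-, h1, h2, -⟩
  · rw [h2]; exact EReal.coe_lt_coe_iff.2 h1.2.1
  · rw [h2]; exact EReal.coe_lt_top _

theorem IsPencilSlab.isSlab {S : Slab} (h : L.IsPencilSlab e S) : L.IsSlab S := by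
  obtain ⟨-, h1, h2⟩ := h
  have e1 : S.lo < (e.1 : EReal) := by
    rcases h1 with ⟨a, ha, h⟩ | ⟨-, h⟩
    · rw [h]; exact EReal.coe_lt_coe_iff.2 ha.2.1
    · rw [h]; exact EReal.bot_lt_coe _
  have e2 : (e.1 : EReal) < S.hi := by
    rcases h2 with ⟨a, ha, h⟩ | ⟨-, h⟩
    · rw [h]; exact EReal.coe_lt_coe_iff.2 ha.2.1
    · rw [h]; exact EReal.coe_lt_top _
  refine ⟨e1.trans e2, ?_, ?_⟩
  · rcases h1 with ⟨a, ha, h⟩ | ⟨-, h⟩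
    exacts [Or.inr ⟨a, ha.1, h⟩, Or.inl h]
  · rcases h2 with ⟨a, ha, h⟩ | ⟨-, h⟩
    exacts [Or.inr ⟨a, ha.1, h⟩, Or.inl h]

theorem RightTouch.below_rightArm (h : L.RightTouch j e) (h1 : e.1 ≤ p.1)
    (h2 : (p.1 : EReal) < L.rightEnd j) (hp : p ∈ (L.rightLine j e).left) :
    Below p (L.rightArm e) := by
  rcases h.cases with ⟨t, -, -, ht, he, hl⟩ | ⟨hj, hn, -, hl⟩
  · rw [hl, mem_left_iff] at hp
    rw [he, EReal.coe_lt_coe_iff] at h2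
    obtain ⟨y, hy, hs⟩ := (below_segment_iff ht.2.1 h1 h2.le).2 (by
      simp only [Prod.fst_sub, Prod.snd_sub] at hp
      linarith)
    exact ⟨y, hy, Or.inl ⟨_, ht, hs⟩⟩
  · rw [hl, mem_left_iff] at hp
    simp only at hp
    refine ⟨e.2 + L.slope j * (p.1 - e.1), by linarith, Or.inr ⟨hn, j, hj,
      (p.1 - e.1) / (L.dir j).2, div_nonneg (sub_nonneg.2 h1) (L.upward j).le, ?_⟩⟩
    have := (L.upward j).ne'
    refine Prod.ext ?_ ?_
    · simp only [Prod.fst_add, Prod.smul_fst, smul_eq_mul]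
      field_simp
      ring
    · simp only [Prod.snd_add, Prod.smul_snd, smul_eq_mul, slope]
      field_simp

theorem LeftTouch.below_leftArm (h : L.LeftTouch j e) (h1 : p.1 ≤ e.1)
    (h2 : L.leftEnd j < (p.1 : EReal)) (hp : p ∈ (L.leftLine j e).right) :
    Below p (L.leftArm e) := by
  rcases h.cases with ⟨t, -, -, ht, he, hl⟩ | ⟨hj, hn, -, hl⟩
  · rw [hl, mem_right_iff] at hp
    rw [he, EReal.coe_lt_coe_iff] at h2
    obtain ⟨y, hy, hs⟩ := (below_segment_iff ht.2.1 h2.le h1).2 (by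
      simp only [Prod.fst_sub, Prod.snd_sub] at hp
      linarith)
    exact ⟨y, hy, Or.inl ⟨_, ht, hs⟩⟩
  · rw [hl, mem_right_iff] at hp
    simp only at hp
    refine ⟨e.2 + L.slope j * (p.1 - e.1), by linarith, Or.inr ⟨hn, j, hj,
      (e.1 - p.1) / (L.dir j).2, div_nonneg (sub_nonneg.2 h1) (L.upward j).le, ?_⟩⟩
    have := (L.upward j).ne'
    refine Prod.ext ?_ ?_
    · simp only [Prod.fst_add, Prod.smul_fst, smul_eq_mul]
      field_simp
      ring
    · simp only [Prod.snd_add, Prod.smul_snd, smul_eq_mul, slope]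
      field_simp
      ring

theorem RightTouch.exists_above (h : L.RightTouch j e) (hp : p ∈ (L.rightLine j e).right) :
    ∃ i, p ∈ L.above i := by
  refine L.exists_above_of_not_mem_closure ?_
  rcases h.cases with ⟨t, -, -, ht, he, hl⟩ | ⟨hj, hn, -, hl⟩
  · rw [hl, mem_right_iff] at hp
    intro hc
    have := L.hull_le_of_forall ht.2.2 p hc
    simp only [cross, Prod.fst_sub, Prod.snd_sub] at this hp
    linarith
  · rw [hl, mem_right_iff] at hp
    have := h.1
    simp only [AboveSupp] at this hp
    exact AboveSupp.not_mem_closure (i := j) (show _ < _ by linarith)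

theorem LeftTouch.exists_above (h : L.LeftTouch j e) (hp : p ∈ (L.leftLine j e).left) :
    ∃ i, p ∈ L.above i := by
  refine L.exists_above_of_not_mem_closure ?_
  rcases h.cases with ⟨t, -, -, ht, he, hl⟩ | ⟨hj, hn, -, hl⟩
  · rw [hl, mem_left_iff] at hp
    intro hc
    have := L.hull_le_of_forall ht.2.2 p hc
    simp only [cross, Prod.fst_sub, Prod.snd_sub] at this hp
    linarith
  · rw [hl, mem_left_iff] at hp
    have := h.1
    simp only [AboveSupp] at this hp
    exact AboveSupp.not_mem_closure (i := j) (show _ < _ by linarith)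

theorem RightTouch.isPencil_of_right {jl : Fin k} (h : L.RightTouch j e) (hl : L.LeftTouch jl e)
    (h1 : e.1 ≤ p.1) (h2 : (p.1 : EReal) < L.rightEnd j) (hp : p ∈ (L.rightLine j e).left) :
    (Slab.mk (L.leftEnd jl) (L.rightEnd j)).Contains p ∧ p ∈ L.pencil e := by
  have hc : (Slab.mk (L.leftEnd jl) (L.rightEnd j)).Contains p :=
    ⟨hl.leftEnd_lt.trans_le (EReal.coe_le_coe_iff.2 h1), h2⟩
  obtain ⟨y, hy, hm⟩ := h.below_rightArm h1 h2 hp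
  exact ⟨hc, ⟨_, isPencilSlab hl h, hc⟩, y, hy, Or.inr hm⟩

theorem LeftTouch.isPencil_of_left {jr : Fin k} (h : L.LeftTouch j e) (hr : L.RightTouch jr e)
    (h1 : p.1 ≤ e.1) (h2 : L.leftEnd j < (p.1 : EReal)) (hp : p ∈ (L.leftLine j e).right) :
    (Slab.mk (L.leftEnd j) (L.rightEnd jr)).Contains p ∧ p ∈ L.pencil e := by
  have hc : (Slab.mk (L.leftEnd j) (L.rightEnd jr)).Contains p :=
    ⟨h2, (EReal.coe_le_coe_iff.2 h1).trans_lt hr.lt_rightEnd⟩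
  obtain ⟨y, hy, hm⟩ := h.below_leftArm h1 h2 hp
  exact ⟨hc, ⟨_, isPencilSlab h hr, hc⟩, y, hy, Or.inl hm⟩

end CanonicalLines

namespace CanonicalLines

variable {n k : ℕ} (L : CanonicalLines k)

/-! ### Slabs between two tangents -/

/-- `S` is a slab that a certificate may assign to the `i`-th point. -/
def SlabValid (P : Input n) (i : Fin n) (S : Slab) : Prop :=
  L.IsSlab S ∧ S.Contains (P i) ∧
    (L.IsLeafSlab S ∨ L.BelowSeg S (P i) ∨
      ∃ j, L.VExtremal P j ∧ L.IsPencilSlab (P j) S ∧ P i ∈ L.pencil (P j))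

variable {L}

theorem belowSeg_of_mem_lss {jr jl : Fin k} {p q r : Plane} (hq : L.RightTouch jr q)
    (hr : L.LeftTouch jl r) (hp : p ∈ lss q r) (hqr : q.1 < r.1)
    (h1 : L.rightEnd jr < (p.1 : EReal)) (h2 : (p.1 : EReal) < L.leftEnd jl) :
    L.IsSlab ⟨L.rightEnd jr, L.leftEnd jl⟩ ∧
      (Slab.mk (L.rightEnd jr) (L.leftEnd jl)).Contains p ∧
      L.BelowSeg ⟨L.rightEnd jr, L.leftEnd jl⟩ p := by
  rcases hq.cases with ⟨t, -, -, ha, hea, -⟩ | ⟨-, -, h, -⟩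
  swap
  · rw [h] at h1; exact absurd le_top (not_le.2 h1)
  rcases hr.cases with ⟨s, -, -, hb, heb, -⟩ | ⟨-, -, h, -⟩
  swap
  · rw [h] at h2; exact absurd bot_le (not_le.2 h2)
  set a := L.breakpoint jr
  set b := L.breakpoint s
  rw [hea, heb]
  rw [hea, EReal.coe_lt_coe_iff] at h1
  rw [heb, EReal.coe_lt_coe_iff] at h2
  have hab := h1.trans h2
  refine ⟨⟨EReal.coe_lt_coe_iff.2 hab, Or.inr ⟨a, ha.1, rfl⟩, Or.inr ⟨b, hb.1, rfl⟩⟩,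
    ⟨EReal.coe_lt_coe_iff.2 h1, EReal.coe_lt_coe_iff.2 h2⟩,
    a, ha.1, b, hb.1, rfl, rfl, (below_segment_iff hab h1.le h2.le).2 ?_⟩
  have e1 := L.hull_le_of_forall ha.2.2 b (L.vertices_subset hb.1)
  have e2 := L.hull_le_of_forall hb.2.2 a (L.vertices_subset ha.1)
  simp only [cross, Prod.fst_sub, Prod.snd_sub] at e1 e2
  obtain ⟨f1, f2, f3⟩ := (mem_lss_iff_of_lt hqr).1 hp
  have a1 := mul_lt_mul_of_pos_right f3 (sub_pos.2 hab)
  have a2 := mul_le_mul_of_nonneg_right e1 (sub_pos.2 f2).le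
  have a3 := mul_le_mul_of_nonneg_right e2 (sub_pos.2 f1).le
  refine lt_of_mul_lt_mul_right ?_ (sub_pos.2 hqr).le
  linarith

theorem isExtremalFor_iff {P : Input n} {i : Fin k} {a : Fin n} :
    IsExtremalFor (L.dir i) P a ↔
      ∀ j, (P j).2 - L.slope i * (P j).1 ≤ (P a).2 - L.slope i * (P a).1 := by
  refine forall_congr' fun j => ?_
  have h1 := L.dot_sub_height i (P j)
  have h2 := L.dot_sub_height i (P a)
  have hv := L.upward i
  rw [← sub_le_sub_iff_right (L.height i), h1, h2, mul_le_mul_iff_right₀ hv]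
  constructor <;> intro h <;> linarith

theorem _root_.IsArgmax.fst_le {P : Input n} {E : Fin k → Fin n} (h : IsArgmax L P E) {i j : Fin k}
    (hij : i ≤ j) : (P (E i)).1 ≤ (P (E j)).1 := by
  rcases (L.slope_antitone hij).lt_or_eq with hs | hs
  · have h1 := isExtremalFor_iff.1 (h i).1 (E j)
    have h2 := isExtremalFor_iff.1 (h j).1 (E i)
    by_contra! hlt
    have := mul_lt_mul_of_pos_right hs (sub_pos.2 hlt)
    linarith
  · have : IsExtremalFor (L.dir j) P (E i) := by
      rw [isExtremalFor_iff, hs, ← isExtremalFor_iff]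
      exact (h i).1
    rw [(h j).2 _ this]

theorem _root_.IsArgmax.isExtremal {P : Input n} {E : Fin k → Fin n} (h : IsArgmax L P E)
    (i : Fin k) : IsExtremal P (E i) := (h i).1.isExtremal (L.upward i)

theorem _root_.IsArgmax.eq_of_fst_eq {P : Input n} {E : Fin k → Fin n} (h : IsArgmax L P E)
    {i j : Fin k} (hij : (P (E i)).1 = (P (E j)).1) : P (E i) = P (E j) :=
  Prod.ext hij (((h.isExtremal j) _ (subset_convexHull ℝ _ (mem_range_self _)) hij).antisymm
    ((h.isExtremal i) _ (subset_convexHull ℝ _ (mem_range_self _)) hij.symm))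

/-- Lines on which the tangents from the canonical extremal points touch the hull. -/
structure Touches (L : CanonicalLines k) (P : Input n) (E : Fin k → Fin n)
    (JL JR : Fin k → Fin k) : Prop where
  argmax : IsArgmax L P E
  above : ∀ i, L.AboveSupp i (P (E i))
  right : ∀ i, L.RightTouch (JR i) (P (E i))
  le_right : ∀ i, i ≤ JR i
  left : ∀ i, L.LeftTouch (JL i) (P (E i))
  left_le : ∀ i, JL i ≤ i

theorem Touches.false_of_between {P : Input n} {E : Fin k → Fin n} {JL JR : Fin k → Fin k}
    (h : L.Touches P E JL JR) {i i' : Fin k} {x : ℝ} (h1 : L.rightEnd (JR i) < (x : EReal))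
    (h2 : (x : EReal) < L.leftEnd (JL i'))
    (hadj : ∀ t, (P (E t)).1 ≤ (P (E i)).1 ∨ (P (E i')).1 ≤ (P (E t)).1) : False := by
  rcases (h.right i).cases with ⟨t, ht, hbt, ha, hea, -⟩ | ⟨-, -, h', -⟩
  swap
  · rw [h'] at h1; exact absurd le_top (not_le.2 h1)
  rcases (h.left i').cases with ⟨s, hs, hbs, hb, heb, -⟩ | ⟨-, -, h', -⟩
  swap
  · rw [h'] at h2; exact absurd bot_le (not_le.2 h2)
  rw [hea, EReal.coe_lt_coe_iff] at h1
  rw [heb, EReal.coe_lt_coe_iff] at h2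
  have hlt : JR i < s := by
    by_contra! hle
    exact absurd (hs.breakpoint_le ht hle) (not_le.2 (h1.trans h2))
  have hts : t ≤ s := Fin.le_def.2 (by have := ht.1; have := Fin.lt_def.1 hlt; omega)
  have c1 : i ≤ t :=
    Fin.le_def.2 (by have := ht.1; have := Fin.le_def.1 (h.le_right i); omega)
  have c2 : t ≤ i' :=
    Fin.le_def.2 (by
      have := hs.1; have := Fin.le_def.1 (h.left_le i'); have := Fin.le_def.1 hts; omega)
  have hat := h.above t
  unfold AboveSupp at hat
  rcases hadj t with hle | hle
  · rw [h.argmax.eq_of_fst_eq (hle.antisymm (h.argmax.fst_le c1))] at hat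
    exact lt_asymm hat hbt
  · rw [h.argmax.eq_of_fst_eq ((h.argmax.fst_le c2).antisymm hle)] at hat
    exact lt_asymm hat (hs.belowSupp_of_gt hbs hb.2.1.le hts)

theorem Touches.rightEnd_eq_top {P : Input n} {E : Fin k → Fin n} {JL JR : Fin k → Fin k}
    (h : L.Touches P E JL JR) {i : Fin k} (hadj : ∀ t, (P (E t)).1 ≤ (P (E i)).1) :
    L.rightEnd (JR i) = ⊤ := by
  rcases (h.right i).cases with ⟨t, ht, hbt, ha, hea, -⟩ | ⟨-, -, h', -⟩
  swap
  · exact h'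
  have c1 : i ≤ t :=
    Fin.le_def.2 (by have := ht.1; have := Fin.le_def.1 (h.le_right i); omega)
  have hat := h.above t
  rw [h.argmax.eq_of_fst_eq ((hadj t).antisymm (h.argmax.fst_le c1))] at hat
  exact (lt_asymm hat hbt).elim

theorem Touches.leftEnd_eq_bot {P : Input n} {E : Fin k → Fin n} {JL JR : Fin k → Fin k}
    (h : L.Touches P E JL JR) {i : Fin k} (hadj : ∀ t, (P (E i)).1 ≤ (P (E t)).1) :
    L.leftEnd (JL i) = ⊥ := by
  rcases (h.left i).cases with ⟨t, ht, hbt, ha, hea, -⟩ | ⟨-, -, h', -⟩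
  swap
  · exact h'
  have c1 : t ≤ i :=
    Fin.le_def.2 (by have := ht.1; have := Fin.le_def.1 (h.left_le i); omega)
  have hat := h.above t
  rw [h.argmax.eq_of_fst_eq ((h.argmax.fst_le c1).antisymm (hadj t))] at hat
  exact (lt_asymm hat hbt).elim

end CanonicalLines

/-! ### Computing certificates for the canonical hull -/

namespace LinTree

variable {n k : ℕ} (L : CanonicalLines k)

/-- Is the `i`-th point above the line of slope `s` and intercept `b`? -/
noncomputable def askAboveLine (b s : ℝ) (i : Fin n) : LinTree n Bool :=
  ask i (.fixed (0, b) (1, s) (by simp [Prod.ext_iff]))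

/-- Is the `i`-th point below the line of slope `s` and intercept `b`? -/
noncomputable def askBelowLine (b s : ℝ) (i : Fin n) : LinTree n Bool :=
  ask i (.fixed (0, b) (-1, -s) (by simp [Prod.ext_iff]))

theorem askAboveLine_true {P : Input n} {b s : ℝ} {i : Fin n}
    (h : (askAboveLine b s i).LeadsTo P true) : b + s * (P i).1 < (P i).2 := by
  have := mem_left_iff.1 (ask_true h)
  simp only at this
  linarith

theorem askAboveLine_false {P : Input n} {b s : ℝ} {i : Fin n}
    (h : (askAboveLine b s i).LeadsTo P false) : (P i).2 < b + s * (P i).1 := by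
  have := mem_right_iff.1 (ask_false h id)
  simp only at this
  linarith

theorem askBelowLine_true {P : Input n} {b s : ℝ} {i : Fin n}
    (h : (askBelowLine b s i).LeadsTo P true) : (P i).2 < b + s * (P i).1 := by
  have := mem_left_iff.1 (ask_true h)
  simp only at this
  linarith

theorem askBelowLine_false {P : Input n} {b s : ℝ} {i : Fin n}
    (h : (askBelowLine b s i).LeadsTo P false) : b + s * (P i).1 < (P i).2 := by
  have := mem_right_iff.1 (ask_false h id)
  simp only at this
  linarith

/-- Is the `i`-th point to the left of the vertical line at `x`? -/
noncomputable def askBefore (i : Fin n) (x : EReal) : LinTree n Bool :=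
  if x = ⊤ then leaf true else if x = ⊥ then leaf false else
    ask i (.fixed (x.toReal, 0) (0, 1) (by simp [Prod.ext_iff]))

theorem height_askBefore (i : Fin n) (x : EReal) : (askBefore i x).height ≤ 1 := by
  unfold askBefore
  split_ifs
  exacts [by simp [height], by simp [height], height_ask _ _]

theorem askBefore_true {P : Input n} {i : Fin n} {x : EReal}
    (h : (askBefore i x).LeadsTo P true) : ((P i).1 : EReal) < x := by
  unfold askBefore at h
  split_ifs at h with h1 h2
  · rw [h1]; exact EReal.coe_lt_top _
  · simp [LeadsTo] at h
  · rw [← EReal.coe_toReal h1 h2, EReal.coe_lt_coe_iff]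
    have := mem_left_iff.1 (ask_true h)
    simp only at this
    linarith

theorem askBefore_false {P : Input n} {i : Fin n} {x : EReal}
    (h : (askBefore i x).LeadsTo P false) : x < ((P i).1 : EReal) := by
  unfold askBefore at h
  split_ifs at h with h1 h2
  · simp [LeadsTo] at h
  · rw [h2]; exact EReal.bot_lt_coe _
  · rw [← EReal.coe_toReal h1 h2, EReal.coe_lt_coe_iff]
    have := mem_right_iff.1 (ask_false h id)
    simp only at this
    linarith

/-- Find the leaf slab that contains the `i`-th point. -/
noncomputable def leafSlab (i : Fin n) : LinTree n Slab :=
  (search (fun t => ask i (.fixed (L.vertexCoords.getD (t - 1) 0, 0) (0, -1)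
    (by simp [Prod.ext_iff]))) (Nat.clog 2 (k * k + 1)) 0 (L.vertexCoords.length + 1)).map fun j =>
      ⟨if j = 0 then ⊥ else (L.vertexCoords.getD (j - 1) 0 : EReal),
        if j = L.vertexCoords.length then ⊤ else (L.vertexCoords.getD j 0 : EReal)⟩

theorem height_leafSlab (i : Fin n) : (leafSlab L i).height ≤ Nat.clog 2 (k * k + 1) := by
  unfold leafSlab
  rw [height_map]
  exact height_search_le (fun _ => height_ask _ _) _ _ _

variable {L}

theorem leafSlab_spec {P : Input n} {i : Fin n} {S : Slab} (h : (leafSlab L i).LeadsTo P S) :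
    L.SlabValid P i S := by
  unfold leafSlab at h
  rw [leadsTo_map] at h
  obtain ⟨j, hj, rfl⟩ := h
  obtain ⟨-, h1, h2, h3⟩ := hj.of_search (by omega) (by
    have := L.length_vertexCoords_le
    exact (by omega : L.vertexCoords.length + 1 - 0 ≤ k * k + 1).trans
      (Nat.le_pow_clog one_lt_two _))
  have hmem : ∀ t, t < L.vertexCoords.length →
      ∃ a ∈ L.vertices, (L.vertexCoords.getD t 0 : EReal) = (a.1 : EReal) := fun t ht => by
    rw [List.getD_eq_getElem _ _ ht]
    obtain ⟨a, ha, h⟩ := L.mem_vertexCoords.1 (List.getElem_mem ht)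
    exact ⟨a, ha, by rw [h]⟩
  have hlo : j ≠ 0 → L.vertexCoords.getD (j - 1) 0 < (P i).1 := fun h0 => by
    have := mem_left_iff.1 (ask_true (h2.resolve_left h0))
    simp only at this
    linarith
  have hhi : j ≠ L.vertexCoords.length → (P i).1 < L.vertexCoords.getD j 0 := fun h0 => by
    have := mem_right_iff.1 (ask_false (h3.resolve_left (by omega)) id)
    simp only [Nat.add_sub_cancel] at this
    linarith
  set S : Slab := ⟨if j = 0 then ⊥ else (L.vertexCoords.getD (j - 1) 0 : EReal),
        if j = L.vertexCoords.length then ⊤ else (L.vertexCoords.getD j 0 : EReal)⟩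
  have hc : S.Contains (P i) := by
    constructor
    · show (if j = 0 then ⊥ else (L.vertexCoords.getD (j - 1) 0 : EReal)) < _
      split_ifs with h0
      exacts [EReal.bot_lt_coe _, EReal.coe_lt_coe_iff.2 (hlo h0)]
    · show _ < (if j = L.vertexCoords.length then ⊤ else (L.vertexCoords.getD j 0 : EReal))
      split_ifs with h0
      exacts [EReal.coe_lt_top _, EReal.coe_lt_coe_iff.2 (hhi h0)]
  have hs : L.IsSlab S := by
    refine ⟨hc.1.trans hc.2, ?_, ?_⟩
    · by_cases h0 : j = 0
      · exact Or.inl (if_pos h0)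
      · obtain ⟨a, ha, h⟩ := hmem (j - 1) (by omega)
        exact Or.inr ⟨a, ha, (if_neg h0).trans h⟩
    · by_cases h0 : j = L.vertexCoords.length
      · exact Or.inl (if_pos h0)
      · obtain ⟨a, ha, h⟩ := hmem j (by omega)
        exact Or.inr ⟨a, ha, (if_neg h0).trans h⟩
  refine ⟨hs, hc, Or.inl ⟨hs, fun a ha hca => ?_⟩⟩
  obtain ⟨s, hs, hsa⟩ := List.mem_iff_getElem.1 (L.mem_vertexCoords.2 ⟨a, ha, rfl⟩)
  have hmono : ∀ t (ht : t < L.vertexCoords.length), s < t →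
      L.vertexCoords[s] < L.vertexCoords[t] := fun t ht hst =>
    List.pairwise_iff_getElem.1 L.pairwise_vertexCoords s t hs ht hst
  have hmono' : ∀ t (ht : t < L.vertexCoords.length), t < s →
      L.vertexCoords[t] < L.vertexCoords[s] := fun t ht hst =>
    List.pairwise_iff_getElem.1 L.pairwise_vertexCoords t s ht hs hst
  rcases Nat.lt_or_ge s j with hsj | hsj
  · have h4 : S.lo = (L.vertexCoords.getD (j - 1) 0 : EReal) := if_neg (by omega)
    have h5 := hca.1
    rw [h4, EReal.coe_lt_coe_iff, List.getD_eq_getElem _ _ (by omega), ← hsa] at h5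
    rcases Nat.lt_or_ge s (j - 1) with h6 | h6
    · exact lt_asymm h5 (hmono _ _ h6)
    · obtain rfl : s = j - 1 := by omega
      exact lt_irrefl _ h5
  · have h4 : S.hi = (L.vertexCoords.getD j 0 : EReal) := if_neg (by omega)
    have h5 := hca.2
    rw [h4, EReal.coe_lt_coe_iff, List.getD_eq_getElem _ _ (by omega), ← hsa] at h5
    rcases Nat.lt_or_ge j s with h6 | h6
    · exact lt_asymm h5 (hmono' _ _ h6)
    · obtain rfl : s = j := by omega
      exact lt_irrefl _ h5

variable (L)

/-- Find the line where the right tangent from the `i`-th canonical extremal point touches. -/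
noncomputable def findRight (E : Fin k → Fin n) (i : Fin k) : LinTree n (Fin k) :=
  (search (fun t => if h : t < k then askAboveLine (L.supp ⟨t, h⟩) (L.slope ⟨t, h⟩) (E i)
    else leaf false) (Nat.clog 2 k) i k).map fun j => if h : j < k then ⟨j, h⟩ else i

/-- Find the line where the left tangent from the `i`-th canonical extremal point touches. -/
noncomputable def findLeft (E : Fin k → Fin n) (i : Fin k) : LinTree n (Fin k) :=
  (search (fun t => if h : t - 1 < k then askBelowLine (L.supp ⟨t - 1, h⟩) (L.slope ⟨t - 1, h⟩) (E i)
    else leaf false) (Nat.clog 2 k) 0 (i + 1)).map fun j => if h : j < k then ⟨j, h⟩ else i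

theorem height_findRight (E : Fin k → Fin n) (i : Fin k) :
    (findRight L E i).height ≤ Nat.clog 2 k := by
  unfold findRight
  rw [height_map]
  refine height_search_le (fun t => ?_) _ _ _
  split_ifs
  exacts [height_ask _ _, by simp [height]]

theorem height_findLeft (E : Fin k → Fin n) (i : Fin k) :
    (findLeft L E i).height ≤ Nat.clog 2 k := by
  unfold findLeft
  rw [height_map]
  refine height_search_le (fun t => ?_) _ _ _
  split_ifs
  exacts [height_ask _ _, by simp [height]]

variable {L}

theorem findRight_spec {P : Input n} {E : Fin k → Fin n} {i j : Fin k}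
    (h : (findRight L E i).LeadsTo P j) (hi : L.AboveSupp i (P (E i))) :
    L.RightTouch j (P (E i)) ∧ i ≤ j := by
  unfold findRight at h
  rw [leadsTo_map] at h
  obtain ⟨t, ht, rfl⟩ := h
  obtain ⟨h1, h2, h3, h4⟩ := ht.of_search i.2 ((Nat.sub_le _ _).trans (Nat.le_pow_clog one_lt_two _))
  rw [dif_pos h2]
  refine ⟨⟨?_, ?_⟩, h1⟩
  · rcases h3 with rfl | h3
    · exact hi
    · rw [dif_pos h2] at h3
      exact askAboveLine_true h3
  · rintro ⟨s, hs⟩ hst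
    obtain rfl : s = t + 1 := hst
    have h4 := h4.resolve_left (by omega)
    rw [dif_pos hs] at h4
    exact askAboveLine_false h4

theorem findLeft_spec {P : Input n} {E : Fin k → Fin n} {i j : Fin k}
    (h : (findLeft L E i).LeadsTo P j) (hi : L.AboveSupp i (P (E i))) :
    L.LeftTouch j (P (E i)) ∧ j ≤ i := by
  unfold findLeft at h
  rw [leadsTo_map] at h
  obtain ⟨t, ht, rfl⟩ := h
  obtain ⟨-, h2, h3, h4⟩ := ht.of_search (Nat.succ_pos _)
    ((by have := i.2; omega : (i : ℕ) + 1 - 0 ≤ k).trans (Nat.le_pow_clog one_lt_two _))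
  have h2' : t < k := by have := i.2; omega
  rw [dif_pos h2']
  refine ⟨⟨?_, ?_⟩, Fin.le_def.2 (by simp only; omega)⟩
  · rcases h4 with h4 | h4
    · obtain rfl : t = i := by omega
      exact hi
    · simp only [Nat.add_sub_cancel] at h4
      rw [dif_pos h2'] at h4
      exact askBelowLine_false h4
  · rintro ⟨s, hs⟩ hst
    obtain rfl : t = s + 1 := hst
    have h3 := h3.resolve_left (by omega)
    simp only [Nat.add_sub_cancel] at h3
    rw [dif_pos hs] at h3
    exact askBelowLine_true h3

end LinTree

namespace LinTree

variable {n k : ℕ} (L : CanonicalLines k)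

/-- The line of the right arm of an input point. -/
noncomputable def rightSpec (j : Fin k) (q : Fin n) : LineSpec n :=
  if (j : ℕ) + 1 < k then .pivot (L.breakpoint j) q
    else .slope q (-1, -L.slope j) (by simp [Prod.ext_iff])

/-- The line of the left arm of an input point. -/
noncomputable def leftSpec (j : Fin k) (q : Fin n) : LineSpec n :=
  if (j : ℕ) = 0 then .slope q (1, L.slope j) (by simp [Prod.ext_iff])
    else .pivot (L.breakpoint ((j : ℕ) - 1)) q

theorem line_rightSpec (P : Input n) (j : Fin k) (q : Fin n) :
    (rightSpec L j q).line P = L.rightLine j (P q) := by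
  unfold rightSpec CanonicalLines.rightLine
  split_ifs <;> rfl

theorem line_leftSpec (P : Input n) (j : Fin k) (q : Fin n) :
    (leftSpec L j q).line P = L.leftLine j (P q) := by
  unfold leftSpec CanonicalLines.leftLine
  split_ifs <;> rfl

theorem not_uses_rightSpec {p q : Fin n} (j : Fin k) (h : p ≠ q) :
    ¬ (rightSpec L j q).Uses p := by
  unfold rightSpec
  split_ifs <;> exact h

theorem not_uses_leftSpec {p q : Fin n} (j : Fin k) (h : p ≠ q) :
    ¬ (leftSpec L j q).Uses p := by
  unfold leftSpec
  split_ifs <;> exact h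

/-- Locate the point `p` with respect to the right arm of the canonical extremal point `i` to its
left, where the tangents are given by `JL` and `JR`. The result `none` means that the point is
outside the canonical hull. If the arm does not reach `p`, continue with `T`. -/
noncomputable def tryRight (E : Fin k → Fin n) (JL JR : Fin k → Fin k) (p : Fin n)
    (i : Option (Fin k)) (T : LinTree n (Option Slab)) : LinTree n (Option Slab) :=
  match i with
  | none => T
  | some i => (askBefore p (L.rightEnd (JR i))).bind fun b => if b then
      (ask p (rightSpec L (JR i) (E i))).map fun b =>
        if b then some ⟨L.leftEnd (JL i), L.rightEnd (JR i)⟩ else none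
      else T

/-- Locate the point `p` with respect to the left arm of the canonical extremal point `i` to its
right. -/
noncomputable def tryLeft (E : Fin k → Fin n) (JL JR : Fin k → Fin k) (p : Fin n)
    (i : Option (Fin k)) (T : LinTree n (Option Slab)) : LinTree n (Option Slab) :=
  match i with
  | none => T
  | some i => (askBefore p (L.leftEnd (JL i))).bind fun b => if b then T else
      (ask p (leftSpec L (JL i) (E i))).map fun b =>
        if b then none else some ⟨L.leftEnd (JL i), L.rightEnd (JR i)⟩

theorem height_tryRight (E : Fin k → Fin n) (JL JR : Fin k → Fin k) (p : Fin n)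
    (i : Option (Fin k)) (T : LinTree n (Option Slab)) :
    (tryRight L E JL JR p i T).height ≤ T.height + 2 := by
  unfold tryRight
  cases i with
  | none => simp
  | some i =>
    refine (height_bind_le (B := T.height + 1) fun b => ?_).trans
      (by have := height_askBefore p (L.rightEnd (JR i)); omega)
    split_ifs
    · rw [height_map]
      have := height_ask p (rightSpec L (JR i) (E i))
      omega
    · omega

theorem height_tryLeft (E : Fin k → Fin n) (JL JR : Fin k → Fin k) (p : Fin n)
    (i : Option (Fin k)) (T : LinTree n (Option Slab)) :
    (tryLeft L E JL JR p i T).height ≤ T.height + 2 := by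
  unfold tryLeft
  cases i with
  | none => simp
  | some i =>
    refine (height_bind_le (B := T.height + 1) fun b => ?_).trans
      (by have := height_askBefore p (L.leftEnd (JL i)); omega)
    split_ifs
    · omega
    · rw [height_map]
      have := height_ask p (leftSpec L (JL i) (E i))
      omega

variable {L}

/-- The located slab is valid, and points that were not located are outside the hull. -/
def LocatedValid (L : CanonicalLines k) (P : Input n) (p : Fin n) (o : Option Slab) : Prop :=
  (∀ S ∈ o, L.SlabValid P p S) ∧ (o = none → ∃ i, P p ∈ L.above i)

theorem tryRight_spec {P : Input n} {E : Fin k → Fin n} {JL JR : Fin k → Fin k} {p : Fin n}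
    {i : Option (Fin k)} {T : LinTree n (Option Slab)} {o : Option Slab}
    (h : (tryRight L E JL JR p i T).LeadsTo P o) (hE : L.Touches P E JL JR)
    (hp : ∀ i, p ≠ E i) (hi : ∀ i' ∈ i, (P (E i')).1 ≤ (P p).1) :
    LocatedValid L P p o ∨
      (T.LeadsTo P o ∧ ∀ i' ∈ i, L.rightEnd (JR i') < ((P p).1 : EReal)) := by
  cases i with
  | none => exact Or.inr ⟨h, by simp⟩
  | some i =>
    have hi := hi i rfl
    simp only [tryRight, leadsTo_bind] at h
    obtain ⟨b, hb, h⟩ := h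
    cases b with
    | false =>
      simp only [Bool.false_eq_true, if_false] at h
      refine Or.inr ⟨h, fun i' hi' => ?_⟩
      obtain rfl : i = i' := by simpa using hi'
      exact askBefore_false hb
    | true =>
      simp only [if_true, leadsTo_map] at h
      obtain ⟨b, hb', rfl⟩ := h
      refine Or.inl ?_
      have hlt := askBefore_true hb
      cases b with
      | true =>
        have := ask_true hb'
        rw [line_rightSpec] at this
        obtain ⟨h1, h2⟩ := (hE.right i).isPencil_of_right (hE.left i) hi hlt this
        have h3 := CanonicalLines.isPencilSlab (hE.left i) (hE.right i)
        refine ⟨fun S hS => ?_, by simp⟩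
        obtain rfl : _ = S := by simpa using hS
        exact ⟨h3.isSlab, h1, Or.inr (Or.inr ⟨E i, (hE.argmax.vExtremal_iff _).2 ⟨i, rfl⟩, h3, h2⟩)⟩
      | false =>
        have := ask_false hb' (not_uses_rightSpec L _ (hp i))
        rw [line_rightSpec] at this
        exact ⟨by simp, fun _ => (hE.right i).exists_above this⟩

theorem tryLeft_spec {P : Input n} {E : Fin k → Fin n} {JL JR : Fin k → Fin k} {p : Fin n}
    {i : Option (Fin k)} {T : LinTree n (Option Slab)} {o : Option Slab}
    (h : (tryLeft L E JL JR p i T).LeadsTo P o) (hE : L.Touches P E JL JR)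
    (hp : ∀ i, p ≠ E i) (hi : ∀ i' ∈ i, (P p).1 ≤ (P (E i')).1) :
    LocatedValid L P p o ∨
      (T.LeadsTo P o ∧ ∀ i' ∈ i, ((P p).1 : EReal) < L.leftEnd (JL i')) := by
  cases i with
  | none => exact Or.inr ⟨h, by simp⟩
  | some i =>
    have hi := hi i rfl
    simp only [tryLeft, leadsTo_bind] at h
    obtain ⟨b, hb, h⟩ := h
    cases b with
    | true =>
      simp only [if_true] at h
      refine Or.inr ⟨h, fun i' hi' => ?_⟩
      obtain rfl : i = i' := by simpa using hi'
      exact askBefore_true hb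
    | false =>
      simp only [Bool.false_eq_true, if_false, leadsTo_map] at h
      obtain ⟨b, hb', rfl⟩ := h
      refine Or.inl ?_
      have hlt := askBefore_false hb
      cases b with
      | false =>
        have := ask_false hb' (not_uses_leftSpec L _ (hp i))
        rw [line_leftSpec] at this
        obtain ⟨h1, h2⟩ := (hE.left i).isPencil_of_left (hE.right i) hi hlt this
        have h3 := CanonicalLines.isPencilSlab (hE.left i) (hE.right i)
        refine ⟨fun S hS => ?_, by simp⟩
        obtain rfl : _ = S := by simpa using hS
        exact ⟨h3.isSlab, h1, Or.inr (Or.inr ⟨E i, (hE.argmax.vExtremal_iff _).2 ⟨i, rfl⟩, h3, h2⟩)⟩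
      | true =>
        have := ask_true hb'
        rw [line_leftSpec] at this
        exact ⟨by simp, fun _ => (hE.left i).exists_above this⟩

variable (L)

/-- The slab between the right tangent of one and the left tangent of another canonical extremal
point. -/
noncomputable def middleSlab (JL JR : Fin k → Fin k) (x : Option (Fin k) × Option (Fin k)) : Slab :=
  ⟨match x.1 with | none => ⊥ | some i => L.rightEnd (JR i),
    match x.2 with | none => ⊤ | some i => L.leftEnd (JL i)⟩

/-- Locate the point `p` between canonical extremal points. -/
noncomputable def locate (E : Fin k → Fin n) (JL JR : Fin k → Fin k) (p : Fin n)
    (x : Option (Fin k) × Option (Fin k)) : LinTree n (Option Slab) :=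
  tryRight L E JL JR p x.1 (tryLeft L E JL JR p x.2 (leaf (some (middleSlab L JL JR x))))

theorem height_locate (E : Fin k → Fin n) (JL JR : Fin k → Fin k) (p : Fin n)
    (x : Option (Fin k) × Option (Fin k)) : (locate L E JL JR p x).height ≤ 4 := by
  unfold locate
  refine (height_tryRight L _ _ _ _ _ _).trans ?_
  have := height_tryLeft L E JL JR p x.2 (leaf (some (middleSlab L JL JR x)))
  simp only [height] at this
  omega

/-- A direction in which the given point is extremal. -/
noncomputable def dirOf (E : Fin k → Fin n) (a : Fin n) : Option (Fin k) := by
  classical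
  exact if h : ∃ i, E i = a then some h.choose else none

theorem mem_dirOf {E : Fin k → Fin n} {a : Fin n} {i : Fin k} (h : i ∈ dirOf E a) : E i = a := by
  unfold dirOf at h
  split_ifs at h with h0
  · obtain rfl : h0.choose = i := by simpa using h
    exact h0.choose_spec
  · simp at h

theorem exists_mem_dirOf (E : Fin k → Fin n) (i : Fin k) : ∃ i', dirOf E (E i) = some i' := by
  unfold dirOf
  rw [dif_pos ⟨i, rfl⟩]
  exact ⟨_, rfl⟩

/-- The canonical extremal points to the left and to the right of a point, where the list `l`
is sorted from left to right. -/
noncomputable def neighbors (E : Fin k → Fin n) (l : List (Fin n)) :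
    VInfo n → Option (Fin k) × Option (Fin k)
  | .witness q r => if l.idxOf q < l.idxOf r then (dirOf E q, dirOf E r)
      else (dirOf E r, dirOf E q)
  | .between e₁ e₂ => (e₁.bind (dirOf E), e₂.bind (dirOf E))

variable {L}

/-- The point `p` is below the segment between two canonical extremal points or horizontally
between two adjacent ones. -/
structure NeighborsValid (P : Input n) (E : Fin k → Fin n) (p : Fin n)
    (x : Option (Fin k) × Option (Fin k)) : Prop where
  left : ∀ i ∈ x.1, (P (E i)).1 ≤ (P p).1
  right : ∀ i ∈ x.2, (P p).1 ≤ (P (E i)).1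
  cases : (∃ i i', x = (some i, some i') ∧ (P (E i)).1 < (P (E i')).1 ∧
      P p ∈ lss (P (E i)) (P (E i'))) ∨
    ∀ t, (∃ i ∈ x.1, (P (E t)).1 ≤ (P (E i)).1) ∨ ∃ i ∈ x.2, (P (E i)).1 ≤ (P (E t)).1

theorem neighbors_spec {P : Input n} {E : Fin k → Fin n} {γ : VCert n} {p : Fin n}
    (hE : IsArgmax L P E) (hγ : γ.Valid L P) (hp : ¬ L.VExtremal P p) :
    NeighborsValid P E p (neighbors E γ.list (γ.info p)) := by
  have hinfo := hγ.2 p hp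
  have hdir : ∀ a, L.VExtremal P a → ∃ i, dirOf E a = some i ∧ E i = a := fun a ha => by
    obtain ⟨i, rfl⟩ := (hE.vExtremal_iff a).1 ha
    obtain ⟨i', hi'⟩ := exists_mem_dirOf E i
    exact ⟨i', hi', mem_dirOf hi'⟩
  cases h : γ.info p with
  | witness q r =>
    rw [h] at hinfo
    obtain ⟨hq, hr, hl⟩ := hinfo
    obtain ⟨i, hi, rfl⟩ := hdir q hq
    obtain ⟨i', hi', rfl⟩ := hdir r hr
    have hne := ne_of_mem_lss hl
    have key : ∀ i i' : Fin k, (P (E i)).1 < (P (E i')).1 → P p ∈ lss (P (E i)) (P (E i')) →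
        NeighborsValid P E p (some i, some i') := by
      intro i i' hlt hl
      have := (mem_lss_iff_of_lt hlt).1 hl
      exact ⟨by simpa using this.1.le, by simpa using this.2.1.le, Or.inl ⟨i, i', rfl, hlt, hl⟩⟩
    have hidx := hγ.1.idxOf_lt_iff ((hγ.1.1 _).2 hq) ((hγ.1.1 _).2 hr)
    simp only [neighbors]
    split_ifs with hif
    · rw [hi, hi']
      exact key _ _ (hidx.1 hif) hl
    · rw [hi, hi']
      rw [hidx] at hif
      exact key _ _ (lt_of_le_of_ne (not_lt.1 hif) hne.1.symm) (by rwa [lss_comm])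
  | between e₁ e₂ =>
    rw [h] at hinfo
    obtain ⟨h1, h2, -, h4⟩ := hinfo
    refine ⟨fun i hi => ?_, fun i hi => ?_, Or.inr fun t => ?_⟩
    · obtain ⟨a, ha, hi⟩ := Option.bind_eq_some_iff.1 hi
      rw [mem_dirOf hi]
      exact (h1 a ha).2
    · obtain ⟨a, ha, hi⟩ := Option.bind_eq_some_iff.1 hi
      rw [mem_dirOf hi]
      exact (h2 a ha).2
    · rcases h4 (E t) ((hE.vExtremal_iff _).2 ⟨t, rfl⟩) with ⟨e, he, hle⟩ | ⟨e, he, hle⟩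
      · obtain ⟨i, hi, rfl⟩ := hdir e (h1 e he).1
        exact Or.inl ⟨i, Option.bind_eq_some_iff.2 ⟨_, he, hi⟩, hle⟩
      · obtain ⟨i, hi, rfl⟩ := hdir e (h2 e he).1
        exact Or.inr ⟨i, Option.bind_eq_some_iff.2 ⟨_, he, hi⟩, hle⟩

theorem slabValid_middleSlab {P : Input n} {E : Fin k → Fin n} {JL JR : Fin k → Fin k}
    {p : Fin n} {x : Option (Fin k) × Option (Fin k)} (hE : L.Touches P E JL JR)
    (hx : NeighborsValid P E p x) (h1 : ∀ i ∈ x.1, L.rightEnd (JR i) < ((P p).1 : EReal))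
    (h2 : ∀ i ∈ x.2, ((P p).1 : EReal) < L.leftEnd (JL i)) :
    L.SlabValid P p (middleSlab L JL JR x) := by
  rcases hx.cases with ⟨i, i', rfl, hlt, hl⟩ | hadj
  · obtain ⟨a, b, c⟩ := CanonicalLines.belowSeg_of_mem_lss (hE.right i) (hE.left i') hl hlt
      (h1 i rfl) (h2 i' rfl)
    exact ⟨a, b, Or.inr (Or.inl c)⟩
  · obtain ⟨x₁, x₂⟩ := x
    cases x₁ with
    | none =>
      cases x₂ with
      | none =>
        have hk : IsEmpty (Fin k) := ⟨fun t => by simpa using hadj t⟩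
        have hv : L.vertices = ∅ := by
          refine eq_empty_of_forall_notMem fun a ha => ?_
          obtain ⟨i, -⟩ := L.exists_tight_of_mem_vertices ha
          exact hk.elim i
        have hs : L.IsSlab ⟨⊥, ⊤⟩ := ⟨bot_lt_top, Or.inl rfl, Or.inl rfl⟩
        exact ⟨hs, ⟨EReal.bot_lt_coe _, EReal.coe_lt_top _⟩, Or.inl ⟨hs, by simp [hv]⟩⟩
      | some i =>
        have := h2 i rfl
        rw [hE.leftEnd_eq_bot fun t => by simpa using hadj t] at this
        exact absurd bot_le (not_le.2 this)
    | some i =>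
      cases x₂ with
      | none =>
        have := h1 i rfl
        rw [hE.rightEnd_eq_top fun t => by simpa using hadj t] at this
        exact absurd le_top (not_le.2 this)
      | some i' =>
        exact (hE.false_of_between (h1 i rfl) (h2 i' rfl) fun t => by simpa using hadj t).elim

theorem locate_spec {P : Input n} {E : Fin k → Fin n} {JL JR : Fin k → Fin k} {p : Fin n}
    {x : Option (Fin k) × Option (Fin k)} {o : Option Slab}
    (h : (locate L E JL JR p x).LeadsTo P o) (hE : L.Touches P E JL JR)
    (hp : ∀ i, p ≠ E i) (hx : NeighborsValid P E p x) : LocatedValid L P p o := by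
  unfold locate at h
  rcases tryRight_spec h hE hp hx.left with h | ⟨h, h1⟩
  · exact h
  rcases tryLeft_spec h hE hp hx.right with h | ⟨h, h2⟩
  · exact h
  simp only [LeadsTo] at h
  subst h
  refine ⟨fun S hS => ?_, by simp⟩
  obtain rfl : _ = S := by simpa using hS
  exact slabValid_middleSlab hE hx h1 h2

variable (L)

open Classical in
/-- Locate all points, given the canonical extremal points and a `V`-extremal certificate. -/
noncomputable def locateAll (x : VCert n × (Fin k → Fin n)) : LinTree n (Fin n → Option Slab) :=
  (pi fun i => askAboveLine (L.icpt i) (L.slope i) (x.2 i)).bind fun g =>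
    if ∀ i, g i = true then
      (pi (findLeft L x.2)).bind fun JL => (pi (findRight L x.2)).bind fun JR =>
        pi fun p => if ∃ i, p = x.2 i then leaf (some ⟨⊥, ⊤⟩) else
          locate L x.2 JL JR p (neighbors x.2 x.1.list (x.1.info p))
    else leaf fun _ => none

theorem height_pi_le_mul {α : Type} {m B : ℕ} {t : Fin m → LinTree n α}
    (h : ∀ i, (t i).height ≤ B) : (pi t).height ≤ m * B :=
  (height_pi_le t).trans ((Finset.sum_le_sum fun i _ => h i).trans (by simp))

theorem height_locateAll (x : VCert n × (Fin k → Fin n)) :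
    (locateAll L x).height ≤ k + 2 * (k * Nat.clog 2 k) + 4 * n := by
  unfold locateAll
  refine (height_bind_le (B := 2 * (k * Nat.clog 2 k) + 4 * n) fun g => ?_).trans
    (by
      have := height_pi_le_mul (B := 1)
        (t := fun i => askAboveLine (L.icpt i) (L.slope i) (x.2 i)) fun _ => height_ask _ _
      omega)
  split_ifs
  · refine (height_bind_le (B := k * Nat.clog 2 k + 4 * n) fun JL => ?_).trans
      (by have := height_pi_le_mul (height_findLeft L x.2); omega)
    refine (height_bind_le (B := 4 * n) fun JR => ?_).trans
      (by have := height_pi_le_mul (height_findRight L x.2); omega)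
    refine (height_pi_le_mul (B := 4) fun p => ?_).trans (by omega)
    split_ifs
    · simp [height]
    · exact height_locate _ _ _ _ _ _
  · simp [height]

variable {L}

theorem locateAll_spec {P : Input n} {x : VCert n × (Fin k → Fin n)} {o : Fin n → Option Slab}
    (h : (locateAll L x).LeadsTo P o) (hE : IsArgmax L P x.2) (hx : x.1.Valid L P) :
    (∀ p, ¬ L.VExtremal P p → ∀ S ∈ o p, L.SlabValid P p S) ∧
      ((∀ i, ∃ j, P j ∈ L.above i) → ∀ p, o p = none → ∃ i, P p ∈ L.above i) := by
  unfold locateAll at h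
  rw [leadsTo_bind] at h
  obtain ⟨g, hg, h⟩ := h
  split_ifs at h with hif
  · have habove : ∀ i, L.AboveSupp i (P (x.2 i)) := fun i => by
      have := hg.of_pi i
      rw [hif i] at this
      exact L.above_supp (L.mem_above_iff.2 (askAboveLine_true this))
    rw [leadsTo_bind] at h
    obtain ⟨JL, hJL, h⟩ := h
    rw [leadsTo_bind] at h
    obtain ⟨JR, hJR, h⟩ := h
    have hT : L.Touches P x.2 JL JR :=
      ⟨hE, habove, fun i => (findRight_spec (hJR.of_pi i) (habove i)).1,
        fun i => (findRight_spec (hJR.of_pi i) (habove i)).2,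
        fun i => (findLeft_spec (hJL.of_pi i) (habove i)).1,
        fun i => (findLeft_spec (hJL.of_pi i) (habove i)).2⟩
    have hloc : ∀ p, ¬ (∃ i, p = x.2 i) → LocatedValid L P p (o p) := fun p hp => by
      have := h.of_pi p
      rw [if_neg hp] at this
      refine locate_spec this hT (fun i hi => hp ⟨i, hi⟩) (neighbors_spec hE hx ?_)
      rintro hv
      obtain ⟨i, hi⟩ := (hE.vExtremal_iff p).1 hv
      exact hp ⟨i, hi.symm⟩
    refine ⟨fun p hp => (hloc p ?_).1, fun _ p hp => ?_⟩
    · rintro ⟨i, rfl⟩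
      exact hp ((hE.vExtremal_iff _).2 ⟨i, rfl⟩)
    · by_cases hv : ∃ i, p = x.2 i
      · have := h.of_pi p
        rw [if_pos hv, hp] at this
        simp [LeadsTo] at this
      · exact (hloc p hv).2 hp
  · simp only [LeadsTo] at h
    subst h
    refine ⟨by simp, fun hall => absurd (fun i => ?_) hif⟩
    by_contra hgi
    have := hg.of_pi i
    rw [Bool.not_eq_true] at hgi
    rw [hgi] at this
    have h1 := askAboveLine_false this
    obtain ⟨j, hj⟩ := hall i
    have h2 := L.mem_above_iff.1 hj
    have h3 := CanonicalLines.isExtremalFor_iff.1 (hE i).1 j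
    linarith

variable (L)

/-- Compute a certificate for the canonical hull from a `V`-extremal certificate. -/
noncomputable def toCanonical (x : VCert n × (Fin k → Fin n)) : LinTree n (CanonicalCert n) :=
  (locateAll L x).bind fun o => (pi fun p => match o p with
    | none => leafSlab L p
    | some S => leaf S).map fun s => ⟨x.1.list, s⟩

variable {L}

theorem toCanonical_spec {P : Input n} {x : VCert n × (Fin k → Fin n)} {γ : CanonicalCert n}
    (h : (toCanonical L x).LeadsTo P γ) (hE : IsArgmax L P x.2) (hx : x.1.Valid L P) :
    γ.Valid L P := by
  unfold toCanonical at h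
  rw [leadsTo_bind] at h
  obtain ⟨o, ho, h⟩ := h
  rw [leadsTo_map] at h
  obtain ⟨s, hs, rfl⟩ := h
  refine ⟨hx.1, fun p hp => ?_⟩
  have hsp := hs.of_pi p
  cases hop : o p with
  | none =>
    rw [hop] at hsp
    exact leafSlab_spec hsp
  | some S =>
    rw [hop] at hsp
    obtain rfl : S = s p := hsp
    exact (locateAll_spec ho hE hx).1 p hp _ hop

open Classical in
theorem leafDepth_toCanonical_le {P : Input n} {x : VCert n × (Fin k → Fin n)}
    (h : (locateAll L x).LeadsTo P ((locateAll L x).eval P)) (hE : IsArgmax L P x.2)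
    (hx : x.1.Valid L P) :
    (toCanonical L x).leafDepth P ≤ k + 2 * (k * Nat.clog 2 k) + 4 * n +
      Nat.clog 2 (k * k + 1) * if ∀ i, ∃ j, P j ∈ L.above i then
        (Finset.univ.filter fun p => ∃ i, P p ∈ L.above i).card else n := by
  unfold toCanonical
  rw [leafDepth_bind, leafDepth_map, leafDepth_pi]
  refine Nat.add_le_add ((leafDepth_le_height _ _).trans (height_locateAll L x)) ?_
  set o := (locateAll L x).eval P
  have h1 : ∀ p, (match o p with
      | none => leafSlab L p
      | some S => leaf S).leafDepth P ≤ if o p = none then Nat.clog 2 (k * k + 1) else 0 := by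
    intro p
    cases o p with
    | none => simpa using (leafDepth_le_height _ _).trans (height_leafSlab L p)
    | some S => simp [leafDepth]
  refine (Finset.sum_le_sum fun p _ => h1 p).trans ?_
  rw [← Finset.sum_filter, Finset.sum_const, smul_eq_mul, mul_comm]
  refine Nat.mul_le_mul_left _ ?_
  split_ifs with hall
  · refine Finset.card_le_card fun p hp => ?_
    simp only [Finset.mem_filter, Finset.mem_univ, true_and] at hp ⊢
    exact (locateAll_spec h hE hx).2 hall p hp
  · exact (Finset.card_le_univ _).trans (by simp)

end LinTree

/-! ### The cost of locating the points -/

theorem LinTree.LeadsTo.eq_eval {n : ℕ} {α : Type} {P : Input n} {T : LinTree n α} {a : α}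
    (h : T.LeadsTo P a) : T.eval P = a := by
  induction T with
  | leaf b => exact h
  | node q l r hl hr =>
    rcases h with ⟨h1, h2⟩ | ⟨h1, h2⟩
    · simp only [eval, if_pos h1, hl h2]
    · have : ¬ q.IsLeft P := fun h => DirLine.not_mem_right h h1
      simp only [eval, if_neg this, hr h2]

namespace CanonicalLines

variable {n k : ℕ} (L : CanonicalLines k)

theorem measurableSet_above (i : Fin k) : MeasurableSet (L.above i) :=
  measurableSet_lt measurable_const (by unfold dot; fun_prop)

/-- The inputs with at least one and at most `m` points above the `i`-th canonical line. -/
def goodInputs (n : ℕ) (i : Fin k) (m : ℝ) : Set (Input n) :=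
  {P | 1 ≤ {j : Fin n | P j ∈ L.above i}.ncard ∧ ({j : Fin n | P j ∈ L.above i}.ncard : ℝ) ≤ m}

theorem measurableSet_goodInputs (i : Fin k) (m : ℝ) : MeasurableSet (L.goodInputs n i m) := by
  classical
  have h : Measurable fun P : Input n => {j : Fin n | P j ∈ L.above i}.ncard := by
    have : (fun P : Input n => {j : Fin n | P j ∈ L.above i}.ncard) =
        fun P => ∑ j, if P j ∈ L.above i then 1 else 0 := by
      funext P
      rw [Set.ncard_eq_toFinset_card', Finset.sum_boole]
      simp
    rw [this]
    exact Finset.measurable_sum _ fun j _ => Measurable.ite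
      (measurable_pi_apply j (L.measurableSet_above i)) measurable_const measurable_const
  exact h (t := {t : ℕ | 1 ≤ t ∧ (t : ℝ) ≤ m}) (by measurability)

open Classical in
theorem card_above_le {P : Input n} {m : ℝ} (h : ∀ i, P ∈ L.goodInputs n i m) :
    ((Finset.univ.filter fun p => ∃ i, P p ∈ L.above i).card : ℝ) ≤ k * m := by
  have h1 : (Finset.univ.filter fun p => ∃ i, P p ∈ L.above i) ⊆
      Finset.univ.biUnion fun i => Finset.univ.filter fun p => P p ∈ L.above i := by
    intro p hp
    simpa using hp
  have h2 : ((Finset.univ.filter fun p => ∃ i, P p ∈ L.above i).card : ℝ) ≤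
      ∑ i, ((Finset.univ.filter fun p => P p ∈ L.above i).card : ℝ) := by
    exact_mod_cast (Finset.card_le_card h1).trans Finset.card_biUnion_le
  have h3 : ∑ _i : Fin k, m = k * m := by simp
  refine h2.trans (le_of_le_of_eq (Finset.sum_le_sum fun i _ => ?_) h3)
  have := (h i).2
  rwa [Set.ncard_eq_toFinset_card', show {j : Fin n | P j ∈ L.above i}.toFinset =
    Finset.univ.filter fun p => P p ∈ L.above i by ext; simp] at this

end CanonicalLines

namespace LinTree

variable {n k : ℕ} {L : CanonicalLines k} {D : Fin n → Measure Plane}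
  [∀ i, IsProbabilityMeasure (D i)]

theorem measure_compl_goodInputs_le {c K : ℝ} (h : SuccessfulLearning D L c K) (i : Fin k) :
    Measure.pi D (L.goodInputs n i (c * Real.log n))ᶜ ≤ ENNReal.ofReal (1 / (n : ℝ) ^ 3) := by
  have h1 : 1 - 1 / (n : ℝ) ^ 3 ≤ (Measure.pi D).real (L.goodInputs n i (c * Real.log n)) := h.2 i
  have h2 := probReal_compl_eq_one_sub (μ := Measure.pi D)
    (L.measurableSet_goodInputs (n := n) i (c * Real.log n))
  rw [← ofReal_measureReal]
  exact ENNReal.ofReal_le_ofReal (by linarith)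

theorem expectedDepth_toCanonical_le (hD : ∀ i, IsContinuousDist (D i)) {c K : ℝ}
    (hL : SuccessfulLearning D L c K) (T : LinTree n (VCert n × (Fin k → Fin n)))
    (hT : ∀ P x, T.LeadsTo P x → x.1.Valid L P ∧ IsArgmax L P x.2) :
    (T.bind (toCanonical L)).expectedDepth D ≤ T.expectedDepth D +
      ((k + 2 * (k * Nat.clog 2 k) + 4 * n : ℕ) + (Nat.clog 2 (k * k + 1) : ℕ) *
        (ENNReal.ofReal (k * (|c| * Real.log n)) + n * (k * ENNReal.ofReal (1 / (n : ℝ) ^ 3)))) := by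
  classical
  set m := c * Real.log n with hm
  set bad : Set (Input n) := ⋃ i, (L.goodInputs n i m)ᶜ with hbad
  have hbm : MeasurableSet bad := MeasurableSet.iUnion fun i => (L.measurableSet_goodInputs i m).compl
  have hbμ : Measure.pi D bad ≤ k * ENNReal.ofReal (1 / (n : ℝ) ^ 3) := by
    refine (measure_iUnion_le _).trans ?_
    rw [tsum_fintype]
    refine (Finset.sum_le_sum fun i _ => measure_compl_goodInputs_le hL i).trans ?_
    simp
  set g : Input n → ℝ≥0∞ := fun P => ((k + 2 * (k * Nat.clog 2 k) + 4 * n : ℕ) : ℝ≥0∞) +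
    (Nat.clog 2 (k * k + 1) : ℕ) *
      (ENNReal.ofReal (k * (|c| * Real.log n)) + n * bad.indicator 1 P) with hg
  have hgm : Measurable g :=
    (((measurable_one.indicator hbm).const_mul _).const_add _).const_mul _ |>.const_add _
  have hle : ∀ᵐ P ∂(Measure.pi D), ((T.bind (toCanonical L)).leafDepth P : ℝ≥0∞) ≤
      T.leafDepth P + g P := by
    filter_upwards [T.ae_leadsTo_eval hD, (T.bind (locateAll L)).ae_leadsTo_eval hD] with P h1 h2
    obtain ⟨hx, hE⟩ := hT P _ h1
    rw [leadsTo_bind] at h2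
    obtain ⟨a, ha, h2⟩ := h2
    rw [eval_bind, ← ha.eq_eval] at h2
    rw [leafDepth_bind, Nat.cast_add]
    refine add_le_add le_rfl ?_
    refine (Nat.cast_le.2 (leafDepth_toCanonical_le h2 hE hx)).trans ?_
    rw [Nat.cast_add, Nat.cast_mul, hg]
    refine add_le_add le_rfl (mul_le_mul_right ?_ _)
    by_cases hP : P ∈ bad
    · rw [indicator_of_mem hP, Pi.one_apply, mul_one]
      refine le_add_left (Nat.cast_le.2 ?_)
      split_ifs
      · exact (Finset.card_le_univ _).trans (by simp)
      · exact le_rfl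
    · have hgood : ∀ i, P ∈ L.goodInputs n i m := by simpa [hbad] using hP
      have hall : ∀ i, ∃ j, P j ∈ L.above i := fun i => 
        Set.nonempty_of_ncard_ne_zero (Nat.one_le_iff_ne_zero.1 (hgood i).1)
      rw [if_pos hall]
      refine le_add_right ?_
      rw [← ENNReal.ofReal_natCast]
      refine ENNReal.ofReal_le_ofReal ((L.card_above_le hgood).trans ?_)
      have := mul_le_mul_of_nonneg_right (le_abs_self c) (Real.log_natCast_nonneg n)
      gcongr
  calc (T.bind (toCanonical L)).expectedDepth D
      ≤ ∫⁻ P, (T.leafDepth P + g P) ∂(Measure.pi D) := lintegral_mono_ae hle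
    _ = T.expectedDepth D + ∫⁻ P, g P ∂(Measure.pi D) := lintegral_add_right _ hgm
    _ ≤ _ := by
      gcongr
      rw [hg, lintegral_add_left measurable_const,
        lintegral_const_mul _ (((measurable_one.indicator hbm).const_mul _).const_add _),
        lintegral_add_left measurable_const,
        lintegral_const_mul _ (measurable_one.indicator hbm), lintegral_indicator_one hbm]
      simp only [lintegral_const, measure_univ, mul_one]
      gcongr

end LinTree

/-! ### Numerical bounds -/

theorem half_lt_log_natCast {n : ℕ} (hn : 2 ≤ n) : 1 / 2 < Real.log n := by
  have h1 : Real.log 2 ≤ Real.log n := Real.log_le_log (by norm_num) (by exact_mod_cast hn)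
  have := Real.log_two_gt_d9
  linarith

theorem clog_le_log {m : ℕ} {x : ℝ} (hm : 1 ≤ m) (hx : Real.log m ≤ x) :
    (Nat.clog 2 m : ℝ) ≤ 2 * x + 1 := by
  have h0 : 0 ≤ Real.log m := Real.log_natCast_nonneg m
  rcases hm.eq_or_lt with rfl | hm
  · simp at h0 hx ⊢
    linarith
  have h1 := Nat.pow_pred_clog_lt_self one_lt_two hm
  have h2 : Real.log ((2 : ℝ) ^ (Nat.clog 2 m).pred) ≤ Real.log m :=
    Real.log_le_log (by positivity) (by exact_mod_cast h1.le)
  rw [Real.log_pow] at h2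
  have h3 : (Nat.clog 2 m : ℝ) ≤ (Nat.clog 2 m).pred + 1 := by
    exact_mod_cast Nat.le_succ_of_pred_le le_rfl
  have h4 := Real.log_two_gt_d9
  have h5 : (0 : ℝ) ≤ (Nat.clog 2 m).pred := Nat.cast_nonneg _
  have h6 : ((Nat.clog 2 m).pred : ℝ) * (1 / 2) ≤ (Nat.clog 2 m).pred * Real.log 2 := by
    gcongr; linarith
  linarith

theorem exists_cost_bound (c K : ℝ) : ∃ B : ℝ, 0 ≤ B ∧ ∀ n k : ℕ, 2 ≤ n →
    (k : ℝ) ≤ K * (n / (Real.log n) ^ 2) →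
    (k * Nat.clog 2 n + n * 2 : ℝ) ≤ B * n ∧
    (k + 2 * (k * Nat.clog 2 k) + 4 * n + Nat.clog 2 (k * k + 1) *
      (k * (|c| * Real.log n) + n * (k * (1 / (n : ℝ) ^ 3))) : ℝ) ≤ B * n := by
  set M : ℝ := 16 * |K| ^ 2 + 1 with hM
  have hM1 : 1 ≤ M := by
    have : 0 ≤ |K| ^ 2 := by positivity
    linarith
  have hlM : 0 ≤ Real.log M := Real.log_nonneg hM1
  set C : ℝ := 4 * Real.log M + 6 with hC
  have hC0 : 0 ≤ C := by rw [hC]; positivity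
  refine ⟨4 * |K| + 8 * (C * |K|) + C * |c| * |K| + 6, by positivity, fun n k hn hk => ?_⟩
  set l := Real.log n with hl
  have hl2 : 1 / 2 < l := half_lt_log_natCast hn
  have hn1 : (1 : ℝ) ≤ n := by exact_mod_cast (by omega : 1 ≤ n)
  have hk0 : (0 : ℝ) ≤ k := Nat.cast_nonneg k
  have hkl : k * l ^ 2 ≤ |K| * n := by
    have h1 : (k : ℝ) * l ^ 2 ≤ K * (n / l ^ 2) * l ^ 2 := by gcongr
    have h2 : K * (n / l ^ 2) * l ^ 2 = K * n := by field_simp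
    have h3 : K * n ≤ |K| * n := by gcongr; exact le_abs_self K
    linarith
  have hkl1 : k * l ≤ 2 * (|K| * n) := by
    have : (k * l) * (1 / 2) ≤ (k * l) * l := by gcongr
    linarith
  have hkn : (k : ℝ) ≤ 4 * (|K| * n) := by
    have : (k : ℝ) * (1 / 2) ≤ k * l := by gcongr
    linarith
  have hb : (Nat.clog 2 (k * k + 1) : ℝ) ≤ C * l := by
    have h1 : ((k * k + 1 : ℕ) : ℝ) ≤ M * (n : ℝ) ^ 2 := by
      have : (k : ℝ) * k ≤ 4 * (|K| * n) * (4 * (|K| * n)) := by gcongr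
      have : (1 : ℝ) ≤ (n : ℝ) ^ 2 := one_le_pow₀ hn1
      push_cast
      rw [hM]
      linarith
    have h2 : Real.log (k * k + 1 : ℕ) ≤ Real.log M + 2 * l := by
      refine (Real.log_le_log (by positivity) h1).trans_eq ?_
      rw [Real.log_mul (by linarith) (by positivity), Real.log_pow]
      norm_num [hl]
    have h3 := clog_le_log (Nat.le_add_left 1 _) h2
    have h4 : Real.log M * 1 ≤ Real.log M * (2 * l) := by gcongr; linarith
    rw [hC]
    linarith
  have hbn : (Nat.clog 2 n : ℝ) ≤ C * l := by
    have h1 := clog_le_log (by omega) hl.symm.le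
    have h2 : 4 * l ≤ C * l := by gcongr; linarith
    linarith
  have hbk : (Nat.clog 2 k : ℝ) ≤ C * l := by
    refine le_trans (Nat.cast_le.2 (Nat.clog_mono_right 2 ?_)) hb
    nlinarith
  have hkC : k * (C * l) ≤ 2 * (C * |K|) * n := by
    have := mul_le_mul_of_nonneg_left hkl1 hC0
    linarith
  have hP : 0 ≤ C * |K| * n := by positivity
  have hQ : 0 ≤ |K| * n := by positivity
  have hR : 0 ≤ C * |c| * |K| * n := by positivity
  constructor
  · have h1 : k * (Nat.clog 2 n : ℝ) ≤ k * (C * l) := by gcongr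
    linarith
  · have h1 : k * (Nat.clog 2 k : ℝ) ≤ k * (C * l) := by gcongr
    have h2 : (n : ℝ) * (k * (1 / (n : ℝ) ^ 3)) ≤ k := by
      have : (n : ℝ) * (k * (1 / (n : ℝ) ^ 3)) = k * (1 / (n : ℝ) ^ 2) := by
        field_simp
      rw [this]
      refine mul_le_of_le_one_right hk0 ?_
      rw [div_le_one (by positivity)]
      exact one_le_pow₀ hn1
    have h3 : Nat.clog 2 (k * k + 1) * (k * (|c| * l) + n * (k * (1 / (n : ℝ) ^ 3))) ≤
        C * l * (k * (|c| * l) + k) := by gcongr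
    have h4 : C * |c| * (k * l ^ 2) ≤ C * |c| * (|K| * n) := by gcongr
    linarith

theorem mainTheorem5 (c K : ℝ) :
    ∃ A : ℝ≥0, ∀ (n k : ℕ), 2 ≤ n →
      ∀ (D : Fin n → Measure Plane) [∀ i, IsProbabilityMeasure (D i)],
      (∀ i, IsContinuousDist (D i)) →
      ∀ L : CanonicalLines k, SuccessfulLearning D L c K →
      ∀ T : LinTree n (HullCert n), T.Computes HullCert.Valid →
        -- the entropy-sensitive tree
        (∃ T' : LinTree n (CanonicalCert n),
          T'.EntropySensitive D ∧ T'.Computes (CanonicalCert.Valid L) ∧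
          T'.expectedDepth D ≤ A * (n + T.expectedDepth D)) ∧
        -- the successive conversions of the certificates
        (∃ (T₁ : LinTree n (HullCert n)) (T₂ : LinTree n (VCert n))
            (T₃ : LinTree n (CanonicalCert n)),
          T₁.Computes HullCert.ValidExtremal ∧
          T₁.expectedDepth D ≤ T.expectedDepth D + A * n ∧
          T₂.Computes (VCert.Valid L) ∧
          T₂.expectedDepth D ≤ T₁.expectedDepth D + A * n ∧
          T₃.Computes (CanonicalCert.Valid L) ∧
          T₃.expectedDepth D ≤ T₂.expectedDepth D + A * n) := by
  obtain ⟨B, hB0, hB⟩ := exists_cost_bound c K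
  set A₀ : ℝ≥0 := 24 + B.toNNReal with hA₀
  refine ⟨1889 * (1 + 3 * A₀), fun n k hn D _ hD L hL T hT => ?_⟩
  obtain ⟨hB1, hB2⟩ := hB n k hn hL.1
  set i₀ : Fin n := ⟨0, by omega⟩
  set T₁ : LinTree n (HullCert n) := T.bind LinTree.toExtremal with hT₁
  set U : LinTree n (VCert n × (Fin k → Fin n)) := T₁.bind (LinTree.toVExtremal L i₀) with hU
  set T₂ : LinTree n (VCert n) := U.map Prod.fst with hT₂
  set T₃ : LinTree n (CanonicalCert n) := U.bind (LinTree.toCanonical L) with hT₃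
  have v₁ : T₁.Computes HullCert.ValidExtremal := fun P γ h => by
    rw [hT₁, LinTree.leadsTo_bind] at h
    obtain ⟨a, ha, h⟩ := h
    exact LinTree.toExtremal_spec (hT P a ha) h
  have vU : ∀ P x, U.LeadsTo P x → x.1.Valid L P ∧ IsArgmax L P x.2 := fun P x h => by
    rw [hU, LinTree.leadsTo_bind] at h
    obtain ⟨a, ha, h⟩ := h
    exact LinTree.toVExtremal_spec (v₁ P a ha) h
  have v₂ : T₂.Computes (VCert.Valid L) := fun P γ h => by
    rw [hT₂, LinTree.leadsTo_map] at h
    obtain ⟨a, ha, rfl⟩ := h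
    exact (vU P a ha).1
  have v₃ : T₃.Computes (CanonicalCert.Valid L) := fun P γ h => by
    rw [hT₃, LinTree.leadsTo_bind] at h
    obtain ⟨a, ha, h⟩ := h
    exact LinTree.toCanonical_spec h (vU P a ha).2 (vU P a ha).1
  have hBA : ENNReal.ofReal (B * n) ≤ A₀ * n := by
    rw [ENNReal.ofReal_mul hB0, ENNReal.ofReal_natCast, ENNReal.ofReal, hA₀]
    gcongr
    exact le_add_self
  have d₁ : T₁.expectedDepth D ≤ T.expectedDepth D + A₀ * n := by
    refine (LinTree.expectedDepth_bind_le LinTree.height_toExtremal).trans ?_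
    gcongr
    rw [Nat.cast_mul, hA₀]
    gcongr
    push_cast
    exact le_self_add
  have dU : U.expectedDepth D ≤ T₁.expectedDepth D + A₀ * n := by
    refine (LinTree.expectedDepth_bind_le (LinTree.height_toVExtremal L i₀)).trans ?_
    gcongr
    refine le_trans ?_ hBA
    rw [← ENNReal.ofReal_natCast]
    exact ENNReal.ofReal_le_ofReal (by exact_mod_cast hB1)
  have d₂ : T₂.expectedDepth D ≤ T₁.expectedDepth D + A₀ * n :=
    (LinTree.expectedDepth_map D U _).trans_le dU
  have d₃ : T₃.expectedDepth D ≤ U.expectedDepth D + A₀ * n := by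
    refine (LinTree.expectedDepth_toCanonical_le hD hL U vU).trans ?_
    gcongr
    refine le_trans (le_of_eq ?_) ((ENNReal.ofReal_le_ofReal hB2).trans hBA)
    have hlog := Real.log_natCast_nonneg n
    rw [ENNReal.ofReal_add (by positivity) (by positivity),
      ENNReal.ofReal_mul (p := (Nat.clog 2 (k * k + 1) : ℝ)) (by positivity),
      ENNReal.ofReal_add (p := k * (|c| * Real.log n)) (by positivity) (by positivity),
      ENNReal.ofReal_mul (p := (n : ℝ)) (by positivity),
      ENNReal.ofReal_mul (p := (k : ℝ)) (q := 1 / (n : ℝ) ^ 3) (by positivity)]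
    simp only [ENNReal.ofReal_natCast]
    rw [← ENNReal.ofReal_natCast (k + 2 * (k * Nat.clog 2 k) + 4 * n)]
    push_cast
    rfl
  have hA : (A₀ : ℝ≥0∞) ≤ (1889 * (1 + 3 * A₀) : ℝ≥0) := by
    refine ENNReal.coe_le_coe.2 ?_
    rw [← NNReal.coe_le_coe]
    push_cast
    have := A₀.2
    have : (0 : ℝ) ≤ A₀ := A₀.2
    linarith
  obtain ⟨T', s', l', d'⟩ := LinTree.exists_entropySensitive hD T₃
  refine ⟨⟨T', s', fun P γ h => v₃ P γ (l' P γ h), d'.trans ?_⟩, T₁, T₂, T₃, v₁,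
    d₁.trans (by gcongr), v₂, d₂.trans (by gcongr), v₃, ?_⟩
  · have h1 : T₃.expectedDepth D ≤ T.expectedDepth D + 3 * A₀ * n := by
      refine d₃.trans ((add_le_add_left (dU.trans (add_le_add_left d₁ _)) _).trans_eq ?_)
      ring
    calc 1889 * T₃.expectedDepth D ≤ 1889 * (T.expectedDepth D + 3 * A₀ * n) := by gcongr
      _ ≤ 1889 * ((1 + 3 * A₀) * T.expectedDepth D + (1 + 3 * A₀) * n) := by
        gcongr
        · exact le_mul_of_one_le_left zero_le le_self_add
        · exact le_add_self
      _ = _ := by push_cast; ring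
  · rw [hT₂, LinTree.expectedDepth_map]
    exact d₃.trans (by gcongr)
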